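/- **Theorem (Radon–Nikodym realization for $\Sigma_A$).** *Setting.* Let $A$ be an $r\times r$ matrix of $0$'s and $1$'s, $\Sigma_A=\{x\in\{1,\dots,r\}^{\mathbb Z} : A_{x_ix_{i+1}}=1 \text{ for all } i\}$ with the metric $d(x,y)=\sum_{x_i\ne y_i}2^{-|i|}$ and the shift $(\sigma x)_i=x_{i+1}$, and assume that $\sigma$ is transitive: some point has a dense forward orbit $\{\sigma^n x : n\ge 0\}$. The reduced Hölder class $\langle\phi\rangle_*$ of a Hölder function $\phi:\Sigma_A\to\mathbb R$ is the set of Hölder functions $\phi+u\circ\sigma-u+K$ with $u$ Hölder and $K\in\mathbb R$ constant. For $0<\epsilon\le 1$ put $W^s_\epsilon(x)=\{y: d(\sigma^nx,\sigma^ny)<\epsilon\ \forall n\ge0\}$, $W^u_\epsilon(x)=\{y: d(\sigma^{-n}x,\sigma^{-n}y)<\epsilon\ \forall n\ge0\}$. If $w_0=z_0$, let $[w,z]$ be the point with the coordinates $i\le 0$ of $w$ and $i\ge 0$ of $z$. The flow-box $B_\epsilon(x)$ is the set of all $[w,z]$ with $w\in W^s_\epsilon(x)$, $z\in W^u_\epsilon(x)$;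 the projection of it onto its unstable factor is $p\mapsto[x,p]\in W^u_\epsilon(x)$. A *small transversal* (to the stable foliation) is a set $\{[\tau(z),z]: z\in W^u_\epsilon(x)\}$ with $\tau:W^u_\epsilon(x)\to W^s_\epsilon(x)$ continuous; e.g. $W^u_\epsilon(x)$ itself. A function on a subset of a transversal is called *Hölder* if it is Hölder for the distance $\sum_{i\ge0,\,z_i\neq w_i}2^{-i}$, i.e. for $d$ after projection to the unstable factor. The *holonomy pseudogroup* is generated, under restriction to open subsets, inversion and composition, by the projections $T\cap B_\epsilon(x)\to W^u_\epsilon(x)$ of small transversals $T$, and by the conjugating homeomorphisms $W^u_\epsilon(x)\to W^u_\epsilon(y)$, where $x_i=y_i$ for all $i\ge n$ and $\epsilon\le2^{-n}$, sending $z$ to the point with coordinates $y_i$ for $i\le n$ and $z_i$ for $i\ge n$. A *transverse Hölder measure class* $\boldsymbol\mu$ assigns to each small transversal $T$ the class of a finite Borel measure on $T$ modulo equivalence with Radon–Nikodym derivative $e^{u}$, $u$ Hölder, such that each holonomy transformation $h:S\to S'$, with $S\subset T$ and $S'\subset T'$, carries representatives on $T$ to representatives on $T'$ with derivative $d\mu'(h(x))/d\mu(x)=e^{u(x)}$,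 $u$ Hölder on $S$; we require that $\boldsymbol\mu$ is not identically zero. It is *shift-invariant* if the same holds for $\sigma:T\to\sigma(T)$ whenever $T$ and $\sigma(T)$ are small transversals. A *Radon–Nikodym cocycle* of a shift-invariant $\boldsymbol\mu$ is a Hölder function $\theta(x)=-\log\frac{d\mu(\sigma x)}{d\mu(x)}$ on $\Sigma_A$ obtained as follows. Take a finite cover of $\Sigma_A$ by flow-boxes $B_i=B_{\epsilon_i}(x_i)$, representatives $\mu_i$ of $\boldsymbol\mu$ on $W^u_{\epsilon_i}(x_i)$ and a Hölder partition of unity $\alpha_i$ subordinate to the cover; on each small transversal $T$ let $\mu_T=\sum_i\alpha_i\mu_i$, where $\mu_i$ is pulled back to $T\cap B_i$ by the projection. Then $\theta$ is required to satisfy $d\mu_{\sigma(T)}(\sigma x)/d\mu_T(x)=e^{-\theta(x)}$ on each small transversal $T$ such that $\sigma(T)$ is a small transversal. The *reduced Radon–Nikodym class* of $\boldsymbol\mu$ is the reduced Hölder class of its Radon–Nikodym cocycles, for all possible choices. *Claim.* For every Hölder function $\phi:\Sigma_A\to\mathbb R$ there is exactly one shift-invariant transverse Hölder measure class $\boldsymbol\mu$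 to the stable foliation of $\Sigma_A$ whose reduced Radon–Nikodym class is $\langle\phi\rangle_*$. -/

import Mathlib

open MeasureTheory Set Filter Topology
open scoped NNReal ENNReal

/-- The two-sided subshift of finite type `Σ_A`: bi-infinite sequences of symbols all of whose
transitions are allowed by the `0-1` matrix `A`. -/
@[ext]
structure SFT {r : ℕ} (A : Matrix (Fin r) (Fin r) ℕ) : Type where
  seq : ℤ → Fin r
  allowed : ∀ i, A (seq i) (seq (i + 1)) = 1

namespace SFT

variable {r : ℕ} {A : Matrix (Fin r) (Fin r) ℕ}

instance : CoeFun (SFT A) (fun _ => ℤ → Fin r) := ⟨SFT.seq⟩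

/-! ### The metric `d(x, y) = ∑_{x_i ≠ y_i} 2^{-|i|}` -/

/-- The `i`-th term of the series defining the distance. -/
noncomputable def distTerm (x y : SFT A) (i : ℤ) : ℝ :=
  if x i = y i then 0 else (1 / 2 : ℝ) ^ i.natAbs

theorem distTerm_nonneg (x y : SFT A) (i : ℤ) : 0 ≤ distTerm x y i := by
  unfold distTerm; split_ifs <;> positivity

theorem summable_weight : Summable (fun i : ℤ => (1 / 2 : ℝ) ^ i.natAbs) := by
  apply Summable.of_nat_of_neg
  · simpa using summable_geometric_two
  · simpa using summable_geometric_two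

theorem summable_distTerm (x y : SFT A) : Summable (distTerm x y) := by
  refine Summable.of_nonneg_of_le (distTerm_nonneg x y) (fun i => ?_) summable_weight
  unfold distTerm; split_ifs
  · positivity
  · exact le_rfl

noncomputable instance : MetricSpace (SFT A) where
  dist x y := ∑' i : ℤ, distTerm x y i
  dist_self x := by simp [distTerm]
  dist_comm x y := by simp only [distTerm, eq_comm]
  dist_triangle x y z := by
    rw [← (summable_distTerm x y).tsum_add (summable_distTerm y z)]
    refine (summable_distTerm x z).tsum_le_tsum (fun i => ?_)
      ((summable_distTerm x y).add (summable_distTerm y z))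
    by_cases h1 : x i = y i
    · simp [distTerm, h1]
    · have h2 := distTerm_nonneg y z i
      have h3 : distTerm x z i ≤ (1 / 2 : ℝ) ^ i.natAbs := by
        unfold distTerm; split_ifs
        · positivity
        · exact le_rfl
      have h4 : distTerm x y i = (1 / 2 : ℝ) ^ i.natAbs := by simp [distTerm, h1]
      linarith
  eq_of_dist_eq_zero := by
    intro x y h
    have h0 := (hasSum_zero_iff_of_nonneg (distTerm_nonneg x y)).1
      (h ▸ (summable_distTerm x y).hasSum)
    refine SFT.ext (funext fun i => ?_)
    by_contra hne
    have h1 : distTerm x y i = 0 := congrFun h0 i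
    rw [distTerm, if_neg hne] at h1
    exact absurd h1 (by positivity)

noncomputable instance : MeasurableSpace (SFT A) := borel _

instance : BorelSpace (SFT A) := ⟨rfl⟩

theorem dist_def (x y : SFT A) : dist x y = ∑' i : ℤ, distTerm x y i := rfl

theorem apply_zero_eq_of_dist_lt_one {x y : SFT A} (h : dist x y < 1) : x 0 = y 0 := by
  by_contra hne
  have h1 : distTerm x y 0 ≤ dist x y :=
    (summable_distTerm x y).le_tsum 0 (fun i _ => distTerm_nonneg x y i)
  have h2 : distTerm x y 0 = 1 := by simp [distTerm, hne]
  linarith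

/-- The shift map, `(σ x)_i = x_{i+1}`, as a bijection of `Σ_A`. -/
def shift (A : Matrix (Fin r) (Fin r) ℕ) : SFT A ≃ SFT A where
  toFun x := ⟨fun i => x (i + 1), fun i => x.allowed (i + 1)⟩
  invFun x := ⟨fun i => x (i - 1), fun i => by
    have h := x.allowed (i - 1)
    rwa [show i - 1 + 1 = i + 1 - 1 by ring] at h⟩
  left_inv x := SFT.ext (funext fun i => congrArg x.seq (by ring))
  right_inv x := SFT.ext (funext fun i => congrArg x.seq (by ring))

theorem shift_symm_iterate_apply (n : ℕ) (x : SFT A) (i : ℤ) :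
    ((shift A).symm^[n] x) i = x (i - n) := by
  induction n generalizing x with
  | zero => simp
  | succ n ih =>
    rw [Function.iterate_succ_apply, ih]
    exact congrArg x.seq (by push_cast; ring)

/-- Transitivity: some point has a dense forward orbit under the shift. -/
def IsTransitive (A : Matrix (Fin r) (Fin r) ℕ) : Prop :=
  ∃ x : SFT A, Dense (range fun n : ℕ => (shift A)^[n] x)

/-! ### Hölder cocycles and reduced cohomology over the shift -/

/-- Hölder continuous real functions on `Σ_A` (some constant, some positive exponent). -/
def IsHolder (f : SFT A → ℝ) : Prop :=
  ∃ C α : ℝ≥0, 0 < α ∧ HolderWith C α f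

/-- The reduced Hölder cohomology class of `φ`: the Hölder functions which differ from `φ` by
an almost coboundary `u ∘ σ - u + K`, with `u` Hölder and `K` constant. -/
def reducedClass (φ : SFT A → ℝ) : Set (SFT A → ℝ) :=
  {ψ | IsHolder ψ ∧ ∃ u : SFT A → ℝ, IsHolder u ∧ ∃ K : ℝ,
    ∀ x, ψ x = φ x + (u (shift A x) - u x + K)}

/-! ### Local product structure, transversals and holonomy -/

/-- The local stable set `W^s_ε(x)`. -/
def localStable (x : SFT A) (ε : ℝ) : Set (SFT A) :=
  {y | ∀ n : ℕ, dist ((shift A)^[n] x) ((shift A)^[n] y) < ε}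

/-- The local unstable set `W^u_ε(x)`. -/
def localUnstable (x : SFT A) (ε : ℝ) : Set (SFT A) :=
  {y | ∀ n : ℕ, dist ((shift A).symm^[n] x) ((shift A).symm^[n] y) < ε}

/-- For `w_0 = z_0`, the point with the coordinates `i ≤ 0` of `w` and the coordinates `i ≥ 0`
of `z`, that is, the intersection of the local unstable set of `w` with the local stable set
of `z`. (The value `w` when `w_0 ≠ z_0` is never used.) -/
def bracket (w z : SFT A) : SFT A :=
  if h : w 0 = z 0 then
    ⟨fun i => if i ≤ 0 then w i else z i, fun i => by
      rcases lt_trichotomy i 0 with hi | hi | hi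
      · have h1 : i + 1 ≤ 0 := by omega
        simp only [hi.le, h1, if_true]
        exact w.allowed i
      · subst hi
        have h1 : ¬ ((0 : ℤ) + 1 ≤ 0) := by omega
        simp only [le_refl, h1, if_true, if_false, h]
        exact z.allowed 0
      · have h1 : ¬ (i + 1 ≤ 0) := by omega
        simp only [not_le.2 hi, h1, if_false]
        exact z.allowed i⟩
  else w

/-- The flow-box around `x` of size `ε ≤ 1`: the image of `W^s_ε(x) × W^u_ε(x)` under the local
product structure `(w, z) ↦ bracket w z`. In this chart the projection onto the unstable factor
`W^u_ε(x)` (along local stable sets) is `p ↦ bracket x p`. -/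
def flowBox (x : SFT A) (ε : ℝ) : Set (SFT A) :=
  image2 bracket (localStable x ε) (localUnstable x ε)

/-- A small transversal to the stable foliation: the graph, in a local product chart, of a
continuous function `τ : W^u_ε(x) → W^s_ε(x)`. -/
def IsSmallTransversal (T : Set (SFT A)) : Prop :=
  ∃ (x : SFT A) (ε : ℝ) (τ : SFT A → SFT A), 0 < ε ∧ ε ≤ 1 ∧
    ContinuousOn τ (localUnstable x ε) ∧
    MapsTo τ (localUnstable x ε) (localStable x ε) ∧
    T = (fun z => bracket (τ z) z) '' localUnstable x ε

theorem bracket_of_mem_localUnstable {x z : SFT A} {ε : ℝ} (hε : ε ≤ 1)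
    (hz : z ∈ localUnstable x ε) : bracket x z = z := by
  have key : ∀ n : ℕ, x (-n) = z (-n) := fun n => by
    have h := apply_zero_eq_of_dist_lt_one ((hz n).trans_le hε)
    rwa [shift_symm_iterate_apply, shift_symm_iterate_apply, zero_sub] at h
  have h0 : x 0 = z 0 := by simpa using key 0
  unfold bracket
  rw [dif_pos h0]
  refine SFT.ext (funext fun i => ?_)
  by_cases hi : i ≤ 0
  · obtain ⟨n, hn⟩ := Int.eq_ofNat_of_zero_le (neg_nonneg.2 hi)
    have : i = -n := by omega
    subst this
    simpa using key n
  · simp [hi]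

variable (A) in
/-- The type of small transversals to the stable foliation. -/
def SmallTransversal : Type := {T : Set (SFT A) // IsSmallTransversal T}

instance : CoeOut (SmallTransversal A) (Set (SFT A)) := ⟨Subtype.val⟩

/-- The local unstable set `W^u_ε(x)`, as a small transversal. -/
def unstableTransversal (x : SFT A) (ε : ℝ) (h0 : 0 < ε) (h1 : ε ≤ 1) : SmallTransversal A :=
  ⟨localUnstable x ε, x, ε, fun _ => x, h0, h1, continuousOn_const,
    fun _ _ n => by simpa using h0, by
      conv_lhs => rw [← image_id (localUnstable x ε)]
      exact image_congr fun z hz => (bracket_of_mem_localUnstable h1 hz).symm⟩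

/-- The canonical conjugating map `z ↦ z'` where `z'_i = y_i` for `i ≤ n` and `z'_i = z_i` for
`i ≥ n` (if `z_n = y_n`); `z'` lies in the stable set of `z`. -/
def conjugating (y : SFT A) (n : ℕ) (z : SFT A) : SFT A :=
  (shift A).symm^[n] (bracket ((shift A)^[n] y) ((shift A)^[n] z))

/-- `Holonomy T T' S h` says that `h`, restricted to the relatively open subset `S` of the
transversal `T`, is a homeomorphism onto a relatively open subset of the transversal `T'`
belonging to the holonomy pseudogroup of the stable foliation. This is generated by

* the projections `p ↦ bracket x p` onto the unstable factor in local product charts;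
* the conjugating homeomorphisms `W^u_ε(x) → W^u_ε(y)`, where `x` lies in the stable set of `y`,
  i.e. `x_i = y_i` for all `i ≥ n`, for some `n`, and `ε` is so small that points of `W^u_ε(x)`
  agree with `x` up to time `n`;

under restriction to open subsets, inversion and composition. -/
inductive Holonomy :
    SmallTransversal A → SmallTransversal A → Set (SFT A) → (SFT A → SFT A) → Prop
  | proj (T : SmallTransversal A) (x : SFT A) (ε : ℝ) (h0 : 0 < ε) (h1 : ε ≤ 1) :
      Holonomy T (unstableTransversal x ε h0 h1) ((T : Set (SFT A)) ∩ flowBox x ε) (bracket x)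
  | conj (x y : SFT A) (n : ℕ) (hxy : ∀ i : ℤ, (n : ℤ) ≤ i → x i = y i)
      (ε : ℝ) (h0 : 0 < ε) (h1 : ε ≤ 1) (hn : ε ≤ (1 / 2) ^ n) :
      Holonomy (unstableTransversal x ε h0 h1) (unstableTransversal y ε h0 h1)
        (localUnstable x ε) (conjugating y n)
  | restrict {T T' : SmallTransversal A} {S : Set (SFT A)} {h : SFT A → SFT A}
      (O : Set (SFT A)) (hO : IsOpen O) (hh : Holonomy T T' S h) : Holonomy T T' (S ∩ O) h
  | congr {T T' : SmallTransversal A} {S : Set (SFT A)} {h h' : SFT A → SFT A}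
      (hh : Holonomy T T' S h) (heq : EqOn h h' S) : Holonomy T T' S h'
  | inv {T T' : SmallTransversal A} {S : Set (SFT A)} {h g : SFT A → SFT A}
      (hh : Holonomy T T' S h) (hg : LeftInvOn g h S) : Holonomy T' T (h '' S) g
  | comp {T T' T'' : SmallTransversal A} {S S' : Set (SFT A)} {h g : SFT A → SFT A}
      (hh : Holonomy T T' S h) (hg : Holonomy T' T'' S' g) :
      Holonomy T T'' (S ∩ h ⁻¹' S') (g ∘ h)

/-! ### Transverse Hölder measure classes -/

/-- The distance `∑_{i ≥ 0, x_i ≠ y_i} 2^{-i}` between the forward parts of two points. For two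
points of a transversal inside a flow-box it is the distance `d` between their projections to the
unstable factor; on a local unstable set (of size at most `1`) it is `d` itself. -/
noncomputable def fwdDist (x y : SFT A) : ℝ :=
  ∑' i : ℕ, if x i = y i then 0 else (1 / 2 : ℝ) ^ i

/-- Hölder functions on (a subset `S` of) a transversal, for the transverse Hölder structure of
the stable foliation, i.e. in the coordinate given by projection onto the unstable factor. -/
def TransverselyHolderOn (u : SFT A → ℝ) (S : Set (SFT A)) : Prop :=
  ∃ C α : ℝ, 0 < α ∧ ∀ z ∈ S, ∀ w ∈ S, |u z - u w| ≤ C * fwdDist z w ^ α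

/-- `log (dm'(h x) / dm(x)) = u x` on the set `S`. -/
def HasLogRNOn (m m' : Measure (SFT A)) (h : SFT A → SFT A) (S : Set (SFT A))
    (u : SFT A → ℝ) : Prop :=
  ∀ E ⊆ S, MeasurableSet E → m' (h '' E) = ∫⁻ x in E, ENNReal.ofReal (Real.exp (u x)) ∂m

/-- The Hölder measure class of `m` on the set `T`: all measures on `T` which are equivalent to
`m` with a positive Hölder Radon-Nikodym derivative `exp u`. -/
def holderMeasureClass (T : Set (SFT A)) (m : Measure (SFT A)) : Set (Measure (SFT A)) :=
  {m' | m' Tᶜ = 0 ∧ ∃ u, TransverselyHolderOn u T ∧ HasLogRNOn m m' id T u}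

variable (A) in
/-- A (nonzero) transverse Hölder measure class to the stable foliation of `Σ_A`: an assignment
to each small transversal of the Hölder measure class of a finite Borel measure on it, preserved
by the holonomy pseudogroup. -/
@[ext]
structure TransverseMeasureClass where
  /-- The measure class on the small transversal `T`, as the set of its representatives. -/
  cls : SmallTransversal A → Set (Measure (SFT A))
  isClass : ∀ T : SmallTransversal A, ∃ m : Measure (SFT A),
    IsFiniteMeasure m ∧ m (T : Set (SFT A))ᶜ = 0 ∧ cls T = holderMeasureClass T m
  holonomy : ∀ (T T' : SmallTransversal A) (S : Set (SFT A)) (h : SFT A → SFT A),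
    Holonomy T T' S h → ∀ m ∈ cls T, ∀ m' ∈ cls T',
      ∃ u, TransverselyHolderOn u S ∧ HasLogRNOn m m' h S u
  nonzero : ∃ T, ∃ m ∈ cls T, m ≠ 0

namespace TransverseMeasureClass

/-- Invariance of the transverse Hölder measure class under the shift: on every small transversal
`T` carried by the shift to a small transversal `σ(T)`, the shift maps the class of `T` to that
of `σ(T)`, with Hölder Radon-Nikodym derivative. -/
def ShiftInvariant (M : TransverseMeasureClass A) : Prop :=
  ∀ T T' : SmallTransversal A, (T' : Set (SFT A)) = shift A '' (T : Set (SFT A)) →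
    ∀ m ∈ M.cls T, ∀ m' ∈ M.cls T',
      ∃ u, TransverselyHolderOn u (T : Set (SFT A)) ∧ HasLogRNOn m m' (shift A) T u

/-- The choices in the definition of the Radon-Nikodym class: a finite cover by flow-boxes `B_i`
around `x_i`, a representative `μ_i` of the measure class on the transversal `W^u_{ε_i}(x_i)` of
`B_i`, and a Hölder partition of unity `α_i` subordinate to the cover. -/
structure FlowBoxData (M : TransverseMeasureClass A) where
  N : ℕ
  center : Fin N → SFT A
  size : Fin N → ℝ
  size_pos : ∀ i, 0 < size i
  size_le : ∀ i, size i ≤ 1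
  cover : ∀ p, ∃ i, p ∈ flowBox (center i) (size i)
  rep : Fin N → Measure (SFT A)
  rep_mem : ∀ i, rep i ∈ M.cls
    (unstableTransversal (center i) (size i) (size_pos i) (size_le i))
  weight : Fin N → SFT A → ℝ
  weight_holder : ∀ i, IsHolder (weight i)
  weight_nonneg : ∀ i p, 0 ≤ weight i p
  weight_support : ∀ i, tsupport (weight i) ⊆ flowBox (center i) (size i)
  weight_sum : ∀ p, ∑ i, weight i p = 1

/-- The measure `μ = ∑_i α_i μ_i` on a transversal `T`: each `μ_i` is pulled back to `T ∩ B_i` by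
the projection onto the unstable factor of `B_i`, and then multiplied by the function `α_i`. -/
noncomputable def FlowBoxData.measureOn {M : TransverseMeasureClass A} (D : M.FlowBoxData)
    (T : SmallTransversal A) : Measure (SFT A) :=
  ∑ i, (((D.rep i).comap (fun z : ↥((T : Set (SFT A)) ∩ flowBox (D.center i) (D.size i)) =>
    bracket (D.center i) z.1)).map Subtype.val).withDensity
      (fun p => ENNReal.ofReal (D.weight i p))

/-- `θ` is the Radon-Nikodym cocycle `θ(x) = - log (dμ(σ x) / dμ(x))` of the shift, computed with
the field of transverse measures `μ = ∑_i α_i μ_i`. -/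
def FlowBoxData.IsRNCocycle {M : TransverseMeasureClass A} (D : M.FlowBoxData)
    (θ : SFT A → ℝ) : Prop :=
  IsHolder θ ∧ ∀ T T' : SmallTransversal A,
    (T' : Set (SFT A)) = shift A '' (T : Set (SFT A)) →
      HasLogRNOn (D.measureOn T) (D.measureOn T') (shift A) T (fun x => -θ x)

/-- The reduced Radon-Nikodym class of the shift acting on `M`: the reduced cohomology class of
the Radon-Nikodym cocycles obtained from all possible choices. -/
def reducedRNClass (M : TransverseMeasureClass A) : Set (SFT A → ℝ) :=
  {ψ | ∃ (D : M.FlowBoxData) (θ : SFT A → ℝ), D.IsRNCocycle θ ∧ ψ ∈ reducedClass θ}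

end TransverseMeasureClass

end SFT

namespace SFT

variable {r : ℕ} {A : Matrix (Fin r) (Fin r) ℕ}

/-! ### Coordinates and the metric -/

/-! A point of a small transversal is determined by its coordinates `i ≥ 0`, so transverse objects
live on the one-sided shift. A copy of it inside `Σ_A` is `core`: one base point is fixed per
symbol, and `retr` replaces the past of a point by that of the base point with the same zeroth
symbol. Each small transversal is embedded in the core by `retr`, and `retr` is locally a holonomy
transformation. A transverse Hölder measure class is therefore the same thing as a nonzero finite
measure `ν` on the core up to Hölder densities (`Represents`,
`TransverseMeasureClass.exists_represents`). Shift-invariance says that `ν` is `Conformal`: on each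
symbol cylinder the one-sided shift has derivative `exp (-θ)`, with `θ` a Hölder function of the
future.

The Radon–Nikodym class is that of `θ` (`Conformal.reducedRNClass_eq`). Suitable flow-box data give
`θ` itself. Any other data multiply `ν` by a positive Hölder density, which changes `θ` by a
coboundary almost everywhere, and then everywhere because transitivity gives `ν` full support.

Existence: `φ` is Hölder cohomologous to a function `ψ` of the future
(`CoordHolder.exists_cohomologous`). The transfer operator of `ψ` has an eigenmeasure with
eigenvalue `l > 0` (`PositiveOperator.exists_eigenmeasure`), and this is conformal for `ψ - log l`
(`exists_conformal`). Every conformal measure defines an invariant class (`Conformal.toClass`).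

Uniqueness: another class with the same reduced class has a conformal measure whose `θ` is `ψ + w ∘
σ - w + K'`. Here `w` depends only on the future, so multiplication by `exp w` stays within the
class and gives a conformal measure for `ψ + K'`. Bounded distortion compares conformal measures on
cylinders up to the factor `exp (n * K)`, where `K` is the difference of the constants. Hence the
constants agree (`Conformal.const_nonneg`), the measures are comparable, and they are in fact
proportional (`Conformal.exists_eq_smul`). -/

theorem shift_apply (x : SFT A) (i : ℤ) : (shift A x) i = x (i + 1) := rfl

theorem shift_symm_apply (x : SFT A) (i : ℤ) : ((shift A).symm x) i = x (i - 1) := rfl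

theorem shift_iterate_apply (n : ℕ) (x : SFT A) (i : ℤ) :
    ((shift A)^[n] x) i = x (i + n) := by
  induction n generalizing x with
  | zero => simp
  | succ n ih =>
    rw [Function.iterate_succ_apply, ih, shift_apply]
    exact congrArg x.seq (by push_cast; ring)

theorem bracket_apply {w z : SFT A} (h : w 0 = z 0) (i : ℤ) :
    (bracket w z) i = if i ≤ 0 then w i else z i := by
  unfold bracket; rw [dif_pos h]

theorem bracket_of_ne {w z : SFT A} (h : w 0 ≠ z 0) : bracket w z = w := by
  unfold bracket; rw [dif_neg h]

theorem bracket_apply_nonpos {w z : SFT A} (h : w 0 = z 0) {i : ℤ} (hi : i ≤ 0) :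
    (bracket w z) i = w i := by
  rw [bracket_apply h, if_pos hi]

theorem bracket_apply_nonneg {w z : SFT A} (h : w 0 = z 0) {i : ℤ} (hi : 0 ≤ i) :
    (bracket w z) i = z i := by
  rw [bracket_apply h]
  split_ifs with h1
  · rw [le_antisymm h1 hi, h]
  · rfl

theorem pow_le_dist {x y : SFT A} {i : ℤ} (h : x i ≠ y i) :
    (1 / 2 : ℝ) ^ i.natAbs ≤ dist x y := by
  have h1 : distTerm x y i ≤ dist x y :=
    (summable_distTerm x y).le_tsum i (fun i _ => distTerm_nonneg x y i)
  rwa [distTerm, if_neg h] at h1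

theorem eq_of_dist_lt_pow {x y : SFT A} {i : ℤ} (h : dist x y < (1 / 2 : ℝ) ^ i.natAbs) :
    x i = y i := by
  by_contra hne
  exact absurd (pow_le_dist hne) (not_le.2 h)

/-- The forward coordinates `0 ≤ i < n` of the two points agree. -/
def FwdAgree (n : ℕ) (x y : SFT A) : Prop := ∀ i : ℕ, i < n → x i = y i

/-- The coordinates `|i| < n` of the two points agree. -/
def Agree (n : ℕ) (x y : SFT A) : Prop := ∀ i : ℤ, i.natAbs < n → x i = y i

theorem Agree.fwd {n : ℕ} {x y : SFT A} (h : Agree n x y) : FwdAgree n x y :=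
  fun i hi => h i (by simpa using hi)

theorem Agree.symm {n : ℕ} {x y : SFT A} (h : Agree n x y) : Agree n y x :=
  fun i hi => (h i hi).symm

theorem FwdAgree.symm {n : ℕ} {x y : SFT A} (h : FwdAgree n x y) : FwdAgree n y x :=
  fun i hi => (h i hi).symm

theorem FwdAgree.trans {n : ℕ} {x y z : SFT A} (h : FwdAgree n x y) (h' : FwdAgree n y z) :
    FwdAgree n x z :=
  fun i hi => (h i hi).trans (h' i hi)

theorem FwdAgree.mono {m n : ℕ} {x y : SFT A} (h : FwdAgree n x y) (hm : m ≤ n) :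
    FwdAgree m x y :=
  fun i hi => h i (hi.trans_le hm)

theorem Agree.mono {m n : ℕ} {x y : SFT A} (h : Agree n x y) (hm : m ≤ n) :
    Agree m x y :=
  fun i hi => h i (hi.trans_le hm)

theorem agree_of_dist_lt {x y : SFT A} {n : ℕ} (h : dist x y < (1 / 2 : ℝ) ^ n) :
    Agree n x y := fun i hi => eq_of_dist_lt_pow <| h.trans_le <|
  pow_le_pow_of_le_one (by norm_num) (by norm_num) hi.le

theorem summable_fwdTerm (x y : SFT A) :
    Summable (fun i : ℕ => if x i = y i then (0 : ℝ) else (1 / 2 : ℝ) ^ i) := by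
  refine Summable.of_nonneg_of_le (fun i => ?_) (fun i => ?_) summable_geometric_two
  · split_ifs <;> positivity
  · split_ifs
    · positivity
    · exact le_rfl

theorem fwdDist_nonneg (x y : SFT A) : 0 ≤ fwdDist x y :=
  tsum_nonneg fun i => by split_ifs <;> positivity

theorem pow_le_fwdDist {x y : SFT A} {i : ℕ} (h : x i ≠ y i) :
    (1 / 2 : ℝ) ^ i ≤ fwdDist x y := by
  have h1 := (summable_fwdTerm x y).le_tsum i (fun i _ => by split_ifs <;> positivity)
  rwa [if_neg h] at h1

theorem tsum_ite_agree_le {P : ℕ → Prop} [DecidablePred P] {n : ℕ} (h : ∀ i < n, P i) :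
    ∑' i : ℕ, (if P i then (0 : ℝ) else (1 / 2 : ℝ) ^ i) ≤ 2 * (1 / 2 : ℝ) ^ n := by
  have hs : Summable (fun i : ℕ => if P i then (0 : ℝ) else (1 / 2 : ℝ) ^ i) := by
    refine Summable.of_nonneg_of_le (fun i => ?_) (fun i => ?_) summable_geometric_two
    · split_ifs <;> positivity
    · split_ifs
      · positivity
      · exact le_rfl
  rw [← hs.sum_add_tsum_nat_add n, Finset.sum_eq_zero, zero_add]
  · have h2 : ∑' i : ℕ, (1 / 2 : ℝ) ^ (i + n) = 2 * (1 / 2 : ℝ) ^ n := by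
      simp_rw [pow_add]; rw [tsum_mul_right, tsum_geometric_two]
    rw [← h2]
    refine ((summable_nat_add_iff n).2 hs).tsum_le_tsum (fun i => ?_)
      ((summable_nat_add_iff n).2 summable_geometric_two)
    split_ifs
    · positivity
    · exact le_rfl
  · intro i hi
    rw [if_pos (h i (Finset.mem_range.1 hi))]

theorem fwdDist_le {x y : SFT A} {n : ℕ} (h : FwdAgree n x y) :
    fwdDist x y ≤ 2 * (1 / 2 : ℝ) ^ n :=
  tsum_ite_agree_le h

theorem dist_eq_add (x y : SFT A) : dist x y = fwdDist x y +
    (1 / 2) * ∑' i : ℕ, (if x (-(i + 1 : ℤ)) = y (-(i + 1 : ℤ)) then (0 : ℝ) else (1 / 2) ^ i) := by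
  have h := summable_distTerm x y
  rw [dist_def, tsum_of_nat_of_neg_add_one (f := distTerm x y)
    (h.comp_injective Nat.cast_injective)
    (h.comp_injective (i := fun n : ℕ => -((n : ℤ) + 1)) (fun a b hab => by
      simp only at hab; omega)), ← tsum_mul_left]
  congr 1
  refine tsum_congr fun i => ?_
  have : (-(i + 1 : ℤ)).natAbs = i + 1 := by omega
  unfold distTerm
  rw [this]
  split_ifs
  · simp
  · ring

theorem dist_eq_fwdDist {x y : SFT A} (h : ∀ i : ℤ, i ≤ 0 → x i = y i) :
    dist x y = fwdDist x y := by
  rw [dist_eq_add]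
  have : ∀ i : ℕ, (if x (-(i + 1 : ℤ)) = y (-(i + 1 : ℤ)) then (0 : ℝ) else (1 / 2) ^ i) = 0 :=
    fun i => if_pos (h _ (by omega))
  rw [tsum_congr this]; simp

theorem dist_le_of_agree {x y : SFT A} {n : ℕ} (h : Agree n x y) :
    dist x y ≤ 4 * (1 / 2 : ℝ) ^ n := by
  rw [dist_eq_add]
  have h1 := fwdDist_le h.fwd
  have h2 := tsum_ite_agree_le (n := n - 1)
    (P := fun i : ℕ => x (-(i + 1 : ℤ)) = y (-(i + 1 : ℤ))) (fun i hi => h _ (by omega))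
  have h3 : (1 / 2 : ℝ) ^ (n - 1) ≤ 2 * (1 / 2 : ℝ) ^ n := by
    cases n with
    | zero => simp
    | succ n => simp only [Nat.add_sub_cancel]; rw [pow_succ]; linarith
  linarith

/-- As `ε ≤ 1`, closeness of the `n`-th backward iterates forces agreement at coordinate `-n`.
Conversely, once the pasts agree, shifting backwards only moves the disagreements further from
coordinate `0`, so the bound at time `0` implies all the others. -/
theorem mem_localUnstable {x y : SFT A} {ε : ℝ} (hε : ε ≤ 1) :
    y ∈ localUnstable x ε ↔ (∀ i : ℤ, i ≤ 0 → x i = y i) ∧ dist x y < ε := by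
  constructor
  · refine fun h => ⟨fun i hi => ?_, h 0⟩
    have h1 := apply_zero_eq_of_dist_lt_one ((h (-i).toNat).trans_le hε)
    rw [shift_symm_iterate_apply, shift_symm_iterate_apply, zero_sub] at h1
    rwa [show -((-i).toNat : ℤ) = i by omega] at h1
  · rintro ⟨h, hd⟩ n
    refine lt_of_le_of_lt ?_ hd
    rw [dist_def, dist_def, ← (Equiv.addRight (n : ℤ)).tsum_eq]
    refine Summable.tsum_le_tsum (fun i => ?_) ?_ (summable_distTerm x y)
    · simp only [distTerm, shift_symm_iterate_apply, Equiv.coe_addRight, add_sub_cancel_right]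
      split_ifs with h1
      · exact le_rfl
      · have : 0 < i := by
          by_contra hi
          exact h1 (h i (not_lt.1 hi))
        exact pow_le_pow_of_le_one (by norm_num) (by norm_num) (by omega)
    · exact (summable_distTerm _ _).comp_injective (Equiv.injective _)

theorem mem_localStable {x y : SFT A} {ε : ℝ} (hε : ε ≤ 1) :
    y ∈ localStable x ε ↔ (∀ i : ℤ, 0 ≤ i → x i = y i) ∧ dist x y < ε := by
  constructor
  · refine fun h => ⟨fun i hi => ?_, h 0⟩
    have h1 := apply_zero_eq_of_dist_lt_one ((h i.toNat).trans_le hε)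
    rw [shift_iterate_apply, shift_iterate_apply, zero_add] at h1
    rwa [show (i.toNat : ℤ) = i by omega] at h1
  · rintro ⟨h, hd⟩ n
    refine lt_of_le_of_lt ?_ hd
    rw [dist_def, dist_def, ← (Equiv.addRight (-(n : ℤ))).tsum_eq]
    refine Summable.tsum_le_tsum (fun i => ?_) ?_ (summable_distTerm x y)
    · simp only [distTerm, shift_iterate_apply, Equiv.coe_addRight, neg_add_cancel_right]
      split_ifs with h1
      · exact le_rfl
      · have : i < 0 := by
          by_contra hi
          exact h1 (h i (not_lt.1 hi))
        exact pow_le_pow_of_le_one (by norm_num) (by norm_num) (by omega)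
    · exact (summable_distTerm _ _).comp_injective (Equiv.injective _)

/-- The two factors of `p` are recovered as `bracket p x` and `bracket x p`. This form exhibits a
flow-box as an open set. -/
theorem mem_flowBox {x p : SFT A} {ε : ℝ} (hε : ε ≤ 1) :
    p ∈ flowBox x ε ↔ p 0 = x 0 ∧ dist x (bracket x p) < ε ∧ dist x (bracket p x) < ε := by
  constructor
  · rintro ⟨w, hw, z, hz, rfl⟩
    rw [mem_localStable hε] at hw
    rw [mem_localUnstable hε] at hz
    have hw0 := hw.1 0 le_rfl
    have hz0 := hz.1 0 le_rfl
    have hwz : w 0 = z 0 := hw0.symm.trans hz0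
    have hb0 : (bracket w z) 0 = x 0 := by rw [bracket_apply_nonpos hwz le_rfl, hw0]
    refine ⟨hb0, ?_, ?_⟩
    · convert hz.2 using 2
      refine SFT.ext (funext fun i => ?_)
      rcases le_total i 0 with hi | hi
      · rw [bracket_apply_nonpos hb0.symm hi, hz.1 i hi]
      · rw [bracket_apply_nonneg hb0.symm hi, bracket_apply_nonneg hwz hi]
    · convert hw.2 using 2
      refine SFT.ext (funext fun i => ?_)
      rcases le_total i 0 with hi | hi
      · rw [bracket_apply_nonpos hb0 hi, bracket_apply_nonpos hwz hi]
      · rw [bracket_apply_nonneg hb0 hi, hw.1 i hi]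
  · rintro ⟨h0, h1, h2⟩
    refine ⟨bracket p x, ?_, bracket x p, ?_, ?_⟩
    · rw [mem_localStable hε]
      exact ⟨fun i hi => (bracket_apply_nonneg h0 hi).symm, h2⟩
    · rw [mem_localUnstable hε]
      exact ⟨fun i hi => (bracket_apply_nonpos h0.symm hi).symm, h1⟩
    · have h3 : (bracket p x) 0 = (bracket x p) 0 := by
        rw [bracket_apply_nonneg h0 le_rfl, bracket_apply_nonpos h0.symm le_rfl]
      refine SFT.ext (funext fun i => ?_)
      rcases le_total i 0 with hi | hi
      · rw [bracket_apply_nonpos h3 hi, bracket_apply_nonpos h0 hi]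
      · rw [bracket_apply_nonneg h3 hi, bracket_apply_nonneg h0.symm hi]

/-! ### Topology -/

theorem continuous_apply (i : ℤ) : Continuous fun x : SFT A => x i := by
  rw [continuous_iff_continuousAt]
  intro x
  refine tendsto_nhds_of_eventually_eq ?_
  filter_upwards [Metric.ball_mem_nhds x (show (0 : ℝ) < (1 / 2) ^ i.natAbs by positivity)]
    with y hy
  exact eq_of_dist_lt_pow hy

theorem continuous_of_apply {Y : Type*} [TopologicalSpace Y] {f : Y → SFT A}
    (h : ∀ i, Continuous fun y => f y i) : Continuous f := by
  rw [Metric.continuous_iff']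
  intro y ε hε
  obtain ⟨n, hn⟩ : ∃ n : ℕ, 4 * (1 / 2 : ℝ) ^ n < ε := by
    obtain ⟨n, hn⟩ := exists_pow_lt_of_lt_one (show 0 < ε / 4 by positivity)
      (show (1 / 2 : ℝ) < 1 by norm_num)
    exact ⟨n, by linarith⟩
  have h1 : ∀ i ∈ Finset.Icc (-n : ℤ) n, ∀ᶠ z in 𝓝 y, f z i = f y i := fun i _ =>
    (h i).continuousAt.eventually (show ∀ᶠ a in 𝓝 (f y i), a = f y i by simp)
  filter_upwards [(Finset.eventually_all _).2 h1] with z hz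
  refine (dist_le_of_agree fun i hi => hz i ?_).trans_lt hn
  rw [Finset.mem_Icc]; omega

/-- `Σ_A` is the continuous image of a closed subset of a product of finite discrete spaces.
Compactness also makes it standard Borel, which the measure theory below relies on. -/
instance : CompactSpace (SFT A) := by
  let K : Set (ℤ → Fin r) := {s | ∀ i, A (s i) (s (i + 1)) = 1}
  have hK : IsClosed K := by
    have : K = ⋂ i : ℤ, {s | A (s i) (s (i + 1)) = 1} := by ext; simp [K]
    rw [this]
    refine isClosed_iInter fun i => ?_
    have hc : Continuous fun s : ℤ → Fin r => (s i, s (i + 1)) := by fun_prop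
    exact (isClosed_discrete {p : Fin r × Fin r | A p.1 p.2 = 1}).preimage hc
  have : CompactSpace K := isCompact_iff_compactSpace.1 hK.isCompact
  let f : K → SFT A := fun s => ⟨s.1, s.2⟩
  have hf : Continuous f := continuous_of_apply fun i =>
    (_root_.continuous_apply i).comp continuous_subtype_val
  have hs : Function.Surjective f := fun x => ⟨⟨x.seq, x.allowed⟩, rfl⟩
  exact hs.compactSpace hf

theorem continuous_bracket : Continuous fun p : SFT A × SFT A => bracket p.1 p.2 := by
  refine continuous_of_apply fun i => ?_
  have h : (fun p : SFT A × SFT A => (bracket p.1 p.2) i) =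
      (fun q : (Fin r × Fin r) × (Fin r × Fin r) =>
        if q.1.1 = q.1.2 then (if i ≤ 0 then q.2.1 else q.2.2) else q.2.1) ∘
      (fun p : SFT A × SFT A => ((p.1 0, p.2 0), (p.1 i, p.2 i))) := by
    funext p
    by_cases h : p.1 0 = p.2 0
    · simp [bracket_apply h, h]
    · simp [bracket_of_ne h, h]
  rw [h]
  refine continuous_of_discreteTopology.comp ?_
  exact (((continuous_apply 0).comp continuous_fst).prodMk
    ((continuous_apply 0).comp continuous_snd)).prodMk
    (((continuous_apply i).comp continuous_fst).prodMk ((continuous_apply i).comp continuous_snd))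

theorem continuous_bracket_right (x : SFT A) : Continuous (bracket x) :=
  continuous_bracket.comp (continuous_const.prodMk continuous_id)

theorem continuous_bracket_left (x : SFT A) : Continuous fun p => bracket p x :=
  continuous_bracket.comp (continuous_id.prodMk continuous_const)

theorem continuous_shift : Continuous (shift A) :=
  continuous_of_apply fun i => continuous_apply (i + 1)

theorem continuous_shift_symm : Continuous (shift A).symm :=
  continuous_of_apply fun i => continuous_apply (i - 1)

theorem isOpen_apply_eq (i : ℤ) (a : Fin r) : IsOpen {x : SFT A | x i = a} :=
  (isOpen_discrete {a}).preimage (continuous_apply i)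

theorem isClosed_apply_eq (i : ℤ) (a : Fin r) : IsClosed {x : SFT A | x i = a} :=
  (isClosed_discrete {a}).preimage (continuous_apply i)

theorem isOpen_flowBox (x : SFT A) {ε : ℝ} (hε : ε ≤ 1) : IsOpen (flowBox x ε) := by
  have : flowBox x ε = {p | p 0 = x 0} ∩ ({p | dist x (bracket x p) < ε} ∩
      {p | dist x (bracket p x) < ε}) := by
    ext p; exact mem_flowBox hε
  rw [this]
  refine (isOpen_apply_eq 0 _).inter ((isOpen_lt ?_ continuous_const).inter
    (isOpen_lt ?_ continuous_const))
  · exact continuous_const.dist (continuous_bracket_right x)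
  · exact continuous_const.dist (continuous_bracket_left x)

theorem isClosed_forall_apply_eq (x : SFT A) (P : ℤ → Prop) :
    IsClosed {y : SFT A | ∀ i, P i → x i = y i} := by
  have : {y : SFT A | ∀ i, P i → x i = y i} = ⋂ i, ⋂ (_ : P i), {y | y i = x i} := by
    ext y; simp [eq_comm]
  rw [this]
  exact isClosed_iInter fun i => isClosed_iInter fun _ => isClosed_apply_eq i _

theorem measurableSet_localUnstable (x : SFT A) {ε : ℝ} (hε : ε ≤ 1) :
    MeasurableSet (localUnstable x ε) := by
  have : localUnstable x ε = {y | ∀ i : ℤ, i ≤ 0 → x i = y i} ∩ {y | dist x y < ε} := by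
    ext y; exact mem_localUnstable hε
  rw [this]
  exact (isClosed_forall_apply_eq x _).measurableSet.inter
    (isOpen_lt (continuous_const.dist continuous_id) continuous_const).measurableSet

/-! ### Hölder functions in terms of coordinates -/

/-- Exponential dependence on the coordinates. -/
def CoordHolder (f : SFT A → ℝ) : Prop :=
  ∃ C β : ℝ, 0 ≤ C ∧ 0 < β ∧ β < 1 ∧ ∀ n x y, Agree n x y → |f x - f y| ≤ C * β ^ n

/-- Exponential dependence on the forward coordinates. -/
def FwdHolderOn (f : SFT A → ℝ) (S : Set (SFT A)) : Prop :=
  ∃ C β : ℝ, 0 ≤ C ∧ 0 < β ∧ β < 1 ∧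
    ∀ n, ∀ x ∈ S, ∀ y ∈ S, FwdAgree n x y → |f x - f y| ≤ C * β ^ n

theorem half_pow_rpow (n : ℕ) (α : ℝ) : ((1 / 2 : ℝ) ^ n) ^ α = ((1 / 2 : ℝ) ^ α) ^ n := by
  rw [← Real.rpow_natCast, ← Real.rpow_mul (by norm_num), mul_comm,
    Real.rpow_mul (by norm_num), Real.rpow_natCast]

theorem exists_half_rpow_eq {β : ℝ} (h0 : 0 < β) (h1 : β < 1) :
    ∃ α : ℝ, 0 < α ∧ (1 / 2 : ℝ) ^ α = β := by
  refine ⟨Real.log β / Real.log (1 / 2), ?_, ?_⟩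
  · exact div_pos_of_neg_of_neg (Real.log_neg h0 h1) (Real.log_neg (by norm_num) (by norm_num))
  · rw [Real.rpow_def_of_pos (by norm_num), mul_div_cancel₀, Real.exp_log h0]
    exact (Real.log_neg (by norm_num) (by norm_num)).ne

/-- The exponents correspond by `β = 2 ^ (-α)`: agreement for `|i| < n` gives `dist ≤ 4 * 2 ^ (-n)`,
and a disagreement at `|i| = n` gives `dist ≥ 2 ^ (-n)`. -/
theorem isHolder_iff {f : SFT A → ℝ} : IsHolder f ↔ CoordHolder f := by
  constructor
  · rintro ⟨C, α, hα, h⟩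
    have hα' : (0 : ℝ) < α := hα
    refine ⟨C * 4 ^ (α : ℝ), (1 / 2 : ℝ) ^ (α : ℝ), by positivity, by positivity,
      Real.rpow_lt_one (by norm_num) (by norm_num) hα', fun n x y hxy => ?_⟩
    have h1 := h.dist_le x y
    rw [Real.dist_eq] at h1
    refine h1.trans ?_
    rw [mul_assoc, ← half_pow_rpow, ← Real.mul_rpow (by norm_num) (by positivity)]
    gcongr
    exact dist_le_of_agree hxy
  · rintro ⟨C, β, hC, hβ0, hβ1, h⟩
    obtain ⟨α, hα, rfl⟩ := exists_half_rpow_eq hβ0 hβ1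
    have hC' : 0 ≤ C / (1 / 2 : ℝ) ^ α := by positivity
    refine ⟨(C / (1 / 2 : ℝ) ^ α).toNNReal, α.toNNReal, Real.toNNReal_pos.2 hα, fun x y => ?_⟩
    rw [Real.coe_toNNReal _ hα.le, edist_dist, edist_dist]
    by_cases hxy : x = y
    · subst hxy; simp
    have hne : ∃ n : ℕ, ∃ i : ℤ, i.natAbs = n ∧ x i ≠ y i := by
      by_contra hcon
      push Not at hcon
      exact hxy (SFT.ext (funext fun i => hcon _ i rfl))
    classical
    obtain ⟨i, hi, hne'⟩ := Nat.find_spec hne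
    have hag : Agree (Nat.find hne) x y := fun j hj => by
      by_contra hj'
      exact Nat.find_min hne hj ⟨j, rfl, hj'⟩
    have h1 := h _ x y hag
    have h2 : ((1 / 2 : ℝ) ^ α) ^ Nat.find hne ≤ dist x y ^ α := by
      rw [← half_pow_rpow, ← hi]
      exact Real.rpow_le_rpow (by positivity) (pow_le_dist hne') hα.le
    have h3 : |f x - f y| ≤ C / (1 / 2 : ℝ) ^ α * dist x y ^ α := by
      refine h1.trans (mul_le_mul ?_ h2 (by positivity) (by positivity))
      exact le_div_self hC hβ0 hβ1.le
    rw [Real.dist_eq, ENNReal.ofReal_rpow_of_nonneg dist_nonneg hα.le,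
      ← ENNReal.ofReal_coe_nnreal, Real.coe_toNNReal _ hC', ← ENNReal.ofReal_mul hC']
    exact ENNReal.ofReal_le_ofReal h3

theorem transverselyHolderOn_iff {f : SFT A → ℝ} {S : Set (SFT A)} :
    TransverselyHolderOn f S ↔ FwdHolderOn f S := by
  constructor
  · rintro ⟨C, α, hα, h⟩
    refine ⟨|C| * 2 ^ (α : ℝ), (1 / 2 : ℝ) ^ (α : ℝ), by positivity, by positivity,
      Real.rpow_lt_one (by norm_num) (by norm_num) hα, fun n x hx y hy hxy => ?_⟩
    refine (h x hx y hy).trans ?_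
    rw [mul_assoc, ← half_pow_rpow, ← Real.mul_rpow (by norm_num) (by positivity)]
    have := fwdDist_nonneg x y
    refine mul_le_mul (le_abs_self C) ?_ (by positivity) (by positivity)
    exact Real.rpow_le_rpow this (fwdDist_le hxy) hα.le
  · rintro ⟨C, β, hC, hβ0, hβ1, h⟩
    obtain ⟨α, hα, rfl⟩ := exists_half_rpow_eq hβ0 hβ1
    refine ⟨C, α, hα, fun x hx y hy => ?_⟩
    by_cases hne : ∃ n : ℕ, x n ≠ y n
    · classical
      have hag : FwdAgree (Nat.find hne) x y := fun j hj => by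
        by_contra hj'
        exact Nat.find_min hne hj hj'
      refine (h _ x hx y hy hag).trans ?_
      rw [← half_pow_rpow]
      gcongr
      exact pow_le_fwdDist (Nat.find_spec hne)
    -- Points with the same future need not be equal here, but the estimate for every `n` forces
    -- equal values.
    · push Not at hne
      have h0 : Tendsto (fun n : ℕ => C * ((1 / 2 : ℝ) ^ α) ^ n) atTop (𝓝 (C * 0)) :=
        (tendsto_pow_atTop_nhds_zero_of_lt_one hβ0.le hβ1).const_mul C
      have h1 : |f x - f y| ≤ C * 0 :=
        ge_of_tendsto' h0 fun n => h n x hx y hy fun i _ => hne i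
      refine h1.trans ?_
      have := fwdDist_nonneg x y
      rw [mul_zero]; positivity

theorem CoordHolder.exists_agree {f : SFT A → ℝ} (h : CoordHolder f) {ε : ℝ} (hε : 0 < ε) :
    ∃ n, ∀ x y, Agree n x y → |f x - f y| < ε := by
  obtain ⟨C, β, hC, h0, h1, h⟩ := h
  obtain ⟨n, hn⟩ := exists_pow_lt_of_lt_one (show 0 < ε / (C + 1) by positivity) h1
  refine ⟨n, fun x y hxy => (h n x y hxy).trans_lt ?_⟩
  rw [lt_div_iff₀ (by positivity)] at hn
  have : 0 < β ^ n := by positivity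
  nlinarith

theorem CoordHolder.continuous {f : SFT A → ℝ} (h : CoordHolder f) : Continuous f := by
  rw [Metric.continuous_iff]
  intro x ε hε
  obtain ⟨n, hn⟩ := h.exists_agree hε
  exact ⟨(1 / 2) ^ n, by positivity, fun y hy => hn y x (agree_of_dist_lt hy)⟩

theorem FwdHolderOn.mono {f : SFT A → ℝ} {S S' : Set (SFT A)} (h : FwdHolderOn f S)
    (hS : S' ⊆ S) : FwdHolderOn f S' := by
  obtain ⟨C, β, hC, h0, h1, h⟩ := h
  exact ⟨C, β, hC, h0, h1, fun n x hx y hy hxy => h n x (hS hx) y (hS hy) hxy⟩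

theorem FwdHolderOn.congr {f g : SFT A → ℝ} {S : Set (SFT A)} (h : FwdHolderOn f S)
    (hfg : EqOn f g S) : FwdHolderOn g S := by
  obtain ⟨C, β, hC, h0, h1, h⟩ := h
  exact ⟨C, β, hC, h0, h1, fun n x hx y hy hxy => by
    rw [← hfg hx, ← hfg hy]; exact h n x hx y hy hxy⟩

theorem FwdHolderOn.comp {f : SFT A → ℝ} {S S' : Set (SFT A)} {g : SFT A → SFT A}
    (h : FwdHolderOn f S') (hg : MapsTo g S S')
    (hgi : ∀ n, ∀ x ∈ S, ∀ y ∈ S, FwdAgree n x y → FwdAgree n (g x) (g y)) :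
    FwdHolderOn (fun x => f (g x)) S := by
  obtain ⟨C, β, hC, h0, h1, h⟩ := h
  exact ⟨C, β, hC, h0, h1, fun n x hx y hy hxy =>
    h n _ (hg hx) _ (hg hy) (hgi n x hx y hy hxy)⟩

theorem fwdHolderOn_const (c : ℝ) (S : Set (SFT A)) : FwdHolderOn (fun _ => c) S :=
  ⟨0, 1 / 2, le_rfl, by norm_num, by norm_num, fun n x _ y _ _ => by simp⟩

theorem FwdHolderOn.neg {f : SFT A → ℝ} {S : Set (SFT A)} (h : FwdHolderOn f S) :
    FwdHolderOn (fun x => -f x) S := by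
  obtain ⟨C, β, hC, h0, h1, h⟩ := h
  refine ⟨C, β, hC, h0, h1, fun n x hx y hy hxy => ?_⟩
  have := h n x hx y hy hxy
  rwa [← neg_sub', abs_neg]

theorem add_mul_pow_le {C C' β β' : ℝ} (hC : 0 ≤ C) (hC' : 0 ≤ C') (h0 : 0 < β) (h0' : 0 < β')
    (n : ℕ) : C * β ^ n + C' * β' ^ n ≤ (C + C') * (max β β') ^ n := by
  have h1 : β ^ n ≤ (max β β') ^ n := pow_le_pow_left₀ h0.le (le_max_left _ _) n
  have h2 : β' ^ n ≤ (max β β') ^ n := pow_le_pow_left₀ h0'.le (le_max_right _ _) n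
  nlinarith

theorem FwdHolderOn.add {f g : SFT A → ℝ} {S : Set (SFT A)} (h : FwdHolderOn f S)
    (hg : FwdHolderOn g S) : FwdHolderOn (fun x => f x + g x) S := by
  obtain ⟨C, β, hC, h0, h1, h⟩ := h
  obtain ⟨C', β', hC', h0', h1', h'⟩ := hg
  refine ⟨C + C', max β β', by positivity, lt_max_of_lt_left h0, max_lt h1 h1',
    fun n x hx y hy hxy => ?_⟩
  refine le_trans ?_ (add_mul_pow_le hC hC' h0 h0' n)
  rw [add_sub_add_comm]
  exact (abs_add_le _ _).trans (add_le_add (h n x hx y hy hxy) (h' n x hx y hy hxy))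

theorem CoordHolder.neg {f : SFT A → ℝ} (h : CoordHolder f) :
    CoordHolder (fun x => -f x) := by
  obtain ⟨C, β, hC, h0, h1, h⟩ := h
  refine ⟨C, β, hC, h0, h1, fun n x y hxy => ?_⟩
  rw [← neg_sub', abs_neg]
  exact h n x y hxy

theorem CoordHolder.add {f g : SFT A → ℝ} (h : CoordHolder f) (hg : CoordHolder g) :
    CoordHolder (fun x => f x + g x) := by
  obtain ⟨C, β, hC, h0, h1, h⟩ := h
  obtain ⟨C', β', hC', h0', h1', h'⟩ := hg
  refine ⟨C + C', max β β', by positivity, lt_max_of_lt_left h0, max_lt h1 h1',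
    fun n x y hxy => ?_⟩
  refine le_trans ?_ (add_mul_pow_le hC hC' h0 h0' n)
  rw [add_sub_add_comm]
  exact (abs_add_le _ _).trans (add_le_add (h n x y hxy) (h' n x y hxy))

theorem coordHolder_const (c : ℝ) : CoordHolder (fun _ : SFT A => c) :=
  ⟨0, 1 / 2, le_rfl, by norm_num, by norm_num, fun n x y _ => by simp⟩

theorem CoordHolder.comp_shift {f : SFT A → ℝ} (h : CoordHolder f) :
    CoordHolder (fun x => f (shift A x)) := by
  obtain ⟨C, β, hC, h0, h1, h⟩ := h
  refine ⟨C / β, β, by positivity, h0, h1, fun n x y hxy => ?_⟩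
  have h2 := h (n - 1) (shift A x) (shift A y) fun i hi => by
    rw [shift_apply, shift_apply]; exact hxy _ (by omega)
  refine h2.trans ?_
  rw [div_mul_eq_mul_div, mul_div_assoc]
  gcongr
  rw [le_div_iff₀ h0, ← pow_succ]
  exact pow_le_pow_of_le_one h0.le h1.le (by omega)

theorem FwdHolderOn.continuousOn {f : SFT A → ℝ} {S : Set (SFT A)} (h : FwdHolderOn f S) :
    ContinuousOn f S := by
  obtain ⟨C, β, hC, h0, h1, h⟩ := h
  rw [Metric.continuousOn_iff]
  intro x hx ε hε
  obtain ⟨n, hn⟩ := exists_pow_lt_of_lt_one (show 0 < ε / (C + 1) by positivity) h1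
  refine ⟨(1 / 2) ^ n, by positivity, fun y hy hyx => ?_⟩
  refine (h n y hy x hx (agree_of_dist_lt hyx).fwd).trans_lt ?_
  rw [lt_div_iff₀ (by positivity)] at hn
  have : 0 < β ^ n := by positivity
  nlinarith

/-- A function which is Hölder on pieces determined by finitely many forward coordinates is
Hölder. -/
theorem FwdHolderOn.of_pieces {ι : Type*} [Finite ι] {S : Set (SFT A)} {f : SFT A → ℝ} (N : ℕ)
    (P : ι → Set (SFT A)) (hcov : ∀ x ∈ S, ∃ i, ∀ y ∈ S, FwdAgree N x y → y ∈ P i)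
    (h : ∀ i, FwdHolderOn f (S ∩ P i)) : FwdHolderOn f S := by
  classical
  cases nonempty_fintype ι
  choose C β hC h0 h1 h using h
  rcases S.eq_empty_or_nonempty with rfl | ⟨x0, hx0⟩
  · exact ⟨0, 1 / 2, le_rfl, by norm_num, by norm_num, fun n x hx => by simp at hx⟩
  have hne : Nonempty ι := ⟨(hcov x0 hx0).choose⟩
  obtain ⟨b, hb⟩ : ∃ b, b = Finset.univ.sup' Finset.univ_nonempty β := ⟨_, rfl⟩
  have hbi : ∀ i, β i ≤ b := fun i => hb ▸ Finset.le_sup' β (Finset.mem_univ i)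
  have hb1 : b < 1 := by
    rw [hb, Finset.sup'_lt_iff]; exact fun i _ => h1 i
  have hb0 : 0 < b := (h0 hne.some).trans_le (hbi _)
  have hfin : ∃ B : ℝ, 0 ≤ B ∧ ∀ x ∈ S, |f x| ≤ B := by
    choose! j hj using hcov
    have : ∀ i, ∃ B : ℝ, 0 ≤ B ∧ ∀ x ∈ S ∩ P i, |f x| ≤ B := fun i => by
      rcases (S ∩ P i).eq_empty_or_nonempty with he | ⟨z, hz⟩
      · exact ⟨0, le_rfl, fun x hx => by simp [he] at hx⟩
      · refine ⟨C i + |f z|, by have := hC i; positivity, fun x hx => ?_⟩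
        have h2 := h i 0 x hx z hz (fun k hk => by omega)
        have h3 := abs_sub_abs_le_abs_sub (f x) (f z)
        rw [pow_zero, mul_one] at h2
        linarith
    choose B hB0 hB using this
    refine ⟨∑ i, B i, Finset.sum_nonneg fun i _ => hB0 i, fun x hx => ?_⟩
    refine (hB (j x) x ⟨hx, hj x hx x hx (fun _ _ => rfl)⟩).trans ?_
    exact Finset.single_le_sum (fun i _ => hB0 i) (Finset.mem_univ _)
  obtain ⟨B, hB0, hB⟩ := hfin
  -- For `n ≥ N` both points lie in a common piece. For `n < N` the oscillation is at most `2 * B`,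
  -- which is at most `2 * B / b ^ N * b ^ n`.
  refine ⟨∑ i, C i + 2 * B / b ^ N, b, ?_, hb0, hb1, fun n x hx y hy hxy => ?_⟩
  · have := Finset.sum_nonneg fun i (_ : i ∈ Finset.univ) => hC i
    positivity
  have hs0 := Finset.sum_nonneg fun i (_ : i ∈ Finset.univ) => hC i
  rcases le_or_gt N n with hn | hn
  · obtain ⟨i, hi⟩ := hcov x hx
    have h2 := h i n x ⟨hx, hi x hx fun _ _ => rfl⟩ y ⟨hy, hi y hy (hxy.mono hn)⟩ hxy
    refine h2.trans (mul_le_mul ?_ (pow_le_pow_left₀ (h0 i).le (hbi i) n)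
      (pow_nonneg (h0 i).le n) (by positivity))
    have := Finset.single_le_sum (fun i _ => hC i) (Finset.mem_univ i)
    have h5 : 0 ≤ 2 * B / b ^ N := by positivity
    linarith
  · have h2 : |f x - f y| ≤ 2 * B := by
      have := abs_sub (f x) (f y)
      linarith [hB x hx, hB y hy]
    have h3 : b ^ N ≤ b ^ n := pow_le_pow_of_le_one hb0.le hb1.le hn.le
    have h4 : 2 * B ≤ 2 * B / b ^ N * b ^ n := by
      rw [div_mul_eq_mul_div, le_div_iff₀ (by positivity)]
      gcongr
    refine h2.trans (h4.trans ?_)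
    gcongr
    linarith

end SFT

namespace SFT

variable {r : ℕ} {A : Matrix (Fin r) (Fin r) ℕ}

/-! ### Calculus of logarithmic Radon-Nikodym derivatives -/

/-- `h` is a measurable injection on `S` with measurable logarithmic Radon-Nikodym derivative `u`
from `m` to `m'`. -/
structure RN (m m' : Measure (SFT A)) (h : SFT A → SFT A) (S : Set (SFT A))
    (u : SFT A → ℝ) : Prop where
  measS : MeasurableSet S
  meas_h : Measurable (S.domRestrict h)
  inj : InjOn h S
  meas_u : Measurable (S.domRestrict u)
  rn : HasLogRNOn m m' h S u

/-- This is the Lusin–Souslin theorem. It makes images of Borel sets under injective maps Borel, so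
`HasLogRNOn` can be inverted and composed. -/
theorem measurableEmbedding_restrict {h : SFT A → SFT A} {S : Set (SFT A)}
    (hS : MeasurableSet S) (hm : Measurable (S.domRestrict h)) (hi : InjOn h S) :
    MeasurableEmbedding (S.domRestrict h) := by
  have := hS.standardBorel
  exact hm.measurableEmbedding (injOn_iff_injective.1 hi)

theorem measurable_restrict_of_subset {β : Type*} [MeasurableSpace β] {f : SFT A → β}
    {S S' : Set (SFT A)} (h : Measurable (S.domRestrict f)) (hS : S' ⊆ S) :
    Measurable (S'.domRestrict f) :=
  h.comp (measurable_inclusion hS)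

theorem measurableSet_inter_preimage {β : Type*} [MeasurableSpace β] {f : SFT A → β}
    {S : Set (SFT A)} (hS : MeasurableSet S) (h : Measurable (S.domRestrict f)) {E : Set β}
    (hE : MeasurableSet E) : MeasurableSet (S ∩ f ⁻¹' E) := by
  have := hS.subtype_image (h hE)
  convert this using 1
  ext x
  exact ⟨fun hx => ⟨⟨x, hx.1⟩, hx.2, rfl⟩, fun ⟨z, hz, hzx⟩ => hzx ▸ ⟨z.2, hz⟩⟩

theorem measurableSet_image {h : SFT A → SFT A} {S E : Set (SFT A)}
    (hS : MeasurableSet S) (hm : Measurable (S.domRestrict h)) (hi : InjOn h S)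
    (hE : MeasurableSet E) (hES : E ⊆ S) : MeasurableSet (h '' E) := by
  have h1 := (measurableEmbedding_restrict hS hm hi).measurableSet_image.2
    (measurable_subtype_coe hE)
  convert h1 using 1
  ext y
  constructor
  · rintro ⟨x, hx, rfl⟩; exact ⟨⟨x, hES hx⟩, hx, rfl⟩
  · rintro ⟨x, hx, rfl⟩; exact ⟨x, hx, rfl⟩

theorem HasLogRNOn.mono {m m' : Measure (SFT A)} {h : SFT A → SFT A} {S S' : Set (SFT A)}
    {u : SFT A → ℝ} (H : HasLogRNOn m m' h S u) (hS : S' ⊆ S) : HasLogRNOn m m' h S' u :=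
  fun E hE hm => H E (hE.trans hS) hm

namespace RN

variable {m m' m'' : Measure (SFT A)} {h g : SFT A → SFT A} {S S' : Set (SFT A)}
  {u v : SFT A → ℝ}

theorem mono (H : RN m m' h S u) (hS' : MeasurableSet S') (hS : S' ⊆ S) : RN m m' h S' u :=
  ⟨hS', measurable_restrict_of_subset H.meas_h hS, H.inj.mono hS,
    measurable_restrict_of_subset H.meas_u hS, H.rn.mono hS⟩

theorem measurableSet_image (H : RN m m' h S u) {E : Set (SFT A)} (hE : MeasurableSet E)
    (hES : E ⊆ S) : MeasurableSet (h '' E) :=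
  SFT.measurableSet_image H.measS H.meas_h H.inj hE hES

theorem refl (m : Measure (SFT A)) (hS : MeasurableSet S) : RN m m id S (fun _ => 0) :=
  ⟨hS, measurable_subtype_coe, injOn_id _, measurable_const, fun E _ _ => by simp⟩

theorem congr (H : RN m m' h S u) (hg : EqOn h g S) (hv : EqOn u v S) : RN m m' g S v := by
  refine ⟨H.measS, ?_, H.inj.congr hg, ?_, fun E hE hm => ?_⟩
  · rw [← domRestrict_eq_domRestrict_iff.2 hg]; exact H.meas_h
  · rw [← domRestrict_eq_domRestrict_iff.2 hv]; exact H.meas_u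
  · rw [← (hg.mono hE).image_eq, H.rn E hE hm]
    exact setLIntegral_congr_fun hm fun x hx => by rw [hv (hE hx)]

/-- The set identity says that `m'` on `h '' S` is the pushforward of the weighted measure `exp u •
m` on `S`. No measurability of `G` is needed, because `h` is a measurable embedding on `S` and the
density is finite. -/
theorem lintegral_image (H : RN m m' h S u) (G : SFT A → ℝ≥0∞) :
    ∫⁻ y in h '' S, G y ∂m' = ∫⁻ x in S, ENNReal.ofReal (Real.exp (u x)) * G (h x) ∂m := by
  have hemb := measurableEmbedding_restrict H.measS H.meas_h H.inj
  have hd : Measurable (fun z : S => ENNReal.ofReal (Real.exp (u z))) :=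
    ENNReal.measurable_ofReal.comp (Real.measurable_exp.comp H.meas_u)
  have key : m'.restrict (h '' S) = ((m.comap Subtype.val).withDensity
      (fun z : S => ENNReal.ofReal (Real.exp (u z)))).map (S.domRestrict h) := by
    ext F hF
    have h2 := H.rn (S ∩ h ⁻¹' F) inter_subset_left
      (measurableSet_inter_preimage H.measS H.meas_h hF)
    rw [Measure.restrict_apply hF, inter_comm, ← image_inter_preimage, h2, hemb.map_apply,
      withDensity_apply _ (H.meas_h hF), ← lintegral_indicator (H.meas_h hF),
      ← lintegral_indicator (measurableSet_inter_preimage H.measS H.meas_h hF)]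
    have h3 := lintegral_subtype_comap H.measS (μ := m)
      ((h ⁻¹' F).indicator fun x => ENNReal.ofReal (Real.exp (u x)))
    rw [← lintegral_indicator H.measS, indicator_indicator] at h3
    rw [← h3]
    rfl
  rw [key, hemb.lintegral_map, lintegral_withDensity_eq_lintegral_mul_non_measurable _ hd
    (by simp)]
  exact lintegral_subtype_comap H.measS (μ := m)
    (fun x => ENNReal.ofReal (Real.exp (u x)) * G (h x))

theorem inv (H : RN m m' h S u) (hg : LeftInvOn g h S) :
    RN m' m g (h '' S) (fun y => -u (g y)) := by
  have hS' := H.measurableSet_image H.measS Subset.rfl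
  -- A preimage under `w ∘ g` is an image under `h`, and such images are Borel.
  have key : ∀ {β : Type} [MeasurableSpace β] (w : SFT A → β), Measurable (S.domRestrict w) →
      Measurable ((h '' S).domRestrict fun y => w (g y)) := by
    intro β _ w hw E hE
    have h1 : Subtype.val ⁻¹' (h '' (S ∩ w ⁻¹' E)) = ((h '' S).domRestrict fun y => w (g y)) ⁻¹' E := by
      ext ⟨y, x, hx, rfl⟩
      rw [mem_preimage, mem_preimage, domRestrict_apply]
      simp only [hg hx]
      constructor
      · rintro ⟨x', ⟨hx', hw'⟩, he⟩
        rw [H.inj hx' hx he] at hw'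
        exact hw'
      · exact fun hw' => ⟨x, ⟨hx, hw'⟩, rfl⟩
    rw [← h1]
    exact measurable_subtype_coe (H.measurableSet_image
      (measurableSet_inter_preimage H.measS hw hE) inter_subset_left)
  refine ⟨hS', key (fun x => x) measurable_subtype_coe, ?_, (key u H.meas_u).neg, ?_⟩
  · rintro _ ⟨x, hx, rfl⟩ _ ⟨y, hy, rfl⟩ hxy
    rw [hg hx, hg hy] at hxy
    rw [hxy]
  · intro E hE hm
    obtain ⟨F, hF⟩ : ∃ F, F = S ∩ h ⁻¹' E := ⟨_, rfl⟩
    have hFm : MeasurableSet F := hF ▸ measurableSet_inter_preimage H.measS H.meas_h hm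
    have hFS : F ⊆ S := hF ▸ inter_subset_left
    have hEF : E = h '' F := by
      rw [hF, image_inter_preimage, inter_eq_right.2 hE]
    have hgE : g '' E = F := by
      rw [hEF, image_image]
      exact (image_congr fun x hx => hg (hFS hx)).trans (image_id' F)
    rw [hgE, hEF, (H.mono hFm hFS).lintegral_image, ← setLIntegral_one]
    refine setLIntegral_congr_fun hFm fun x hx => ?_
    simp only
    rw [hg (hFS hx), ← ENNReal.ofReal_mul (Real.exp_pos _).le, ← Real.exp_add, add_neg_cancel,
      Real.exp_zero, ENNReal.ofReal_one]

theorem comp (H : RN m m' h S u) (H' : RN m' m'' g S' v) :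
    RN m m'' (g ∘ h) (S ∩ h ⁻¹' S') (fun x => u x + v (h x)) := by
  have hS := measurableSet_inter_preimage H.measS H.meas_h H'.measS
  have hh : Measurable fun z : ↥(S ∩ h ⁻¹' S') => (⟨h z, z.2.2⟩ : S') :=
    (measurable_restrict_of_subset H.meas_h inter_subset_left).subtype_mk
  refine ⟨hS, H'.meas_h.comp hh, ?_,
    (measurable_restrict_of_subset H.meas_u inter_subset_left).add (H'.meas_u.comp hh), ?_⟩
  · intro x hx y hy hxy
    exact H.inj hx.1 hy.1 (H'.inj hx.2 hy.2 hxy)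
  · intro E hE hm
    have hES : E ⊆ S := hE.trans inter_subset_left
    have hhE : h '' E ⊆ S' := by
      rintro _ ⟨x, hx, rfl⟩; exact (hE hx).2
    rw [image_comp, H'.rn _ hhE (H.measurableSet_image hm hES), (H.mono hm hES).lintegral_image]
    refine setLIntegral_congr_fun hm fun x hx => ?_
    simp only
    rw [← ENNReal.ofReal_mul (Real.exp_pos _).le, ← Real.exp_add]

theorem comp_of_mapsTo (H : RN m m' h S u) (H' : RN m' m'' g S' v) (hm : MapsTo h S S') :
    RN m m'' (g ∘ h) S (fun x => u x + v (h x)) := by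
  have := H.comp H'
  rwa [inter_eq_left.2 (show S ⊆ h ⁻¹' S' from hm)] at this

theorem ae_eq [IsFiniteMeasure m] (H : RN m m' h S u) (H' : RN m m' h S v) :
    ∀ᵐ x ∂(m.restrict S), u x = v x := by
  have hu : AEMeasurable (fun x => ENNReal.ofReal (Real.exp (u x))) (m.restrict S) := by
    refine ENNReal.measurable_ofReal.comp_aemeasurable (Real.measurable_exp.comp_aemeasurable ?_)
    exact (aemeasurable_restrict_iff_comap_subtype H.measS).2 H.meas_u.aemeasurable
  have hv : AEMeasurable (fun x => ENNReal.ofReal (Real.exp (v x))) (m.restrict S) := by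
    refine ENNReal.measurable_ofReal.comp_aemeasurable (Real.measurable_exp.comp_aemeasurable ?_)
    exact (aemeasurable_restrict_iff_comap_subtype H.measS).2 H'.meas_u.aemeasurable
  have h1 := ae_eq_of_forall_setLIntegral_eq_of_sigmaFinite₀ hu hv fun E hE _ => by
    rw [Measure.restrict_restrict hE, ← H.rn _ inter_subset_right (hE.inter H.measS),
      ← H'.rn _ inter_subset_right (hE.inter H.measS)]
  filter_upwards [h1] with x hx
  rw [ENNReal.ofReal_eq_ofReal_iff (Real.exp_pos _).le (Real.exp_pos _).le] at hx
  exact Real.exp_injective hx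

theorem of_pieces {ι : Type*} [Countable ι] (P : ι → Set (SFT A))
    (hP : ∀ i, MeasurableSet (P i)) (hd : Pairwise (Function.onFun Disjoint P))
    (hc : ∀ x ∈ S, ∃ i, x ∈ P i) (hS : MeasurableSet S) (hm : Measurable (S.domRestrict h))
    (hi : InjOn h S) (hu : Measurable (S.domRestrict u))
    (H : ∀ i, HasLogRNOn m m' h (S ∩ P i) u) : RN m m' h S u := by
  refine ⟨hS, hm, hi, hu, fun E hE hEm => ?_⟩
  have hE' : E = ⋃ i, E ∩ P i := by
    rw [← inter_iUnion]
    exact (inter_eq_left.2 fun x hx => mem_iUnion.2 (hc x (hE hx))).symm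
  have hd' : Pairwise (Function.onFun Disjoint fun i => E ∩ P i) := fun i j hij =>
    (hd hij).mono inter_subset_right inter_subset_right
  have hm' : ∀ i, MeasurableSet (E ∩ P i) := fun i => hEm.inter (hP i)
  conv_lhs => rw [hE']
  conv_rhs => rw [hE']
  rw [image_iUnion, measure_iUnion, lintegral_iUnion hm' hd']
  · exact tsum_congr fun i => H i _ (inter_subset_inter_left _ hE) (hm' i)
  · intro i j hij
    refine disjoint_left.2 ?_
    rintro _ ⟨x, hx, rfl⟩ ⟨y, hy, hxy⟩
    have := hi (hE hx.1) (hE hy.1) hxy.symm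
    subst this
    exact disjoint_left.1 (hd hij) hx.2 hy.2
  · exact fun i => SFT.measurableSet_image hS hm hi (hm' i) (inter_subset_left.trans hE)

/-- The inverse map also has a density, so it would carry a null image back to a null set. -/
theorem measure_image_pos (H : RN m m' h S u) (hS : m S ≠ 0) : m' (h '' S) ≠ 0 := by
  rw [H.rn S Subset.rfl H.measS]
  intro h0
  have hne : Nonempty (SFT A) := by
    obtain ⟨x, -⟩ := nonempty_of_measure_ne_zero hS
    exact ⟨x⟩
  have hg : LeftInvOn (Function.invFunOn h S) h S := H.inj.leftInvOn_invFunOn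
  have h1 := (H.inv hg).rn _ Subset.rfl (H.measurableSet_image H.measS Subset.rfl)
  rw [Measure.restrict_eq_zero.2 (by rw [H.rn S Subset.rfl H.measS, h0]), lintegral_zero_measure,
    hg.image_image] at h1
  exact hS h1

end RN

/-- The pullback of the measure `m` to `S` under a map which is injective on `S`. -/
noncomputable def pullback (m : Measure (SFT A)) (h : SFT A → SFT A) (S : Set (SFT A)) :
    Measure (SFT A) :=
  (m.comap fun z : S => h z.1).map Subtype.val

theorem pullback_apply {m : Measure (SFT A)} {h : SFT A → SFT A} {S E : Set (SFT A)}
    (hS : MeasurableSet S) (hm : Measurable (S.domRestrict h)) (hi : InjOn h S)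
    (hE : MeasurableSet E) : pullback m h S E = m (h '' (S ∩ E)) := by
  have hemb := measurableEmbedding_restrict hS hm hi
  unfold pullback
  rw [Measure.map_apply measurable_subtype_coe hE,
    show (fun z : S => h z.1) = S.domRestrict h from rfl, hemb.comap_apply]
  congr 1
  ext y
  constructor
  · rintro ⟨x, hx, rfl⟩; exact ⟨x, ⟨x.2, hx⟩, rfl⟩
  · rintro ⟨x, hx, rfl⟩; exact ⟨⟨x, hx.1⟩, hx.2, rfl⟩

theorem pullback_rn (m : Measure (SFT A)) {h : SFT A → SFT A} {S : Set (SFT A)}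
    (hS : MeasurableSet S) (hm : Measurable (S.domRestrict h)) (hi : InjOn h S) :
    RN (pullback m h S) m h S (fun _ => 0) := by
  refine ⟨hS, hm, hi, measurable_const, fun E hE hEm => ?_⟩
  simp [pullback_apply hS hm hi hEm, inter_eq_right.2 hE]

theorem FwdHolderOn.measurable {f : SFT A → ℝ} {S : Set (SFT A)} (h : FwdHolderOn f S) :
    Measurable (S.domRestrict f) :=
  h.continuousOn.domRestrict.measurable

end SFT

namespace SFT

variable {r : ℕ} {A : Matrix (Fin r) (Fin r) ℕ}

/-! ### Small transversals -/

namespace SmallTransversal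

theorem exists_chart (T : SmallTransversal A) : ∃ (x : SFT A) (ε : ℝ), 0 < ε ∧ ε ≤ 1 ∧
    (T : Set (SFT A)) ⊆ flowBox x ε := by
  obtain ⟨T, x, ε, τ, h0, h1, hτ, hm, rfl⟩ := T
  refine ⟨x, ε, h0, h1, ?_⟩
  rintro _ ⟨z, hz, rfl⟩
  exact ⟨τ z, hm hz, z, hz, rfl⟩

theorem eq_of_forall_apply_eq (T : SmallTransversal A) {p q : SFT A}
    (hp : p ∈ (T : Set (SFT A))) (hq : q ∈ (T : Set (SFT A))) (h : ∀ n : ℕ, p n = q n) :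
    p = q := by
  obtain ⟨T, x, ε, τ, h0, h1, hτ, hm, rfl⟩ := T
  obtain ⟨z, hz, rfl⟩ := hp
  obtain ⟨w, hw, rfl⟩ := hq
  have key : ∀ z ∈ localUnstable x ε, ∀ n : ℕ, (bracket (τ z) z) n = z n := fun z hz n => by
    refine bracket_apply_nonneg ?_ (by positivity)
    rw [← ((mem_localStable h1).1 (hm hz)).1 0 le_rfl, ((mem_localUnstable h1).1 hz).1 0 le_rfl]
  have hzw : z = w := by
    refine SFT.ext (funext fun i => ?_)
    rcases le_total i 0 with hi | hi
    · rw [← ((mem_localUnstable h1).1 hz).1 i hi, ((mem_localUnstable h1).1 hw).1 i hi]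
    · have := h i.toNat
      simp only [key z hz, key w hw] at this
      rwa [show (i.toNat : ℤ) = i by omega] at this
  rw [hzw]

theorem measurableSet (T : SmallTransversal A) : MeasurableSet (T : Set (SFT A)) := by
  obtain ⟨T, x, ε, τ, h0, h1, hτ, hm, rfl⟩ := T
  refine (measurableSet_localUnstable x h1).image_of_continuousOn_injOn
    (continuous_bracket.comp_continuousOn (hτ.prodMk continuousOn_id)) ?_
  intro z hz w hw hzw
  have key : ∀ z ∈ localUnstable x ε, ∀ n : ℕ, (bracket (τ z) z) n = z n := fun z hz n => by
    refine bracket_apply_nonneg ?_ (by positivity)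
    rw [← ((mem_localStable h1).1 (hm hz)).1 0 le_rfl, ((mem_localUnstable h1).1 hz).1 0 le_rfl]
  refine SFT.ext (funext fun i => ?_)
  rcases le_total i 0 with hi | hi
  · rw [← ((mem_localUnstable h1).1 hz).1 i hi, ((mem_localUnstable h1).1 hw).1 i hi]
  · have h2 := key z hz i.toNat
    have h3 := key w hw i.toNat
    simp only at hzw
    rw [hzw] at h2
    rw [show (i.toNat : ℤ) = i by omega] at h2 h3
    rw [← h2, h3]

theorem exists_apply_zero (T : SmallTransversal A) :
    ∃ a, ∀ p ∈ (T : Set (SFT A)), p 0 = a := by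
  obtain ⟨x, ε, h0, h1, h⟩ := T.exists_chart
  exact ⟨x 0, fun p hp => ((mem_flowBox h1).1 (h hp)).1⟩

end SmallTransversal

theorem coe_unstableTransversal (x : SFT A) (ε : ℝ) (h0 : 0 < ε) (h1 : ε ≤ 1) :
    (unstableTransversal x ε h0 h1 : Set (SFT A)) = localUnstable x ε := rfl

theorem mem_localUnstable_of_fwdAgree {x z : SFT A} {ε : ℝ} (h1 : ε ≤ 1)
    (hp : ∀ i : ℤ, i ≤ 0 → x i = z i) {n : ℕ} (hn : 2 * (1 / 2 : ℝ) ^ n < ε)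
    (h : FwdAgree n x z) : z ∈ localUnstable x ε := by
  rw [mem_localUnstable h1, dist_eq_fwdDist hp]
  exact ⟨hp, (fwdDist_le h).trans_lt hn⟩

/-- For `ε ≤ 1 / 2` the points involved also agree at coordinate `1`, so the shift exactly doubles
the forward distance. With `ε = 1 / 2` this supplies around every point a transversal whose image
under `σ` is again a small transversal. -/
theorem shift_image_localUnstable (x : SFT A) {ε : ℝ} (h1 : ε ≤ 1 / 2) :
    localUnstable (shift A x) (2 * ε) = shift A '' localUnstable x ε := by
  have key : ∀ z : SFT A, (∀ i : ℤ, i ≤ 1 → x i = z i) →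
      fwdDist x z = 1 / 2 * fwdDist (shift A x) (shift A z) := by
    intro z h
    have hs := summable_fwdTerm x z
    unfold fwdDist
    rw [hs.tsum_eq_zero_add, ← tsum_mul_left]
    simp only [Nat.cast_zero, h 0 (by norm_num), if_true, zero_add]
    refine tsum_congr fun i => ?_
    simp only [shift_apply, Nat.cast_add, Nat.cast_one]
    by_cases hi : x (i + 1) = z (i + 1)
    · simp [hi]
    · simp only [hi, if_false]; ring
  ext z
  constructor
  · intro hz
    rw [mem_localUnstable (by linarith)] at hz
    obtain ⟨h2, h3⟩ := hz
    have h4 : ∀ i : ℤ, i ≤ 1 → x i = ((shift A).symm z) i := fun i hi => by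
      have := h2 (i - 1) (by omega)
      rwa [shift_apply, sub_add_cancel] at this
    refine ⟨(shift A).symm z, ?_, Equiv.apply_symm_apply _ _⟩
    rw [mem_localUnstable (by linarith)]
    refine ⟨fun i hi => h4 i (by omega), ?_⟩
    rw [dist_eq_fwdDist fun i hi => h4 i (by omega), key _ h4, Equiv.apply_symm_apply,
      ← dist_eq_fwdDist h2]
    linarith
  · rintro ⟨w, hw, rfl⟩
    rw [mem_localUnstable (by linarith)] at hw
    have h4 : ∀ i : ℤ, i ≤ 1 → x i = w i := fun i hi => by
      rcases hi.lt_or_eq with hi | rfl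
      · exact hw.1 i (by omega)
      · refine eq_of_dist_lt_pow (hw.2.trans_le ?_)
        simpa using h1
    have h5 : ∀ i : ℤ, i ≤ 0 → (shift A x) i = (shift A w) i := fun i hi => h4 _ (by omega)
    rw [mem_localUnstable (by linarith)]
    refine ⟨h5, ?_⟩
    rw [dist_eq_fwdDist h5]
    have := hw.2
    rw [dist_eq_fwdDist hw.1, key _ h4] at this
    linarith

/-! ### Hölder functions of the future -/

theorem FwdHolderOn.eq_of_forall_apply_eq {f : SFT A → ℝ} (h : FwdHolderOn f univ) {x y : SFT A}
    (hxy : ∀ n : ℕ, x n = y n) : f x = f y := by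
  obtain ⟨C, β, hC, h0, h1, h⟩ := h
  have ht : Tendsto (fun n : ℕ => C * β ^ n) atTop (𝓝 (C * 0)) :=
    (tendsto_pow_atTop_nhds_zero_of_lt_one h0.le h1).const_mul C
  have h2 : |f x - f y| ≤ C * 0 :=
    ge_of_tendsto' ht fun n => h n x trivial y trivial fun i _ => hxy i
  rw [mul_zero] at h2
  exact sub_eq_zero.1 (abs_nonpos_iff.1 h2)

theorem FwdHolderOn.coordHolder {f : SFT A → ℝ} (h : FwdHolderOn f univ) : CoordHolder f := by
  obtain ⟨C, β, hC, h0, h1, h⟩ := h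
  exact ⟨C, β, hC, h0, h1, fun n x y hxy => h n x trivial y trivial hxy.fwd⟩

theorem FwdHolderOn.comp_shift_iterate {f : SFT A → ℝ} (h : FwdHolderOn f univ) (k : ℕ) :
    FwdHolderOn (fun x => f ((shift A)^[k] x)) univ := by
  obtain ⟨C, β, hC, h0, h1, h⟩ := h
  refine ⟨C / β ^ k, β, by positivity, h0, h1, fun n x _ y _ hxy => ?_⟩
  have h2 := h (n - k) ((shift A)^[k] x) trivial ((shift A)^[k] y) trivial fun i hi => by
    rw [shift_iterate_apply, shift_iterate_apply]
    have := hxy (i + k) (by omega)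
    exact_mod_cast this
  refine h2.trans ?_
  rw [div_mul_eq_mul_div, mul_div_assoc]
  gcongr
  rw [le_div_iff₀ (by positivity), ← pow_add]
  exact pow_le_pow_of_le_one h0.le h1.le (by omega)

/-- The Birkhoff sum over the shift. -/
noncomputable def birkhoff (θ : SFT A → ℝ) (n : ℕ) (x : SFT A) : ℝ :=
  ∑ k ∈ Finset.range n, θ ((shift A)^[k] x)

theorem FwdHolderOn.birkhoff {θ : SFT A → ℝ} (h : FwdHolderOn θ univ) (n : ℕ) :
    FwdHolderOn (birkhoff θ n) univ := by
  induction n with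
  | zero => exact (fwdHolderOn_const 0 _).congr fun x _ => by simp [SFT.birkhoff]
  | succ n ih =>
    refine (ih.add (h.comp_shift_iterate n)).congr fun x _ => ?_
    simp [SFT.birkhoff, Finset.sum_range_succ]

/-! ### The retraction onto a fixed system of local unstable sets -/

section Retraction

variable [Nonempty (SFT A)]

variable (A) in
/-- A point of `Σ_A` with symbol `a` at time `0`. -/
noncomputable def base (a : Fin r) : SFT A := Classical.epsilon fun x : SFT A => x 0 = a

theorem base_apply_zero (x : SFT A) : (base A (x 0)) 0 = x 0 :=
  Classical.epsilon_spec (p := fun y : SFT A => y 0 = x 0) ⟨x, rfl⟩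

/-- Replaces the past of `x` by that of the base point with the same symbol at time `0`. -/
noncomputable def retr (x : SFT A) : SFT A := bracket (base A (x 0)) x

theorem retr_apply_nonneg (x : SFT A) {i : ℤ} (hi : 0 ≤ i) : (retr x) i = x i :=
  bracket_apply_nonneg (base_apply_zero x) hi

theorem retr_apply_nat (x : SFT A) (n : ℕ) : (retr x) n = x n :=
  retr_apply_nonneg x (by positivity)

theorem retr_apply_nonpos (x : SFT A) {i : ℤ} (hi : i ≤ 0) : (retr x) i = (base A (x 0)) i :=
  bracket_apply_nonpos (base_apply_zero x) hi

theorem fwdAgree_retr (n : ℕ) (x : SFT A) : FwdAgree n (retr x) x :=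
  fun i _ => retr_apply_nat x i

theorem retr_eq_retr {x y : SFT A} (h : ∀ n : ℕ, x n = y n) : retr x = retr y := by
  refine SFT.ext (funext fun i => ?_)
  have h0 : x 0 = y 0 := h 0
  rcases le_total i 0 with hi | hi
  · rw [retr_apply_nonpos _ hi, retr_apply_nonpos _ hi, h0]
  · have := h i.toNat
    rw [show (i.toNat : ℤ) = i by omega] at this
    rw [retr_apply_nonneg _ hi, retr_apply_nonneg _ hi, this]

theorem apply_eq_of_retr_eq {x y : SFT A} (h : retr x = retr y) (n : ℕ) : x n = y n := by
  rw [← retr_apply_nat, h, retr_apply_nat]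

theorem retr_retr (x : SFT A) : retr (retr x) = retr x :=
  retr_eq_retr fun n => retr_apply_nat x n

theorem FwdAgree.agree_retr {n : ℕ} {x y : SFT A} (h : FwdAgree n x y) :
    Agree n (retr x) (retr y) := by
  intro i hi
  rcases le_total i 0 with hi' | hi'
  · have h0 : x 0 = y 0 := h 0 (by omega)
    rw [retr_apply_nonpos _ hi', retr_apply_nonpos _ hi', h0]
  · have := h i.toNat (by omega)
    rw [show (i.toNat : ℤ) = i by omega] at this
    rw [retr_apply_nonneg _ hi', retr_apply_nonneg _ hi', this]

theorem continuous_retr : Continuous (retr : SFT A → SFT A) :=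
  continuous_bracket.comp (((continuous_of_discreteTopology (f := base A)).comp
    (continuous_apply 0)).prodMk continuous_id)

variable (A) in
/-- The union of the unstable sets of the base points. -/
def core : Set (SFT A) := {x | retr x = x}

theorem retr_mem_core (x : SFT A) : retr x ∈ core A := retr_retr x

theorem retr_of_mem {x : SFT A} (hx : x ∈ core A) : retr x = x := hx

theorem isClosed_core : IsClosed (core A) := isClosed_eq continuous_retr continuous_id

theorem measurableSet_core : MeasurableSet (core A) := isClosed_core.measurableSet

theorem core_apply_eq {x y : SFT A} (hx : x ∈ core A) (hy : y ∈ core A) (h : x 0 = y 0) {i : ℤ}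
    (hi : i ≤ 0) : x i = y i := by
  rw [← retr_of_mem hx, ← retr_of_mem hy, retr_apply_nonpos _ hi, retr_apply_nonpos _ hi, h]

theorem core_ext {x y : SFT A} (hx : x ∈ core A) (hy : y ∈ core A) (h : ∀ n : ℕ, x n = y n) :
    x = y := by
  rw [← retr_of_mem hx, ← retr_of_mem hy]; exact retr_eq_retr h

theorem CoordHolder.fwdHolderOn_of_core {f : SFT A → ℝ} (h : CoordHolder f)
    (hf : ∀ x, f (retr x) = f x) : FwdHolderOn f univ := by
  obtain ⟨C, β, hC, h0, h1, h⟩ := h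
  refine ⟨C, β, hC, h0, h1, fun n x _ y _ hxy => ?_⟩
  rw [← hf x, ← hf y]
  exact h n _ _ hxy.agree_retr

theorem FwdHolderOn.comp_retr {f : SFT A → ℝ} (h : FwdHolderOn f (core A)) :
    FwdHolderOn (fun x => f (retr x)) univ :=
  h.comp (fun x _ => retr_mem_core x) fun n x _ y _ hxy =>
    ((fwdAgree_retr n x).trans hxy).trans (fwdAgree_retr n y).symm

/-- The one-sided shift, acting on the core. -/
noncomputable def oneShift (x : SFT A) : SFT A := retr (shift A x)

theorem oneShift_iterate (n : ℕ) (x : SFT A) :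
    oneShift^[n] (retr x) = retr ((shift A)^[n] x) := by
  induction n with
  | zero => rfl
  | succ n ih =>
    rw [Function.iterate_succ_apply', ih, Function.iterate_succ_apply']
    refine retr_eq_retr fun k => ?_
    rw [shift_apply, shift_apply, retr_apply_nonneg _ (by positivity)]

theorem continuous_oneShift : Continuous (oneShift : SFT A → SFT A) :=
  continuous_retr.comp continuous_shift

theorem injOn_retr (T : SmallTransversal A) : InjOn retr (T : Set (SFT A)) :=
  fun _ hx _ hy hxy => T.eq_of_forall_apply_eq hx hy (apply_eq_of_retr_eq hxy)

theorem measurable_restrict_retr (S : Set (SFT A)) : Measurable (S.domRestrict retr) :=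
  continuous_retr.measurable.comp measurable_subtype_coe

/-- The pullback to a small transversal of a measure on the core. -/
noncomputable def pull (ν : Measure (SFT A)) (T : SmallTransversal A) : Measure (SFT A) :=
  pullback ν retr T

theorem pull_rn (ν : Measure (SFT A)) (T : SmallTransversal A) :
    RN (pull ν T) ν retr T (fun _ => 0) :=
  pullback_rn ν T.measurableSet (measurable_restrict_retr _) (injOn_retr T)

theorem pull_apply (ν : Measure (SFT A)) (T : SmallTransversal A) {E : Set (SFT A)}
    (hE : MeasurableSet E) : pull ν T E = ν (retr '' ((T : Set (SFT A)) ∩ E)) :=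
  pullback_apply T.measurableSet (measurable_restrict_retr _) (injOn_retr T) hE

theorem pull_compl (ν : Measure (SFT A)) (T : SmallTransversal A) :
    pull ν T (T : Set (SFT A))ᶜ = 0 := by
  rw [pull_apply ν T T.measurableSet.compl]; simp

instance (ν : Measure (SFT A)) [IsFiniteMeasure ν] (T : SmallTransversal A) :
    IsFiniteMeasure (pull ν T) :=
  ⟨by rw [pull_apply ν T MeasurableSet.univ]; exact measure_lt_top _ _⟩

end Retraction

/-- On `S` the map `h` is `p'⁻¹ ∘ p`, so its derivative follows from those of the two charts `p` and
`p'` into `ν`. Usually both charts are `retr`, possibly followed by iterates of `oneShift`. -/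
theorem RN.lift [Nonempty (SFT A)] {m m' ν : Measure (SFT A)} {p p' h : SFT A → SFT A}
    {S S' : Set (SFT A)} {u u' : SFT A → ℝ} (H : RN m ν p S u) (H' : RN m' ν p' S' u')
    (hm : MapsTo h S S') (hp : ∀ x ∈ S, p' (h x) = p x) :
    RN m m' h S (fun x => u x - u' (h x)) := by
  have hg := H'.inj.leftInvOn_invFunOn
  have hmaps : MapsTo p S (p' '' S') := fun x hx => ⟨h x, hm hx, hp x hx⟩
  have key : ∀ x ∈ S, Function.invFunOn p' S' (p x) = h x := fun x hx => by
    rw [← hp x hx]; exact hg (hm hx)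
  refine (H.comp_of_mapsTo (H'.inv hg) hmaps).congr key fun x hx => ?_
  simp only [key x hx]; ring

theorem RN.symm_id {m m' : Measure (SFT A)} {S : Set (SFT A)} {u : SFT A → ℝ}
    (H : RN m m' id S u) : RN m' m id S (fun x => -u x) := by
  have := H.inv (g := _root_.id) (fun _ _ => rfl)
  rwa [image_id] at this

/-! ### Geometry of the holonomy pseudogroup -/

theorem conjugating_apply {y z : SFT A} {n : ℕ} (h : y n = z n) (i : ℤ) :
    (conjugating y n z) i = if i ≤ n then y i else z i := by
  have h0 : ((shift A)^[n] y) 0 = ((shift A)^[n] z) 0 := by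
    rw [shift_iterate_apply, shift_iterate_apply, zero_add, h]
  rw [conjugating, shift_symm_iterate_apply, bracket_apply h0, shift_iterate_apply,
    shift_iterate_apply]
  simp

theorem continuous_conjugating (y : SFT A) (n : ℕ) : Continuous (conjugating y n) :=
  (continuous_shift_symm.iterate n).comp
    ((continuous_bracket_right _).comp (continuous_shift.iterate n))

theorem apply_eq_of_mem_localUnstable {x z : SFT A} {ε : ℝ} {n : ℕ} (h1 : ε ≤ 1)
    (hn : ε ≤ (1 / 2) ^ n) (hz : z ∈ localUnstable x ε) {i : ℤ} (hi : i ≤ n) : x i = z i := by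
  rw [mem_localUnstable h1] at hz
  rcases le_total i 0 with hi' | hi'
  · exact hz.1 i hi'
  · refine eq_of_dist_lt_pow (hz.2.trans_le (hn.trans ?_))
    exact pow_le_pow_of_le_one (by norm_num) (by norm_num) (by omega)

theorem mapsTo_bracket_flowBox (x : SFT A) {ε : ℝ} (h1 : ε ≤ 1) :
    MapsTo (bracket x) (flowBox x ε) (localUnstable x ε) := by
  intro p hp
  rw [mem_flowBox h1] at hp
  rw [mem_localUnstable h1]
  exact ⟨fun i hi => (bracket_apply_nonpos hp.1.symm hi).symm, hp.2.1⟩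

theorem bracket_apply_nat_of_mem_flowBox {x p : SFT A} {ε : ℝ} (h1 : ε ≤ 1)
    (hp : p ∈ flowBox x ε) (n : ℕ) : (bracket x p) n = p n :=
  bracket_apply_nonneg ((mem_flowBox h1).1 hp).1.symm (by positivity)

theorem mapsTo_conjugating {x y : SFT A} {n : ℕ} (hxy : ∀ i : ℤ, (n : ℤ) ≤ i → x i = y i)
    {ε : ℝ} (h1 : ε ≤ 1) (hn : ε ≤ (1 / 2) ^ n) :
    MapsTo (conjugating y n) (localUnstable x ε) (localUnstable y ε) := by
  intro z hz
  have hag : ∀ i : ℤ, i ≤ n → x i = z i := fun i hi => apply_eq_of_mem_localUnstable h1 hn hz hi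
  have hc := conjugating_apply (y := y) (z := z) (n := n)
    (by rw [← hxy n le_rfl, hag n le_rfl])
  have hp : ∀ i : ℤ, i ≤ 0 → y i = (conjugating y n z) i := fun i hi => by
    rw [hc, if_pos (by omega)]
  rw [mem_localUnstable h1] at hz ⊢
  refine ⟨hp, ?_⟩
  rw [dist_eq_fwdDist hp]
  have h2 := hz.2
  rw [dist_eq_fwdDist hz.1] at h2
  convert h2 using 1
  refine tsum_congr fun i => ?_
  rw [hc]
  by_cases hi : (i : ℤ) ≤ n
  · simp [hi, hag i hi]
  · simp only [hi, if_false, hxy i (by omega)]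

/-- The coarse geometry of a holonomy transformation. -/
structure IsFwdIsometry (T T' : SmallTransversal A) (S : Set (SFT A)) (h : SFT A → SFT A) :
    Prop where
  subset : S ⊆ T
  measS : MeasurableSet S
  meas_h : Measurable (S.domRestrict h)
  mapsTo : MapsTo h S T'
  agree : ∀ n, ∀ z ∈ S, ∀ w ∈ S, FwdAgree n z w ↔ FwdAgree n (h z) (h w)

theorem IsFwdIsometry.injOn {T T' : SmallTransversal A} {S : Set (SFT A)} {h : SFT A → SFT A}
    (H : IsFwdIsometry T T' S h) : InjOn h S := by
  intro z hz w hw hzw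
  refine T.eq_of_forall_apply_eq (H.subset hz) (H.subset hw) fun n => ?_
  exact (H.agree (n + 1) z hz w hw).2 (fun i _ => by rw [hzw]) n (Nat.lt_succ_self n)

/-- For zero measures the derivative condition is void. The calculus of `RN` then yields
measurability of domains, inverses and composites. -/
theorem IsFwdIsometry.rn_zero {T T' : SmallTransversal A} {S : Set (SFT A)}
    {h : SFT A → SFT A} (H : IsFwdIsometry T T' S h) : RN 0 0 h S (fun _ => 0) :=
  ⟨H.measS, H.meas_h, H.injOn, measurable_const, fun E _ _ => by simp⟩

/-- Projections keep the forward coordinates. A conjugating map changes only coordinates up to `n`,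
and there all points of its domain share the letters of `x` and all image points share those of `y`.
-/
theorem Holonomy.isFwdIsometry {T T' : SmallTransversal A} {S : Set (SFT A)}
    {h : SFT A → SFT A} (H : Holonomy T T' S h) : IsFwdIsometry T T' S h := by
  induction H with
  | proj T x ε h0 h1 =>
    refine ⟨inter_subset_left, T.measurableSet.inter (isOpen_flowBox x h1).measurableSet,
      (continuous_bracket_right x).measurable.comp measurable_subtype_coe,
      (mapsTo_bracket_flowBox x h1).mono_left inter_subset_right, ?_⟩
    intro n z hz w hw
    simp only [FwdAgree, bracket_apply_nat_of_mem_flowBox h1 hz.2,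
      bracket_apply_nat_of_mem_flowBox h1 hw.2]
  | conj x y n hxy ε h0 h1 hn =>
    refine ⟨Subset.rfl, measurableSet_localUnstable x h1,
      (continuous_conjugating y n).measurable.comp measurable_subtype_coe,
      mapsTo_conjugating hxy h1 hn, ?_⟩
    intro m z hz w hw
    have hz' : ∀ i : ℤ, i ≤ n → x i = z i := fun i hi => apply_eq_of_mem_localUnstable h1 hn hz hi
    have hw' : ∀ i : ℤ, i ≤ n → x i = w i := fun i hi => apply_eq_of_mem_localUnstable h1 hn hw hi
    have hcz := conjugating_apply (y := y) (z := z) (n := n)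
      (by rw [← hxy n le_rfl, hz' n le_rfl])
    have hcw := conjugating_apply (y := y) (z := w) (n := n)
      (by rw [← hxy n le_rfl, hw' n le_rfl])
    simp only [FwdAgree, hcz, hcw]
    refine forall_congr' fun i => forall_congr' fun _ => ?_
    by_cases hi : (i : ℤ) ≤ n
    · simp only [hi, if_true, ← hz' i hi, ← hw' i hi]
    · simp only [hi, if_false]
  | restrict O hO _ ih =>
    exact ⟨inter_subset_left.trans ih.subset, ih.measS.inter hO.measurableSet,
      measurable_restrict_of_subset ih.meas_h inter_subset_left,
      ih.mapsTo.mono_left inter_subset_left,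
      fun n z hz w hw => ih.agree n z hz.1 w hw.1⟩
  | congr _ heq ih =>
    refine ⟨ih.subset, ih.measS, ?_, ih.mapsTo.congr heq, fun n z hz w hw => ?_⟩
    · rw [← domRestrict_eq_domRestrict_iff.2 heq]; exact ih.meas_h
    · rw [← heq hz, ← heq hw]; exact ih.agree n z hz w hw
  | inv _ hg ih =>
    have hi := ih.rn_zero.inv hg
    refine ⟨image_subset_iff.2 ih.mapsTo, hi.measS, hi.meas_h, ?_, ?_⟩
    · rintro _ ⟨x, hx, rfl⟩
      rw [hg hx]; exact ih.subset hx
    · rintro n _ ⟨x, hx, rfl⟩ _ ⟨y, hy, rfl⟩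
      rw [hg hx, hg hy]; exact (ih.agree n x hx y hy).symm
  | comp _ _ ih ih' =>
    have hc := ih.rn_zero.comp ih'.rn_zero
    refine ⟨inter_subset_left.trans ih.subset, hc.measS, hc.meas_h,
      fun x hx => ih'.mapsTo hx.2, fun n z hz w hw => ?_⟩
    exact (ih.agree n z hz.1 w hw.1).trans (ih'.agree n _ hz.2 _ hw.2)

theorem IsFwdIsometry.rn {T T' : SmallTransversal A} {S : Set (SFT A)}
    {h : SFT A → SFT A} (H : IsFwdIsometry T T' S h) {m m' : Measure (SFT A)} {u : SFT A → ℝ}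
    (hu : FwdHolderOn u S) (hrn : HasLogRNOn m m' h S u) : RN m m' h S u :=
  ⟨H.measS, H.meas_h, H.injOn, hu.measurable, hrn⟩

/-! ### Hölder measure classes -/

theorem mem_holderMeasureClass {T : SmallTransversal A} {m m' : Measure (SFT A)} :
    m' ∈ holderMeasureClass (T : Set (SFT A)) m ↔ m' (T : Set (SFT A))ᶜ = 0 ∧
      ∃ u, FwdHolderOn u T ∧ RN m m' id T u := by
  constructor
  · rintro ⟨h0, u, hu, hrn⟩
    rw [transverselyHolderOn_iff] at hu
    exact ⟨h0, u, hu, T.measurableSet, measurable_subtype_coe, injOn_id _, hu.measurable, hrn⟩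
  · rintro ⟨h0, u, hu, hrn⟩
    exact ⟨h0, u, transverselyHolderOn_iff.2 hu, hrn.rn⟩

theorem self_mem_holderMeasureClass {T : SmallTransversal A} {m : Measure (SFT A)}
    (h : m (T : Set (SFT A))ᶜ = 0) : m ∈ holderMeasureClass (T : Set (SFT A)) m :=
  mem_holderMeasureClass.2 ⟨h, _, fwdHolderOn_const 0 _, RN.refl m T.measurableSet⟩

theorem RN.trans_id {m m' m'' : Measure (SFT A)} {S : Set (SFT A)} {u v : SFT A → ℝ}
    (H : RN m m' id S u) (H' : RN m' m'' id S v) : RN m m'' id S (fun x => u x + v x) :=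
  H.comp_of_mapsTo H' (mapsTo_id S)

theorem holderMeasureClass_eq {T : SmallTransversal A} {m m' : Measure (SFT A)}
    {u : SFT A → ℝ} (hu : FwdHolderOn u T) (H : RN m m' id T u) :
    holderMeasureClass (T : Set (SFT A)) m = holderMeasureClass (T : Set (SFT A)) m' := by
  ext μ
  rw [mem_holderMeasureClass, mem_holderMeasureClass]
  refine and_congr_right fun _ => ⟨?_, ?_⟩
  · rintro ⟨v, hv, hrn⟩
    exact ⟨_, hu.neg.add hv, H.symm_id.trans_id hrn⟩
  · rintro ⟨v, hv, hrn⟩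
    exact ⟨_, hu.add hv, H.trans_id hrn⟩

theorem TransverseMeasureClass.exists_rn {M : TransverseMeasureClass A} {T : SmallTransversal A}
    {m m' : Measure (SFT A)} (hm : m ∈ M.cls T) (hm' : m' ∈ M.cls T) :
    ∃ u, FwdHolderOn u T ∧ RN m m' id T u := by
  obtain ⟨m0, -, h0, hT⟩ := M.isClass T
  rw [hT, mem_holderMeasureClass] at hm hm'
  obtain ⟨-, u, hu, hur⟩ := hm
  obtain ⟨-, v, hv, hvr⟩ := hm'
  exact ⟨_, hu.neg.add hv, hur.symm_id.trans_id hvr⟩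

theorem TransverseMeasureClass.compl_eq_zero {M : TransverseMeasureClass A}
    {T : SmallTransversal A} {m : Measure (SFT A)} (hm : m ∈ M.cls T) :
    m (T : Set (SFT A))ᶜ = 0 := by
  obtain ⟨m0, -, h0, hT⟩ := M.isClass T
  rw [hT, mem_holderMeasureClass] at hm
  exact hm.1

theorem TransverseMeasureClass.exists_finite (M : TransverseMeasureClass A)
    (T : SmallTransversal A) : ∃ m ∈ M.cls T, IsFiniteMeasure m := by
  obtain ⟨m0, hf, h0, hT⟩ := M.isClass T
  exact ⟨m0, hT ▸ self_mem_holderMeasureClass h0, hf⟩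

theorem TransverseMeasureClass.cls_eq {M : TransverseMeasureClass A}
    {T : SmallTransversal A} {m : Measure (SFT A)} (hm : m ∈ M.cls T) :
    M.cls T = holderMeasureClass (T : Set (SFT A)) m := by
  obtain ⟨m0, -, h0, hT⟩ := M.isClass T
  rw [hT] at hm ⊢
  rw [mem_holderMeasureClass] at hm
  obtain ⟨-, u, hu, hur⟩ := hm
  exact holderMeasureClass_eq hu hur

theorem TransverseMeasureClass.exists_rn_holonomy (M : TransverseMeasureClass A)
    {T T' : SmallTransversal A} {S : Set (SFT A)} {h : SFT A → SFT A} (H : Holonomy T T' S h)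
    {m m' : Measure (SFT A)} (hm : m ∈ M.cls T) (hm' : m' ∈ M.cls T') :
    ∃ u, FwdHolderOn u S ∧ RN m m' h S u := by
  obtain ⟨u, hu, hrn⟩ := M.holonomy T T' S h H m hm m' hm'
  rw [transverselyHolderOn_iff] at hu
  exact ⟨u, hu, H.isFwdIsometry.rn hu hrn⟩

end SFT

namespace SFT

variable {r : ℕ} {A : Matrix (Fin r) (Fin r) ℕ}

/-! ### Words -/

/-- The word of the first `n` forward symbols. -/
def word (n : ℕ) (x : SFT A) : Fin n → Fin r := fun i => x (i : ℕ)

theorem word_eq_iff {n : ℕ} {x y : SFT A} : word n x = word n y ↔ FwdAgree n x y := by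
  rw [funext_iff]
  exact ⟨fun h i hi => h ⟨i, hi⟩, fun h i => h i i.2⟩

theorem isClosed_fwdAgree (n : ℕ) (w : SFT A) : IsClosed {x | FwdAgree n w x} := by
  have := isClosed_forall_apply_eq w (fun i => 0 ≤ i ∧ i < n)
  convert this using 1
  ext x
  refine ⟨fun h i hi => ?_, fun h i hi => h i ⟨by positivity, by exact_mod_cast hi⟩⟩
  have := h i.toNat (by omega)
  rwa [show (i.toNat : ℤ) = i by omega] at this

theorem measurable_word (n : ℕ) : Measurable (word n : SFT A → Fin n → Fin r) :=
  measurable_pi_lambda _ fun i => (continuous_apply (i : ℕ)).measurable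

/-! ### Transitivity -/

/-- A tail of a dense forward orbit is the image of that orbit under a continuous surjection, hence
still dense. The time from `U` to `V` can therefore be taken as large as needed. -/
theorem IsTransitive.exists_iterate (h : IsTransitive A) {U V : Set (SFT A)} (hU : IsOpen U)
    (hV : IsOpen V) (hU' : U.Nonempty) (hV' : V.Nonempty) (n : ℕ) :
    ∃ x ∈ U, ∃ k, n ≤ k ∧ (shift A)^[k] x ∈ V := by
  obtain ⟨x, hx⟩ := h
  have hd : DenseRange fun n : ℕ => (shift A)^[n] x := hx
  obtain ⟨m, hm⟩ := hd.exists_mem_open hU hU'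
  have hs : Function.Surjective ((shift A)^[m + n]) := (shift A).surjective.iterate _
  have hd' := hs.denseRange.comp hd (continuous_shift.iterate (m + n))
  obtain ⟨l, hl⟩ := hd'.exists_mem_open hV hV'
  refine ⟨_, hm, n + l, by omega, ?_⟩
  simp only [Function.comp_apply] at hl
  rw [← Function.iterate_add_apply] at hl ⊢
  convert hl using 2
  ring

variable [Nonempty (SFT A)]

variable (A) in
/-- A point of the core with given initial word. -/
noncomputable def wordRep (n : ℕ) (w : Fin n → Fin r) : SFT A :=
  retr (Classical.epsilon fun x => word n x = w)

theorem wordRep_mem (n : ℕ) (w : Fin n → Fin r) : wordRep A n w ∈ core A := retr_mem_core _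

theorem fwdAgree_wordRep (n : ℕ) (x : SFT A) : FwdAgree n (wordRep A n (word n x)) x :=
  (fwdAgree_retr _ _).trans (word_eq_iff.1
    (Classical.epsilon_spec (p := fun y : SFT A => word n y = word n x) ⟨x, rfl⟩))

theorem core_mem_localUnstable {q x : SFT A} (hq : q ∈ core A) (hx : x ∈ core A) {n : ℕ} {ε : ℝ}
    (h1 : ε ≤ 1) (hn : 2 * (1 / 2 : ℝ) ^ n < ε) (hn0 : 0 < n) (h : FwdAgree n q x) :
    x ∈ localUnstable q ε :=
  mem_localUnstable_of_fwdAgree h1 (fun _ hi => core_apply_eq hq hx (h 0 hn0) hi) hn h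

/-! ### Conformal measures -/

/-- A finite measure on the core whose logarithmic Radon-Nikodym derivative under the one-sided
shift is `-θ`. -/
structure Conformal (ν : Measure (SFT A)) (θ : SFT A → ℝ) : Prop where
  fin : IsFiniteMeasure ν
  null : ν (core A)ᶜ = 0
  holder : FwdHolderOn θ univ
  rn : ∀ a, HasLogRNOn ν ν oneShift (core A ∩ {x | x 0 = a}) (fun x => -θ x)

theorem injOn_oneShift (a : Fin r) : InjOn oneShift (core A ∩ {x | x 0 = a}) := by
  intro x hx y hy hxy
  refine core_ext hx.1 hy.1 fun n => ?_
  cases n with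
  | zero => exact hx.2.trans hy.2.symm
  | succ n =>
    have := apply_eq_of_retr_eq hxy n
    rwa [shift_apply, shift_apply] at this

theorem oneShift_iterate_of_mem {x : SFT A} (hx : x ∈ core A) (n : ℕ) :
    oneShift^[n] x = retr ((shift A)^[n] x) := by
  conv_lhs => rw [← retr_of_mem hx]
  exact oneShift_iterate n x

namespace Conformal

variable {ν : Measure (SFT A)} {θ : SFT A → ℝ}

theorem rn_oneShift (h : Conformal ν θ) (a : Fin r) :
    RN ν ν oneShift (core A ∩ {x | x 0 = a}) (fun x => -θ x) :=
  ⟨measurableSet_core.inter (isOpen_apply_eq 0 a).measurableSet,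
    continuous_oneShift.measurable.comp measurable_subtype_coe, injOn_oneShift a,
    (h.holder.neg.mono (subset_univ _)).measurable, h.rn a⟩

/-- Chain rule: fixing the first `n` letters fixes the branch of `oneShift` at every step, and the
logarithmic derivatives add up to a Birkhoff sum. -/
theorem rn_iterate (h : Conformal ν θ) (w : SFT A) (n : ℕ) :
    RN ν ν (oneShift^[n]) (core A ∩ {x | FwdAgree n w x}) (fun x => -birkhoff θ n x) := by
  induction n with
  | zero =>
    refine ((RN.refl ν measurableSet_core).mono ?_ inter_subset_left).congr (fun x _ => rfl)
      fun x _ => by simp [birkhoff]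
    exact measurableSet_core.inter (isClosed_fwdAgree 0 w).measurableSet
  | succ n ih =>
    have h2 := ih.comp (h.rn_oneShift (w n))
    have hS : core A ∩ {x | FwdAgree n w x} ∩ oneShift^[n] ⁻¹' (core A ∩ {x | x 0 = w n}) =
        core A ∩ {x | FwdAgree (n + 1) w x} := by
      ext x
      constructor
      · rintro ⟨⟨hx, hx1⟩, hx2⟩
        refine ⟨hx, fun i hi => ?_⟩
        rcases (Nat.lt_succ_iff.1 hi).lt_or_eq with hi | rfl
        · exact hx1 i hi
        · have h3 : (oneShift^[i] x) 0 = w i := hx2.2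
          rw [oneShift_iterate_of_mem hx, retr_apply_nonneg _ le_rfl, shift_iterate_apply,
            zero_add] at h3
          exact h3.symm
      · rintro ⟨hx, hx1⟩
        refine ⟨⟨hx, FwdAgree.mono hx1 (Nat.le_succ n)⟩, ?_, ?_⟩
        · rw [oneShift_iterate_of_mem hx]; exact retr_mem_core _
        · show (oneShift^[n] x) 0 = w n
          rw [oneShift_iterate_of_mem hx, retr_apply_nonneg _ le_rfl, shift_iterate_apply,
            zero_add]
          exact (hx1 n (Nat.lt_succ_self n)).symm
    rw [hS] at h2
    refine h2.congr (fun x _ => (Function.iterate_succ_apply' _ _ _).symm) fun x hx => ?_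
    have h4 : θ (oneShift^[n] x) = θ ((shift A)^[n] x) := by
      rw [oneShift_iterate_of_mem hx.1]
      exact h.holder.eq_of_forall_apply_eq fun k => retr_apply_nat _ k
    simp only [h4, birkhoff, Finset.sum_range_succ]; ring

/-- Projections do not change the future, so they preserve the pullbacks of `ν`. A conjugating map
`z ↦ z'` becomes the identity after `n` applications of the one-sided shift, so its logarithmic
derivative is the difference of the Birkhoff sums of `θ` at `z'` and `z`. -/
theorem holonomy (hν : Conformal ν θ) {T T' : SmallTransversal A} {S : Set (SFT A)}
    {h : SFT A → SFT A} (H : Holonomy T T' S h) :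
    ∃ u, FwdHolderOn u S ∧ RN (pull ν T) (pull ν T') h S u := by
  induction H with
  | proj T x ε h0 h1 =>
    have hi := (Holonomy.proj T x ε h0 h1).isFwdIsometry
    refine ⟨_, fwdHolderOn_const 0 _, (((pull_rn ν T).mono hi.measS hi.subset).lift
      (pull_rn ν _) hi.mapsTo fun p hp => ?_).congr (fun _ _ => rfl) fun _ _ => sub_zero _⟩
    exact retr_eq_retr (bracket_apply_nat_of_mem_flowBox h1 hp.2)
  | conj x y n hxy ε h0 h1 hn =>
    have hi := (Holonomy.conj x y n hxy ε h0 h1 hn).isFwdIsometry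
    have key : ∀ x : SFT A, MapsTo retr (localUnstable x ε) (core A ∩ {z | FwdAgree n x z}) :=
      fun x z hz => ⟨retr_mem_core z, fun i hin => by
        rw [retr_apply_nat]
        exact apply_eq_of_mem_localUnstable h1 hn hz (by exact_mod_cast hin.le)⟩
    have H1 := (pull_rn ν (unstableTransversal x ε h0 h1)).comp_of_mapsTo
      (hν.rn_iterate x n) (key x)
    have H2 := (pull_rn ν (unstableTransversal y ε h0 h1)).comp_of_mapsTo
      (hν.rn_iterate y n) (key y)
    have hb : ∀ z, birkhoff θ n (retr z) = birkhoff θ n z := fun z =>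
      (hν.holder.birkhoff n).eq_of_forall_apply_eq (retr_apply_nat z)
    refine ⟨fun z => -birkhoff θ n z + birkhoff θ n (conjugating y n z), ?_,
      (H1.lift H2 hi.mapsTo fun z hz => ?_).congr (fun _ _ => rfl) fun z hz => ?_⟩
    · refine ((hν.holder.birkhoff n).neg.mono (subset_univ _)).add ?_
      exact (hν.holder.birkhoff n).comp (mapsTo_univ _ _)
        fun k z hz w hw => (hi.agree k z hz w hw).1
    · simp only [Function.comp_apply]
      rw [oneShift_iterate, oneShift_iterate]
      refine retr_eq_retr fun k => ?_
      rw [shift_iterate_apply, shift_iterate_apply, conjugating_apply]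
      · split_ifs with hk
        · have hk0 : k = 0 := by omega
          subst hk0
          simp only [Nat.cast_zero, zero_add]
          rw [← hxy n le_rfl]
          exact apply_eq_of_mem_localUnstable h1 hn hz le_rfl
        · rfl
      · rw [← hxy n le_rfl]
        exact apply_eq_of_mem_localUnstable h1 hn hz le_rfl
    · simp only [hb]; ring
  | restrict O hO _ ih =>
    obtain ⟨u, hu, hr⟩ := ih
    exact ⟨u, hu.mono inter_subset_left,
      hr.mono (hr.measS.inter hO.measurableSet) inter_subset_left⟩
  | congr _ heq ih =>
    obtain ⟨u, hu, hr⟩ := ih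
    exact ⟨u, hu, hr.congr heq fun _ _ => rfl⟩
  | inv hh hg ih =>
    obtain ⟨u, hu, hr⟩ := ih
    refine ⟨_, ?_, hr.inv hg⟩
    refine (hu.comp ?_ ?_).neg
    · rintro _ ⟨x, hx, rfl⟩
      rwa [hg hx]
    · rintro n _ ⟨x, hx, rfl⟩ _ ⟨y, hy, rfl⟩ hxy
      rw [hg hx, hg hy]
      exact (hh.isFwdIsometry.agree n x hx y hy).2 hxy
  | comp hh _ ih ih' =>
    obtain ⟨u, hu, hr⟩ := ih
    obtain ⟨u', hu', hr'⟩ := ih'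
    refine ⟨_, (hu.mono inter_subset_left).add (hu'.comp (fun x hx => hx.2) ?_), hr.comp hr'⟩
    exact fun n x hx y hy => (hh.isFwdIsometry.agree n x hx.1 y hy.1).1

/-- The retraction intertwines `shift A` with `oneShift`, so the derivative is read off on the core.
-/
theorem shift_rn (hν : Conformal ν θ) {T T' : SmallTransversal A}
    (hT : (T' : Set (SFT A)) = shift A '' (T : Set (SFT A))) :
    RN (pull ν T) (pull ν T') (shift A) T (fun x => -θ x) := by
  obtain ⟨a, ha⟩ := T.exists_apply_zero
  have H1 := (pull_rn ν T).comp_of_mapsTo (hν.rn_oneShift a)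
    fun x hx => ⟨retr_mem_core x, (retr_apply_nonneg x le_rfl).trans (ha x hx)⟩
  refine (H1.lift (pull_rn ν T') (h := shift A) ?_ fun x _ => ?_).congr (fun _ _ => rfl)
    fun x _ => ?_
  · rw [hT]; exact mapsTo_image _ _
  · exact (oneShift_iterate 1 x).symm
  · have : θ (retr x) = θ x := hν.holder.eq_of_forall_apply_eq (retr_apply_nat x)
    simp only [this]; ring

theorem exists_pull_ne_zero (hν : Conformal ν θ) (h0 : ν ≠ 0) :
    ∃ T : SmallTransversal A, pull ν T ≠ 0 := by
  by_contra! hcon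
  apply h0
  rw [← Measure.measure_univ_eq_zero]
  -- Two letters suffice: by `2 * (1 / 2) ^ 2 < 1`, each such cylinder of the core lies in an
  -- unstable set of size `1`.
  have hsub : (univ : Set (SFT A)) ⊆ (core A)ᶜ ∪ ⋃ w : Fin 2 → Fin r,
      (core A ∩ {x | FwdAgree 2 (wordRep A 2 w) x}) := by
    intro x _
    by_cases hx : x ∈ core A
    · exact Or.inr (mem_iUnion.2 ⟨word 2 x, hx, fwdAgree_wordRep 2 x⟩)
    · exact Or.inl hx
  refine measure_mono_null hsub (measure_union_null hν.null (measure_iUnion_null fun w => ?_))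
  have h1 := pull_apply ν (unstableTransversal (wordRep A 2 w) 1 one_pos le_rfl)
    MeasurableSet.univ
  rw [hcon, Measure.coe_zero, Pi.zero_apply, inter_univ] at h1
  refine measure_mono_null (fun x hx => ?_) h1.symm
  exact ⟨x, core_mem_localUnstable (wordRep_mem 2 w) hx.1 le_rfl (by norm_num) two_pos hx.2,
    hx.1⟩

/-- The transverse measure class represented by a conformal measure. -/
noncomputable def toClass (hν : Conformal ν θ) (h0 : ν ≠ 0) : TransverseMeasureClass A where
  cls T := holderMeasureClass (T : Set (SFT A)) (pull ν T)
  isClass T := by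
    have := hν.fin
    exact ⟨pull ν T, inferInstance, pull_compl ν T, rfl⟩
  holonomy T T' S h H m hm m' hm' := by
    have hi := H.isFwdIsometry
    obtain ⟨-, v, hv, hvr⟩ := mem_holderMeasureClass.1 hm
    obtain ⟨-, v', hv', hvr'⟩ := mem_holderMeasureClass.1 hm'
    obtain ⟨u, hu, hr⟩ := hν.holonomy H
    have h1 := (hvr.symm_id.mono hi.measS hi.subset).comp_of_mapsTo hr (mapsTo_id S)
    have h2 := h1.comp_of_mapsTo hvr' hi.mapsTo
    refine ⟨_, transverselyHolderOn_iff.2 ?_, h2.rn⟩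
    refine ((hv.neg.mono hi.subset).add hu).add (hv'.comp hi.mapsTo ?_)
    exact fun n x hx y hy => (hi.agree n x hx y hy).1
  nonzero := by
    obtain ⟨T, hT⟩ := hν.exists_pull_ne_zero h0
    exact ⟨T, _, self_mem_holderMeasureClass (pull_compl ν T), hT⟩

end Conformal

/-- The measure `ν` on the core represents the class `M`. -/
def Represents (ν : Measure (SFT A)) (M : TransverseMeasureClass A) : Prop :=
  ∀ T, pull ν T ∈ M.cls T

theorem Conformal.represents_toClass {ν : Measure (SFT A)} {θ : SFT A → ℝ} (hν : Conformal ν θ)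
    (h0 : ν ≠ 0) : Represents ν (hν.toClass h0) :=
  fun T => self_mem_holderMeasureClass (pull_compl ν T)

theorem Conformal.shiftInvariant {ν : Measure (SFT A)} {θ : SFT A → ℝ} (hν : Conformal ν θ)
    {M : TransverseMeasureClass A} (hM : Represents ν M) : M.ShiftInvariant := by
  intro T T' hT m hm m' hm'
  obtain ⟨u, hu, hur⟩ := TransverseMeasureClass.exists_rn hm (hM T)
  obtain ⟨v, hv, hvr⟩ := TransverseMeasureClass.exists_rn (hM T') hm'
  have hmaps : MapsTo (shift A) (T : Set (SFT A)) T' := by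
    rw [hT]; exact mapsTo_image _ _
  have h1 := (hur.comp_of_mapsTo (hν.shift_rn hT) (mapsTo_id _)).comp_of_mapsTo hvr hmaps
  refine ⟨_, transverselyHolderOn_iff.2 ?_, h1.rn⟩
  refine (hu.add (hν.holder.neg.mono (subset_univ _))).add ?_
  obtain ⟨C, β, hC, h0, hβ1, h⟩ := hv
  -- The shift loses one forward letter, which costs a factor `1 / β`.
  refine ⟨C / β, β, by positivity, h0, hβ1, fun n x hx y hy hxy => ?_⟩
  have h2 := h (n - 1) _ (hmaps hx) _ (hmaps hy) fun i hi => by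
    have := hxy (i + 1) (by omega)
    rw [shift_apply, shift_apply]
    exact_mod_cast this
  refine h2.trans ?_
  rw [div_mul_eq_mul_div, mul_div_assoc]
  gcongr
  rw [le_div_iff₀ h0, ← pow_succ]
  exact pow_le_pow_of_le_one h0.le hβ1.le (by omega)

end SFT

namespace SFT

variable {r : ℕ} {A : Matrix (Fin r) (Fin r) ℕ}

/-! ### More on Hölder functions -/

theorem FwdHolderOn.exists_bound {f : SFT A → ℝ} {S : Set (SFT A)} (h : FwdHolderOn f S) :
    ∃ B, 0 ≤ B ∧ ∀ x ∈ S, |f x| ≤ B := by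
  obtain ⟨C, β, hC, h0, h1, h⟩ := h
  rcases S.eq_empty_or_nonempty with rfl | ⟨z, hz⟩
  · exact ⟨0, le_rfl, fun x hx => by simp at hx⟩
  · refine ⟨C + |f z|, by positivity, fun x hx => ?_⟩
    have h2 := h 0 x hx z hz (fun k hk => by omega)
    have h3 := abs_sub_abs_le_abs_sub (f x) (f z)
    rw [pow_zero, mul_one] at h2
    linarith

theorem CoordHolder.exists_bound {f : SFT A → ℝ} (h : CoordHolder f) :
    ∃ B, 0 ≤ B ∧ ∀ x, |f x| ≤ B := by
  obtain ⟨C, β, hC, h0, h1, h⟩ := h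
  rcases isEmpty_or_nonempty (SFT A) with he | ⟨⟨z⟩⟩
  · exact ⟨0, le_rfl, fun x => he.elim x⟩
  · refine ⟨C + |f z|, by positivity, fun x => ?_⟩
    have h2 := h 0 x z (fun k hk => by omega)
    have h3 := abs_sub_abs_le_abs_sub (f x) (f z)
    rw [pow_zero, mul_one] at h2
    linarith

theorem abs_exp_sub_exp_le {a b B : ℝ} (ha : a ≤ B) (hb : b ≤ B) :
    |Real.exp a - Real.exp b| ≤ Real.exp B * |a - b| := by
  wlog hab : b ≤ a generalizing a b
  · rw [abs_sub_comm, abs_sub_comm a b]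
    exact this hb ha (le_of_not_ge hab)
  rw [abs_of_nonneg (sub_nonneg.2 (Real.exp_le_exp.2 hab)), abs_of_nonneg (sub_nonneg.2 hab)]
  have h1 : Real.exp b = Real.exp a * Real.exp (b - a) := by
    rw [← Real.exp_add]; congr 1; ring
  have h2 := Real.add_one_le_exp (b - a)
  have h3 : Real.exp a ≤ Real.exp B := Real.exp_le_exp.2 ha
  have h4 := Real.exp_pos a
  rw [h1]
  nlinarith

theorem FwdHolderOn.exp {f : SFT A → ℝ} {S : Set (SFT A)} (h : FwdHolderOn f S) :
    FwdHolderOn (fun x => Real.exp (f x)) S := by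
  obtain ⟨B, hB0, hB⟩ := h.exists_bound
  obtain ⟨C, β, hC, h0, h1, h⟩ := h
  refine ⟨Real.exp B * C, β, by positivity, h0, h1, fun n x hx y hy hxy => ?_⟩
  refine (abs_exp_sub_exp_le ((le_abs_self _).trans (hB x hx))
    ((le_abs_self _).trans (hB y hy))).trans ?_
  rw [mul_assoc]
  gcongr
  exact h n x hx y hy hxy

theorem coordHolder_of_eventually {f : SFT A → ℝ} {B C β : ℝ} (hB : ∀ x, |f x| ≤ B)
    (hB0 : 0 ≤ B) (hC : 0 ≤ C) (h0 : 0 < β) (h1 : β < 1) (N : ℕ)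
    (h : ∀ n, N ≤ n → ∀ x y, Agree n x y → |f x - f y| ≤ C * β ^ n) : CoordHolder f := by
  refine ⟨C + 2 * B / β ^ N, β, by positivity, h0, h1, fun n x y hxy => ?_⟩
  rcases le_or_gt N n with hn | hn
  · refine (h n hn x y hxy).trans ?_
    have : 0 ≤ 2 * B / β ^ N := by positivity
    gcongr
    linarith
  · have h2 : |f x - f y| ≤ 2 * B := by
      have := abs_sub (f x) (f y)
      linarith [hB x, hB y]
    have h3 : β ^ N ≤ β ^ n := pow_le_pow_of_le_one h0.le h1.le hn.le
    have h4 : 2 * B ≤ 2 * B / β ^ N * β ^ n := by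
      rw [div_mul_eq_mul_div, le_div_iff₀ (by positivity)]
      gcongr
    refine h2.trans (h4.trans ?_)
    gcongr
    linarith

/-- The compact set `tsupport α` has a positive distance from the complement of `U`. So for two
points with many common letters, either both lie in `U`, where the product rule applies, or the
product vanishes at both. -/
theorem CoordHolder.indicator_mul {α g : SFT A → ℝ} {U : Set (SFT A)} (hα : CoordHolder α)
    (hU : IsOpen U) (hs : tsupport α ⊆ U) (hg : FwdHolderOn g U) :
    CoordHolder (U.indicator fun x => α x * g x) := by
  obtain ⟨M, hM0, hM⟩ := hα.exists_bound
  obtain ⟨G, hG0, hG⟩ := hg.exists_bound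
  obtain ⟨C, β, hC, h0, h1, hα⟩ := hα
  obtain ⟨C', β', hC', h0', h1', hg⟩ := hg
  have hK : IsCompact (tsupport α) := (isClosed_tsupport α).isCompact
  obtain ⟨δ, hδ, hth⟩ := hK.exists_thickening_subset_open hU hs
  obtain ⟨N, hN⟩ := exists_pow_lt_of_lt_one (show 0 < δ / 4 by positivity)
    (show (1 / 2 : ℝ) < 1 by norm_num)
  have hnear : ∀ n, N ≤ n → ∀ x y, Agree n x y → x ∈ tsupport α → y ∈ U := by
    intro n hn x y hxy hx
    refine hth (Metric.mem_thickening_iff.2 ⟨x, hx, ?_⟩)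
    rw [dist_comm]
    refine (dist_le_of_agree hxy).trans_lt ?_
    have : (1 / 2 : ℝ) ^ n ≤ (1 / 2) ^ N :=
      pow_le_pow_of_le_one (by norm_num) (by norm_num) hn
    linarith
  refine coordHolder_of_eventually (B := M * G) (C := C * G + M * C') (β := max β β') ?_
    (by positivity) (by positivity) (lt_max_of_lt_left h0) (max_lt h1 h1') N ?_
  · intro x
    by_cases hx : x ∈ U
    · rw [indicator_of_mem hx, abs_mul]
      exact mul_le_mul (hM x) (hG x hx) (abs_nonneg _) hM0
    · rw [indicator_of_notMem hx, abs_zero]; positivity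
  · intro n hn x y hxy
    by_cases hk : x ∈ tsupport α ∨ y ∈ tsupport α
    · have hxy' : x ∈ U ∧ y ∈ U := by
        rcases hk with hk | hk
        · exact ⟨hs hk, hnear n hn x y hxy hk⟩
        · exact ⟨hnear n hn y x hxy.symm hk, hs hk⟩
      rw [indicator_of_mem hxy'.1, indicator_of_mem hxy'.2]
      have h2 : α x * g x - α y * g y = (α x - α y) * g x + α y * (g x - g y) := by ring
      rw [h2]
      refine (abs_add_le _ _).trans ?_
      rw [abs_mul, abs_mul]
      have h3 : |α x - α y| * |g x| ≤ (C * β ^ n) * G :=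
        mul_le_mul (hα n x y hxy) (hG x hxy'.1) (abs_nonneg _) (by positivity)
      have h4 : |α y| * |g x - g y| ≤ M * (C' * β' ^ n) :=
        mul_le_mul (hM y) (hg n x hxy'.1 y hxy'.2 hxy.fwd) (abs_nonneg _) hM0
      have h5 := add_mul_pow_le (C := C * G) (C' := M * C') (by positivity) (by positivity) h0 h0' n
      linarith
    · push Not at hk
      have hz : ∀ z, z ∉ tsupport α → U.indicator (fun x => α x * g x) z = 0 := fun z hz => by
        by_cases hU : z ∈ U
        · rw [indicator_of_mem hU, image_eq_zero_of_notMem_tsupport hz, zero_mul]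
        · exact indicator_of_notMem hU _
      rw [hz x hk.1, hz y hk.2, sub_zero, abs_zero]
      have : 0 < max β β' := lt_max_of_lt_left h0
      positivity

theorem CoordHolder.sum {ι : Type*} (s : Finset ι) {f : ι → SFT A → ℝ}
    (h : ∀ i, CoordHolder (f i)) : CoordHolder (fun x => ∑ i ∈ s, f i x) := by
  classical
  induction s using Finset.induction_on with
  | empty => simpa using coordHolder_const 0
  | insert a s ha ih =>
    simp only [Finset.sum_insert ha]
    exact (h a).add ih

theorem abs_log_sub_log_le {a b c : ℝ} (hc : 0 < c) (ha : c ≤ a) (hb : c ≤ b) :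
    |Real.log a - Real.log b| ≤ |a - b| / c := by
  wlog hab : b ≤ a generalizing a b
  · rw [abs_sub_comm, abs_sub_comm a b]
    exact this hb ha (le_of_not_ge hab)
  have ha0 := hc.trans_le ha
  have hb0 := hc.trans_le hb
  rw [abs_of_nonneg (sub_nonneg.2 (Real.log_le_log hb0 hab)), abs_of_nonneg (sub_nonneg.2 hab),
    ← Real.log_div ha0.ne' hb0.ne']
  refine (Real.log_le_sub_one_of_pos (by positivity)).trans ?_
  rw [div_sub_one hb0.ne']
  gcongr

theorem CoordHolder.log {f : SFT A → ℝ} (h : CoordHolder f) (hf : ∀ x, 0 < f x) :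
    CoordHolder (fun x => Real.log (f x)) := by
  rcases isEmpty_or_nonempty (SFT A) with he | hne
  · exact ⟨0, 1 / 2, le_rfl, by norm_num, by norm_num, fun n x => he.elim x⟩
  obtain ⟨z, -, hz⟩ := isCompact_univ.exists_isMinOn univ_nonempty h.continuous.continuousOn
  obtain ⟨C, β, hC, h0, h1, h⟩ := h
  refine ⟨C / f z, β, div_nonneg hC (hf z).le, h0, h1, fun n x y hxy => ?_⟩
  refine (abs_log_sub_log_le (hf z) (hz trivial) (hz trivial)).trans ?_
  rw [div_mul_eq_mul_div]
  have := hf z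
  gcongr
  exact h n x y hxy

/-! ### Flow-box data -/

namespace TransverseMeasureClass.FlowBoxData

variable {M : TransverseMeasureClass A} (D : M.FlowBoxData)

/-- The density of `measureOn` relative to the pullbacks of a measure representing the class,
if `v i` is the logarithmic density of the representative on the `i`-th box. -/
noncomputable def density (v : Fin D.N → SFT A → ℝ) (x : SFT A) : ℝ :=
  ∑ i, (flowBox (D.center i) (D.size i)).indicator
    (fun x => D.weight i x * Real.exp (v i (bracket (D.center i) x))) x

theorem density_pos (v : Fin D.N → SFT A → ℝ) (x : SFT A) : 0 < D.density v x := by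
  have hnn : ∀ i ∈ Finset.univ, 0 ≤ (flowBox (D.center i) (D.size i)).indicator
      (fun x => D.weight i x * Real.exp (v i (bracket (D.center i) x))) x := fun i _ =>
    indicator_nonneg (fun y _ => mul_nonneg (D.weight_nonneg i y) (Real.exp_pos _).le) x
  obtain ⟨i, hi, hpos⟩ : ∃ i ∈ Finset.univ, 0 < D.weight i x := by
    apply Finset.exists_lt_of_sum_lt
    simp [D.weight_sum x]
  refine Finset.sum_pos' hnn ⟨i, hi, ?_⟩
  rw [indicator_of_mem]
  · exact mul_pos hpos (Real.exp_pos _)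
  · exact D.weight_support i (subset_tsupport _ hpos.ne')

theorem coordHolder_density_term {v : Fin D.N → SFT A → ℝ}
    (hv : ∀ i, FwdHolderOn (v i) (localUnstable (D.center i) (D.size i))) (i : Fin D.N) :
    CoordHolder ((flowBox (D.center i) (D.size i)).indicator
      (fun x => D.weight i x * Real.exp (v i (bracket (D.center i) x)))) := by
  refine (isHolder_iff.1 (D.weight_holder i)).indicator_mul
    (isOpen_flowBox _ (D.size_le i)) (D.weight_support i) (FwdHolderOn.exp ?_)
  refine (hv i).comp (mapsTo_bracket_flowBox _ (D.size_le i)) fun n x hx y hy hxy k hk => ?_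
  rw [bracket_apply_nat_of_mem_flowBox (D.size_le i) hx,
    bracket_apply_nat_of_mem_flowBox (D.size_le i) hy]
  exact hxy k hk

theorem coordHolder_density {v : Fin D.N → SFT A → ℝ}
    (hv : ∀ i, FwdHolderOn (v i) (localUnstable (D.center i) (D.size i))) :
    CoordHolder (D.density v) :=
  CoordHolder.sum _ (D.coordHolder_density_term hv)

end TransverseMeasureClass.FlowBoxData

variable [Nonempty (SFT A)]

/-! ### Full support -/

/-- Markov property: any admissible word ending in the symbol `y 0` can be put in front of the
future of `y`. -/
theorem exists_core_iterate_eq {p y : SFT A} {k : ℕ} (hy : y ∈ core A) (h : p k = y 0) :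
    ∃ z ∈ core A, FwdAgree (k + 1) p z ∧ oneShift^[k] z = y := by
  have h0 : ((shift A)^[k] p) 0 = y 0 := by rw [shift_iterate_apply, zero_add, h]
  obtain ⟨z, hz⟩ := ((shift A).surjective.iterate k) (bracket ((shift A)^[k] p) y)
  refine ⟨retr z, retr_mem_core z, fun i hi => ?_, ?_⟩
  · rw [retr_apply_nat]
    have h1 := congrArg (fun w : SFT A => w ((i : ℤ) - k)) hz
    rw [shift_iterate_apply, bracket_apply_nonpos h0 (by omega), shift_iterate_apply,
      sub_add_cancel] at h1
    exact h1.symm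
  · rw [oneShift_iterate, hz, ← retr_of_mem hy]
    refine retr_eq_retr fun n => ?_
    rw [bracket_apply_nonneg (h0.trans (retr_apply_nonneg y le_rfl).symm) (by positivity),
      retr_apply_nat]

/-- Some symbol cylinder `[a]` has positive measure. By transitivity the given cylinder contains a
longer one which `oneShift^[k]` maps over `[a]`, and this map sends null sets to null sets. -/
theorem Conformal.measure_cylinder_ne_zero {ν : Measure (SFT A)} {θ : SFT A → ℝ}
    (hν : Conformal ν θ) (h0 : ν ≠ 0) (ht : IsTransitive A) (q : SFT A) (n : ℕ) :
    ν (core A ∩ {x | FwdAgree n q x}) ≠ 0 := by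
  intro hz
  obtain ⟨a, ha⟩ : ∃ a, ν (core A ∩ {x | x 0 = a}) ≠ 0 := by
    by_contra! hcon
    apply h0
    rw [← Measure.measure_univ_eq_zero]
    have hsub : (univ : Set (SFT A)) ⊆ (core A)ᶜ ∪ ⋃ a, (core A ∩ {x | x 0 = a}) := by
      intro x _
      by_cases hx : x ∈ core A
      · exact Or.inr (mem_iUnion.2 ⟨x 0, hx, rfl⟩)
      · exact Or.inl hx
    exact measure_mono_null hsub (measure_union_null hν.null (measure_iUnion_null hcon))
  obtain ⟨y, hyc, hya⟩ := nonempty_of_measure_ne_zero ha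
  have hopen : IsOpen {x : SFT A | FwdAgree n q x} := by
    have : {x : SFT A | FwdAgree n q x} = word n ⁻¹' {word n q} := by
      ext x; exact word_eq_iff.symm.trans eq_comm
    rw [this]
    exact (isOpen_discrete _).preimage (continuous_pi fun i => continuous_apply _)
  obtain ⟨p, hp, k, hnk, hk⟩ := ht.exists_iterate hopen (isOpen_apply_eq 0 a)
    ⟨q, (fun _ _ => rfl : FwdAgree n q q)⟩ ⟨y, hya⟩ n
  have hpk : p k = a := by
    have h1 : ((shift A)^[k] p) 0 = a := hk
    rwa [shift_iterate_apply, zero_add] at h1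
  have hnull : ν (core A ∩ {x | FwdAgree k p x}) = 0 :=
    measure_mono_null (show core A ∩ {x | FwdAgree k p x} ⊆ core A ∩ {x | FwdAgree n q x} from
      fun x hx => ⟨hx.1, FwdAgree.trans hp (FwdAgree.mono hx.2 hnk)⟩) hz
  have himg : ν (oneShift^[k] '' (core A ∩ {x | FwdAgree k p x})) = 0 := by
    rw [(hν.rn_iterate p k).rn _ Subset.rfl (hν.rn_iterate p k).measS,
      Measure.restrict_eq_zero.2 hnull, lintegral_zero_measure]
  refine ha (measure_mono_null (fun y hy => ?_) himg)
  obtain ⟨z, hz1, hz2, hz3⟩ := exists_core_iterate_eq hy.1 (hpk.trans hy.2.symm)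
  exact ⟨z, ⟨hz1, hz2.mono (Nat.le_succ k)⟩, hz3⟩

theorem Conformal.pull_agree_ne_zero {ν : Measure (SFT A)} {θ : SFT A → ℝ}
    (hν : Conformal ν θ) (h0 : ν ≠ 0) (ht : IsTransitive A) (x : SFT A) (n : ℕ) :
    pull ν (unstableTransversal x (1 / 2) (by norm_num) (by norm_num))
      (localUnstable x (1 / 2) ∩ Metric.closedBall x (4 * (1 / 2) ^ n)) ≠ 0 := by
  have hm : MeasurableSet (localUnstable x (1 / 2) ∩ Metric.closedBall x (4 * (1 / 2) ^ n)) :=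
    (measurableSet_localUnstable x (by norm_num)).inter Metric.isClosed_closedBall.measurableSet
  rw [pull_apply _ _ hm, coe_unstableTransversal, inter_eq_right.2 inter_subset_left]
  intro hz
  -- Three letters ensure `2 * (1 / 2) ^ 3 < 1 / 2`, which puts the point in the local unstable set;
  -- `n` letters give the ball.
  refine hν.measure_cylinder_ne_zero h0 ht x (n + 3) (measure_mono_null ?_ hz)
  rintro y ⟨hy, hxy⟩
  have h00 : x 0 = y 0 := hxy 0 (by omega)
  have hp : ∀ i : ℤ, i ≤ 0 → x i = (bracket x y) i :=
    fun i hi => (bracket_apply_nonpos h00 hi).symm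
  have hf : ∀ k : ℕ, (bracket x y) k = y k := fun k => bracket_apply_nonneg h00 (by positivity)
  have hfa : FwdAgree (n + 3) x (bracket x y) := fun i hi => by rw [hf]; exact hxy i hi
  refine ⟨bracket x y, ⟨mem_localUnstable_of_fwdAgree (by norm_num) hp (n := 3) (by norm_num)
    (hfa.mono (by omega)), ?_⟩, ?_⟩
  · rw [Metric.mem_closedBall, dist_comm]
    refine dist_le_of_agree fun i hi => ?_
    rcases le_total i 0 with hi' | hi'
    · exact hp i hi'
    · have := hfa i.toNat (by omega)
      rwa [show (i.toNat : ℤ) = i by omega] at this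
  · rw [retr_eq_retr hf, retr_of_mem hy]

/-- Every neighbourhood of `x` in its unstable set has positive measure, so it contains points where
`f = g`. Continuity passes this to `x`. -/
theorem Conformal.eq_of_ae_eq {ν : Measure (SFT A)} {θ f g : SFT A → ℝ}
    (hν : Conformal ν θ) (h0 : ν ≠ 0) (ht : IsTransitive A) (hf : Continuous f)
    (hg : Continuous g) {x : SFT A}
    (h : ∀ᵐ y ∂((pull ν (unstableTransversal x (1 / 2) (by norm_num) (by norm_num))).restrict
      (localUnstable x (1 / 2))), f y = g y) : f x = g x := by
  have hcl : IsClosed {y | f y = g y} := isClosed_eq hf hg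
  have hx : x ∈ closure {y | f y = g y} := by
    rw [Metric.mem_closure_iff]
    intro ε hε
    obtain ⟨n, hn⟩ := exists_pow_lt_of_lt_one (show 0 < ε / 4 by positivity)
      (show (1 / 2 : ℝ) < 1 by norm_num)
    by_contra! hcon
    refine hν.pull_agree_ne_zero h0 ht x n ?_
    rw [inter_comm, ← Measure.restrict_apply' (measurableSet_localUnstable x (by norm_num))]
    refine measure_mono_null (fun y hy => ?_) h
    intro hy'
    have h1 := hcon y hy'
    rw [Metric.mem_closedBall, dist_comm] at hy
    linarith
  rwa [hcl.closure_eq] at hx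

/-! ### Radon–Nikodym cocycles computed from flow-box data -/

namespace TransverseMeasureClass.FlowBoxData

variable {M : TransverseMeasureClass A} (D : M.FlowBoxData)

/-- The projection of the `i`-th box preserves the pullbacks of `ν`, so the pulled back
representative has density `exp (v i)` composed with the projection. Multiplying by the weights and
summing gives `density`; off its box each term vanishes on both sides. -/
theorem measureOn_rn {ν : Measure (SFT A)} {v : Fin D.N → SFT A → ℝ}
    (hv : ∀ i, FwdHolderOn (v i) (localUnstable (D.center i) (D.size i)))
    (hr : ∀ i, RN (pull ν (unstableTransversal (D.center i) _ (D.size_pos i) (D.size_le i))) (D.rep i) id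
      (localUnstable (D.center i) (D.size i)) (v i)) (T : SmallTransversal A) :
    RN (pull ν T) (D.measureOn T) id T (fun x => Real.log (D.density v x)) := by
  have hcd := D.coordHolder_density hv
  refine ⟨T.measurableSet, measurable_subtype_coe, injOn_id _,
    (hcd.log (D.density_pos v)).continuous.measurable.comp measurable_subtype_coe,
    fun E hE hEm => ?_⟩
  have hterm : ∀ i, ((pullback (D.rep i) (bracket (D.center i))
      ((T : Set (SFT A)) ∩ flowBox (D.center i) (D.size i))).withDensity
      (fun p => ENNReal.ofReal (D.weight i p))) E =
      ∫⁻ x in E, ENNReal.ofReal ((flowBox (D.center i) (D.size i)).indicator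
        (fun x => D.weight i x * Real.exp (v i (bracket (D.center i) x))) x) ∂(pull ν T) := by
    intro i
    have hi := (Holonomy.proj T (D.center i) (D.size i) (D.size_pos i)
      (D.size_le i)).isFwdIsometry
    obtain ⟨B, hB⟩ : ∃ B, B = flowBox (D.center i) (D.size i) := ⟨_, rfl⟩
    rw [← hB] at hi ⊢
    have hBm : MeasurableSet B := hB ▸ (isOpen_flowBox _ (D.size_le i)).measurableSet
    have Hκ := pullback_rn (D.rep i) hi.measS hi.meas_h hi.injOn
    have Hp : RN (pull ν T) (pull ν (unstableTransversal _ _ (D.size_pos i) (D.size_le i)))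
        (bracket (D.center i)) ((T : Set (SFT A)) ∩ B) (fun x => 0 - 0) :=
      ((pull_rn ν T).mono hi.measS hi.subset).lift (pull_rn ν _) hi.mapsTo
        fun p hp => retr_eq_retr (bracket_apply_nat_of_mem_flowBox (D.size_le i) (hB ▸ hp.2))
    have Hv := (Hp.comp_of_mapsTo (hr i) hi.mapsTo).lift Hκ (mapsTo_id _) fun _ _ => rfl
    have hκ0 : pullback (D.rep i) (bracket (D.center i)) ((T : Set (SFT A)) ∩ B)
        ((T : Set (SFT A)) ∩ B)ᶜ = 0 := by
      rw [pullback_apply hi.measS hi.meas_h hi.injOn hi.measS.compl]; simp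
    have hEB : E ∩ B ⊆ (T : Set (SFT A)) ∩ B := inter_subset_inter_left _ hE
    rw [withDensity_apply _ hEm, ← lintegral_inter_add_sdiff _ E hBm,
      setLIntegral_measure_zero (E \ B), add_zero]
    · conv_lhs => rw [← image_id (E ∩ B)]
      rw [(Hv.mono (hEm.inter hBm) hEB).lintegral_image,
        ← lintegral_inter_add_sdiff _ E hBm, setLIntegral_congr_fun (hEm.diff hBm)
          (g := fun _ => 0), lintegral_zero, add_zero]
      · refine setLIntegral_congr_fun (hEm.inter hBm) fun x hx => ?_
        simp only [id, indicator_of_mem hx.2, sub_zero, zero_add]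
        rw [mul_comm (D.weight i x), ENNReal.ofReal_mul (Real.exp_pos _).le]
      · intro x hx
        simp only [indicator_of_notMem hx.2, ENNReal.ofReal_zero]
    · exact measure_mono_null (show E \ B ⊆ ((T : Set (SFT A)) ∩ B)ᶜ from
        fun x hx hx' => hx.2 hx'.2) hκ0
  have hsum : D.measureOn T E = ∑ i, ((pullback (D.rep i) (bracket (D.center i))
      ((T : Set (SFT A)) ∩ flowBox (D.center i) (D.size i))).withDensity
      (fun p => ENNReal.ofReal (D.weight i p))) E := by
    rw [← Measure.finsetSum_apply]; rfl
  rw [image_id, hsum, Finset.sum_congr rfl fun i _ => hterm i, ← lintegral_finsetSum']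
  · refine lintegral_congr fun x => ?_
    rw [Real.exp_log (D.density_pos v x), density, ENNReal.ofReal_sum_of_nonneg]
    exact fun i _ =>
      indicator_nonneg (fun y _ => mul_nonneg (D.weight_nonneg i y) (Real.exp_pos _).le) x
  · intro i _
    have := D.coordHolder_density_term hv i
    exact (ENNReal.measurable_ofReal.comp this.continuous.measurable).aemeasurable

end TransverseMeasureClass.FlowBoxData

/-- The Radon-Nikodym cocycles of a class represented by a conformal measure are Hölder
cohomologous to that of the measure. -/
theorem Conformal.cocycle_eq {ν : Measure (SFT A)} {θ θ' : SFT A → ℝ} (hν : Conformal ν θ)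
    (h0 : ν ≠ 0) (ht : IsTransitive A) {M : TransverseMeasureClass A} (hM : Represents ν M)
    (D : M.FlowBoxData) (hD : D.IsRNCocycle θ') :
    ∃ V, CoordHolder V ∧ ∀ x, θ' x = θ x + (V x - V (shift A x)) := by
  have hrep := fun i => TransverseMeasureClass.exists_rn (hM _) (D.rep_mem i)
  choose v hv hr using hrep
  refine ⟨fun x => Real.log (D.density v x), (D.coordHolder_density hv).log (D.density_pos v),
    fun x => ?_⟩
  have hVc := ((D.coordHolder_density hv).log (D.density_pos v)).continuous
  have hθ'c := (isHolder_iff.1 hD.1).continuous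
  have hθc := hν.holder.coordHolder.continuous
  let T := unstableTransversal x (1 / 2) (by norm_num) (by norm_num)
  let T' := unstableTransversal (shift A x) (2 * (1 / 2)) (by norm_num) (by norm_num)
  have hT : (T' : Set (SFT A)) = shift A '' (T : Set (SFT A)) :=
    shift_image_localUnstable x le_rfl
  have hmaps : MapsTo (shift A) (T : Set (SFT A)) T' := by
    rw [hT]; exact mapsTo_image _ _
  -- With `V` the logarithm of the density, the derivative of `σ` from `pull ν T` to `D.measureOn
  -- T'` is computed in two ways: as `V - θ'` through `D.measureOn T`, and as `-θ + V ∘ σ` through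
  -- `pull ν T'`.
  have H1 := D.measureOn_rn hv hr T
  have H2 := (hν.shift_rn hT).comp_of_mapsTo (D.measureOn_rn hv hr T') hmaps
  have H3 : RN (D.measureOn T) (D.measureOn T') (shift A) T (fun x => -θ' x) :=
    ⟨T.measurableSet, continuous_shift.measurable.comp measurable_subtype_coe,
      (shift A).injective.injOn, hθ'c.measurable.neg.comp measurable_subtype_coe,
      hD.2 T T' hT⟩
  have H4 := H1.comp_of_mapsTo H3 (mapsTo_id _)
  have := hν.fin
  have h5 := hν.eq_of_ae_eq h0 ht (x := x) ?_ ?_ (H4.ae_eq H2)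
  · simp only [id] at h5
    linarith
  · exact hVc.add hθ'c.neg
  · exact hθc.neg.add (hVc.comp continuous_shift)

end SFT

namespace SFT

variable {r : ℕ} {A : Matrix (Fin r) (Fin r) ℕ}

/-! ### A clopen partition of unity -/

theorem mem_flowBox_of_agree {c p : SFT A} (h : ∀ i : ℤ, -1 ≤ i → i ≤ 1 → p i = c i) :
    p ∈ flowBox c 1 := by
  have h0 : p 0 = c 0 := h 0 (by norm_num) (by norm_num)
  refine (mem_flowBox le_rfl).2 ⟨h0, ?_, ?_⟩
  · rw [dist_eq_fwdDist fun i hi => (bracket_apply_nonpos h0.symm hi).symm]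
    refine (fwdDist_le (n := 2) fun i hi => ?_).trans_lt (by norm_num)
    rw [bracket_apply_nonneg h0.symm (by positivity), h i (by omega) (by omega)]
  · rw [dist_eq_add]
    have h1 : fwdDist c (bracket p c) = 0 := by
      unfold fwdDist
      rw [tsum_congr fun i : ℕ => if_pos (bracket_apply_nonneg h0 (by positivity)).symm, tsum_zero]
    have h2 := tsum_ite_agree_le (n := 1)
      (P := fun i : ℕ => c (-(i + 1 : ℤ)) = (bracket p c) (-(i + 1 : ℤ))) fun i hi => by
        rw [bracket_apply_nonpos h0 (by omega), h _ (by omega) (by omega)]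
    rw [h1]
    linarith

theorem isClopen_word (n : ℕ) (w : Fin n → Fin r) : IsClopen {x : SFT A | word n x = w} :=
  (isClopen_discrete {w}).preimage (continuous_pi fun _ => continuous_apply _)

/-! ### Reduced Hölder classes -/

theorem mem_reducedClass_iff {φ ψ : SFT A → ℝ} : ψ ∈ reducedClass φ ↔ CoordHolder ψ ∧
    ∃ u, CoordHolder u ∧ ∃ K, ∀ x, ψ x = φ x + (u (shift A x) - u x + K) := by
  simp only [reducedClass, mem_ofPred_eq, isHolder_iff]

theorem reducedClass_subset {φ ψ : SFT A → ℝ} (h : ψ ∈ reducedClass φ) :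
    reducedClass ψ ⊆ reducedClass φ := by
  intro χ hχ
  rw [mem_reducedClass_iff] at *
  obtain ⟨hψ, u, hu, K, h⟩ := h
  obtain ⟨hχ, v, hv, L, h'⟩ := hχ
  exact ⟨hχ, _, hu.add hv, K + L, fun x => by rw [h', h]; ring⟩

theorem reducedClass_symm {φ ψ : SFT A → ℝ} (hφ : CoordHolder φ) (h : ψ ∈ reducedClass φ) :
    φ ∈ reducedClass ψ := by
  rw [mem_reducedClass_iff] at *
  obtain ⟨hψ, u, hu, K, h⟩ := h
  exact ⟨hφ, _, hu.neg, -K, fun x => by rw [h]; ring⟩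

theorem self_mem_reducedClass {φ : SFT A → ℝ} (hφ : CoordHolder φ) : φ ∈ reducedClass φ :=
  mem_reducedClass_iff.2 ⟨hφ, _, coordHolder_const 0, 0, fun x => by ring⟩

/-! ### The Radon–Nikodym class of a conformal measure -/

section FlowBoxes

variable [Nonempty (SFT A)]

variable (A) in
/-- A point with prescribed symbols at the times `-1, 0, 1`. -/
noncomputable def boxCenter (w : Fin 3 → Fin r) : SFT A :=
  shift A (Classical.epsilon fun x => word 3 x = w)

theorem mem_flowBox_boxCenter (p : SFT A) :
    p ∈ flowBox (boxCenter A (word 3 ((shift A).symm p))) 1 := by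
  have h := word_eq_iff.1 (Classical.epsilon_spec
    (p := fun y : SFT A => word 3 y = word 3 ((shift A).symm p)) ⟨_, rfl⟩)
  refine mem_flowBox_of_agree fun i h1 h2 => ?_
  have h3 := h (i + 1).toNat (by omega)
  rw [show (((i + 1).toNat : ℕ) : ℤ) = i + 1 by omega, shift_symm_apply, add_sub_cancel_right]
    at h3
  exact h3.symm

/-- Flow-box data given by a clopen partition of unity and the pullbacks of a measure `ν` which
represents the class. -/
noncomputable def wordFlowBoxData {ν : Measure (SFT A)} {M : TransverseMeasureClass A}
    (hM : Represents ν M) : M.FlowBoxData where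
  N := Fintype.card (Fin 3 → Fin r)
  center i := boxCenter A ((Fintype.equivFin _).symm i)
  size _ := 1
  size_pos _ := one_pos
  size_le _ := le_rfl
  cover p := ⟨Fintype.equivFin _ (word 3 ((shift A).symm p)), by
    rw [Equiv.symm_apply_apply]; exact mem_flowBox_boxCenter p⟩
  rep i := pull ν (unstableTransversal (boxCenter A ((Fintype.equivFin _).symm i)) 1 one_pos le_rfl)
  rep_mem i := hM _
  weight i p := if word 3 ((shift A).symm p) = (Fintype.equivFin _).symm i then 1 else 0
  weight_holder i := by
    refine isHolder_iff.2 (coordHolder_of_eventually (B := 1) (C := 0) (β := 1 / 2)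
      (fun x => by split_ifs <;> simp) zero_le_one le_rfl (by norm_num) (by norm_num) 2 ?_)
    intro n hn x y hxy
    have : word 3 ((shift A).symm x) = word 3 ((shift A).symm y) := word_eq_iff.2 fun k hk => by
      rw [shift_symm_apply, shift_symm_apply]
      exact hxy _ (by omega)
    rw [this]; simp
  weight_nonneg i p := by split_ifs <;> simp
  weight_support i := by
    have hc : IsClosed {p : SFT A |
        word 3 ((shift A).symm p) = (Fintype.equivFin (Fin 3 → Fin r)).symm i} :=
      (isClopen_word 3 _).isClosed.preimage continuous_shift_symm
    refine (closure_minimal (fun p hp => ?_) hc).trans fun p hp => ?_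
    · by_contra hne
      exact hp (if_neg hne)
    · rw [← show word 3 ((shift A).symm p) = (Fintype.equivFin (Fin 3 → Fin r)).symm i from hp]
      exact mem_flowBox_boxCenter p
  weight_sum p := by
    rw [(Fintype.equivFin (Fin 3 → Fin r)).symm.sum_comp
      (fun w => if word 3 ((shift A).symm p) = w then (1 : ℝ) else 0)]
    simp

/-- The representatives are the pullbacks of `ν` themselves and the weights add up to `1`. Hence the
averaged measures have density `1` and the cocycle is exactly `θ`. -/
theorem Conformal.isRNCocycle {ν : Measure (SFT A)} {θ : SFT A → ℝ} (hν : Conformal ν θ)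
    {M : TransverseMeasureClass A} (hM : Represents ν M) :
    (wordFlowBoxData hM).IsRNCocycle θ := by
  obtain ⟨D, hD⟩ : ∃ D, D = wordFlowBoxData hM := ⟨_, rfl⟩
  have hv : ∀ i, FwdHolderOn (fun _ => (0 : ℝ)) (localUnstable (D.center i) (D.size i)) :=
    fun i => fwdHolderOn_const 0 _
  have hr : ∀ i, RN (pull ν (unstableTransversal (D.center i) _ (D.size_pos i) (D.size_le i)))
      (D.rep i) id (localUnstable (D.center i) (D.size i)) (fun _ => 0) := by
    subst hD
    exact fun i => RN.refl _ (measurableSet_localUnstable _ le_rfl)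
  have hlog : ∀ x, Real.log (D.density (fun _ _ => 0) x) = 0 := by
    intro x
    rw [TransverseMeasureClass.FlowBoxData.density]
    have : ∀ i, (flowBox (D.center i) (D.size i)).indicator
        (fun x => D.weight i x * Real.exp 0) x = D.weight i x := by
      intro i
      by_cases hx : x ∈ flowBox (D.center i) (D.size i)
      · rw [indicator_of_mem hx, Real.exp_zero, mul_one]
      · rw [indicator_of_notMem hx]
        by_contra hne
        exact hx (D.weight_support i (subset_tsupport _ (Ne.symm hne)))
    rw [Finset.sum_congr rfl fun i _ => this i, D.weight_sum, Real.log_one]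
  refine ⟨isHolder_iff.2 hν.holder.coordHolder, fun T T' hT => ?_⟩
  rw [← hD]
  have H1 := (D.measureOn_rn hv hr T).congr (fun _ _ => rfl) fun x _ => hlog x
  have H2 := (D.measureOn_rn hv hr T').congr (fun _ _ => rfl) fun x _ => hlog x
  have hmaps : MapsTo (shift A) (T : Set (SFT A)) T' := by
    rw [hT]; exact mapsTo_image _ _
  have H3 := (H1.symm_id.comp_of_mapsTo (hν.shift_rn hT) (mapsTo_id _)).comp_of_mapsTo H2 hmaps
  exact (H3.congr (v := fun x => -θ x) (fun _ _ => rfl) fun x _ => by simp).rn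

theorem Conformal.mem_reducedRNClass {ν : Measure (SFT A)} {θ : SFT A → ℝ} (hν : Conformal ν θ)
    {M : TransverseMeasureClass A} (hM : Represents ν M) : θ ∈ M.reducedRNClass :=
  ⟨wordFlowBoxData hM, θ, hν.isRNCocycle hM, self_mem_reducedClass hν.holder.coordHolder⟩

/-- The left side is a union over all choices of data. By `Conformal.cocycle_eq` each choice stays
in the class of `θ`, and `wordFlowBoxData` attains `θ`. -/
theorem Conformal.reducedRNClass_eq {ν : Measure (SFT A)} {θ : SFT A → ℝ} (hν : Conformal ν θ)
    (h0 : ν ≠ 0) (ht : IsTransitive A) {M : TransverseMeasureClass A} (hM : Represents ν M) :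
    M.reducedRNClass = reducedClass θ := by
  apply Subset.antisymm
  · rintro ψ ⟨D, θ', hD, hψ⟩
    obtain ⟨V, hV, h⟩ := hν.cocycle_eq h0 ht hM D hD
    refine reducedClass_subset ?_ hψ
    exact mem_reducedClass_iff.2 ⟨isHolder_iff.1 hD.1, _, hV.neg, 0, fun x => by rw [h]; ring⟩
  · exact fun ψ hψ => ⟨wordFlowBoxData hM, θ, hν.isRNCocycle hM, hψ⟩

/-- Change of representative of a conformal measure. -/
theorem Conformal.withDensity {ν : Measure (SFT A)} {θ w : SFT A → ℝ} (hν : Conformal ν θ)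
    (hw : FwdHolderOn w univ) :
    Conformal (ν.withDensity fun x => ENNReal.ofReal (Real.exp (w x)))
      (fun x => θ x + w x - w (shift A x)) ∧
    RN ν (ν.withDensity fun x => ENNReal.ofReal (Real.exp (w x))) id univ w := by
  have := hν.fin
  have hR : RN ν (ν.withDensity fun x => ENNReal.ofReal (Real.exp (w x))) id univ w :=
    ⟨MeasurableSet.univ, measurable_subtype_coe, injOn_id _, hw.measurable, fun E _ hE => by
      rw [image_id, withDensity_apply _ hE]⟩
  obtain ⟨B, hB0, hB⟩ := hw.exists_bound
  refine ⟨⟨?_, ?_, ?_, fun a => ?_⟩, hR⟩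
  · refine isFiniteMeasure_withDensity (ne_top_of_le_ne_top
      (b := ENNReal.ofReal (Real.exp B) * ν univ) (by finiteness) ?_)
    rw [← lintegral_const]
    exact lintegral_mono fun x => ENNReal.ofReal_le_ofReal
      (Real.exp_le_exp.2 ((le_abs_self _).trans (hB x trivial)))
  · exact withDensity_absolutelyContinuous _ _ hν.null
  · refine (hν.holder.add (hw.add (hw.comp_shift_iterate 1).neg)).congr fun x _ => ?_
    simp only [Function.iterate_one]; ring
  · have H := ((hR.symm_id.mono (hν.rn_oneShift a).measS (subset_univ _)).comp_of_mapsTo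
      (hν.rn_oneShift a) (mapsTo_id _)).comp_of_mapsTo hR (mapsTo_univ _ _)
    refine (H.congr (fun _ _ => rfl) fun x _ => ?_).rn
    have h1 : w (oneShift x) = w (shift A x) := hw.eq_of_forall_apply_eq (retr_apply_nat _)
    simp only [Function.comp_apply, id, h1]; ring

end FlowBoxes

end SFT

namespace SFT

variable {r : ℕ} {A : Matrix (Fin r) (Fin r) ℕ}

/-! ### Uniqueness of conformal measures -/

/-- Bounded distortion: the `k`-th iterates still share about `n - k` letters, so the differences
are bounded by a geometric series independent of `n`. -/
theorem exists_birkhoff_distortion {θ : SFT A → ℝ} (hθ : FwdHolderOn θ univ) :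
    ∃ D, ∀ n x y, FwdAgree (n + 1) x y → |birkhoff θ n x - birkhoff θ n y| ≤ D := by
  obtain ⟨C, β, hC, h0, h1, h⟩ := hθ
  refine ⟨C * (1 - β)⁻¹, fun n x y hxy => ?_⟩
  have h2 : |birkhoff θ n x - birkhoff θ n y| ≤ ∑ k ∈ Finset.range n, C * β ^ (n - 1 - k) := by
    rw [birkhoff, birkhoff, ← Finset.sum_sub_distrib]
    refine (Finset.abs_sum_le_sum_abs _ _).trans (Finset.sum_le_sum fun k hk => ?_)
    refine h _ _ trivial _ trivial fun i hi => ?_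
    rw [shift_iterate_apply, shift_iterate_apply]
    have := hxy (i + k) (by omega)
    exact_mod_cast this
  refine h2.trans ?_
  rw [Finset.sum_range_reflect (fun k => C * β ^ k), ← Finset.mul_sum]
  gcongr
  rw [← tsum_geometric_of_lt_one h0.le h1]
  exact (summable_geometric_of_lt_one h0.le h1).sum_le_tsum _ fun _ _ => by positivity

theorem birkhoff_add_const (θ : SFT A → ℝ) (K : ℝ) (n : ℕ) (x : SFT A) :
    birkhoff (fun x => θ x + K) n x = birkhoff θ n x + n * K := by
  simp [birkhoff, Finset.sum_add_distrib]

theorem measurableSet_word_eq (n : ℕ) (w : Fin n → Fin r) :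
    MeasurableSet {x : SFT A | word n x = w} :=
  (isClopen_word n w).isClosed.measurableSet

theorem measure_word_preimage_le {ν ν' : Measure (SFT A)} {R : ℝ≥0∞} {n : ℕ}
    (h : ∀ w : Fin n → Fin r, ν {x | word n x = w} ≤ R * ν' {x | word n x = w})
    (W : Set (Fin n → Fin r)) : ν (word n ⁻¹' W) ≤ R * ν' (word n ⁻¹' W) := by
  classical
  have h1 : ∀ μ : Measure (SFT A), μ (word n ⁻¹' W) = ∑ w ∈ W.toFinset, μ {x | word n x = w} := by
    intro μ
    rw [← coe_toFinset W]
    refine (sum_measure_preimage_singleton _ fun w _ => ?_).symm.trans ?_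
    · exact measurableSet_word_eq n w
    · simp only [coe_toFinset]; rfl
  rw [h1, h1, Finset.mul_sum]
  exact Finset.sum_le_sum fun w _ => h w

variable [Nonempty (SFT A)]

theorem measure_core_inter {ν : Measure (SFT A)} (h : ν (core A)ᶜ = 0) (E : Set (SFT A)) :
    ν (core A ∩ E) = ν E := by
  rw [inter_comm]; exact measure_inter_conull h

namespace Conformal

variable {ν : Measure (SFT A)} {θ : SFT A → ℝ}

/-- Fixing `n + 1` letters, one more than the number of iterations, makes the image of the cylinder
exactly one symbol cylinder of the core. -/
theorem measure_symbol_eq (hν : Conformal ν θ) (q : SFT A) (n : ℕ) :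
    ν {x | x 0 = q n} =
      ∫⁻ x in core A ∩ {x | FwdAgree (n + 1) q x},
        ENNReal.ofReal (Real.exp (-birkhoff θ n x)) ∂ν := by
  have hS : MeasurableSet (core A ∩ {x | FwdAgree (n + 1) q x}) :=
    measurableSet_core.inter (isClosed_fwdAgree _ _).measurableSet
  rw [← (hν.rn_iterate q n).rn _ ?_ hS, ← measure_core_inter hν.null]
  · congr 1
    ext y
    constructor
    · rintro ⟨hy, hy0⟩
      obtain ⟨z, hz, hpz, rfl⟩ := exists_core_iterate_eq (p := q) (k := n) hy
        (show q n = y 0 from (show y 0 = q n from hy0).symm)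
      exact ⟨z, ⟨hz, hpz⟩, rfl⟩
    · rintro ⟨z, ⟨hz, hpz⟩, rfl⟩
      rw [oneShift_iterate_of_mem hz]
      refine ⟨retr_mem_core _, ?_⟩
      show (retr ((shift A)^[n] z)) 0 = q n
      rw [retr_apply_nonneg _ le_rfl, shift_iterate_apply, zero_add]
      exact (hpz n (Nat.lt_succ_self n)).symm
  · exact inter_subset_inter_right _ fun x hx => FwdAgree.mono hx (Nat.le_succ n)

/-- Together with `le_measure_symbol` this is the Gibbs property: up to `exp D`, the measure of a
cylinder is `exp (birkhoff θ n q)` times that of its last symbol. -/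
theorem measure_symbol_le (hν : Conformal ν θ) {D : ℝ}
    (hD : ∀ n x y, FwdAgree (n + 1) x y → |birkhoff θ n x - birkhoff θ n y| ≤ D)
    (q : SFT A) (n : ℕ) : ν {x | x 0 = q n} ≤
      ENNReal.ofReal (Real.exp (D - birkhoff θ n q)) * ν {x | FwdAgree (n + 1) q x} := by
  rw [hν.measure_symbol_eq, ← measure_core_inter hν.null, ← setLIntegral_const]
  refine setLIntegral_mono' (measurableSet_core.inter (isClosed_fwdAgree _ _).measurableSet)
    fun x hx => ENNReal.ofReal_le_ofReal (Real.exp_le_exp.2 ?_)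
  linarith [(abs_le.1 (hD n q x hx.2)).2]

theorem le_measure_symbol (hν : Conformal ν θ) {D : ℝ}
    (hD : ∀ n x y, FwdAgree (n + 1) x y → |birkhoff θ n x - birkhoff θ n y| ≤ D)
    (q : SFT A) (n : ℕ) :
    ENNReal.ofReal (Real.exp (-D - birkhoff θ n q)) * ν {x | FwdAgree (n + 1) q x} ≤
      ν {x | x 0 = q n} := by
  rw [hν.measure_symbol_eq, ← measure_core_inter hν.null, ← setLIntegral_const]
  refine setLIntegral_mono' (measurableSet_core.inter (isClosed_fwdAgree _ _).measurableSet)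
    fun x hx => ENNReal.ofReal_le_ofReal (Real.exp_le_exp.2 ?_)
  linarith [(abs_le.1 (hD n q x hx.2)).1]

/-- Comparison of two conformal measures on cylinders. -/
theorem exists_cylinder_le {ν' : Measure (SFT A)} {K : ℝ}
    (hν : Conformal ν (fun x => θ x + K)) (hν' : Conformal ν' θ) (h0 : ν' ≠ 0)
    (ht : IsTransitive A) : ∃ R : ℝ≥0∞, R ≠ ∞ ∧ ∀ n (w : Fin (n + 1) → Fin r),
      ν {x | word (n + 1) x = w} ≤
        R * ENNReal.ofReal (Real.exp (n * K)) * ν' {x | word (n + 1) x = w} := by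
  have hf := hν.fin
  have hf' := hν'.fin
  obtain ⟨D, hD⟩ := exists_birkhoff_distortion hν'.holder
  have hDK : ∀ n x y, FwdAgree (n + 1) x y →
      |birkhoff (fun x => θ x + K) n x - birkhoff (fun x => θ x + K) n y| ≤ D := by
    intro n x y hxy
    rw [birkhoff_add_const, birkhoff_add_const, add_sub_add_right_eq_sub]
    exact hD n x y hxy
  have hpos : ∀ q : SFT A, ν' {x | x 0 = q 0} ≠ 0 := fun q hz => by
    refine hν'.measure_cylinder_ne_zero h0 ht q 1 (measure_mono_null ?_ hz)
    exact fun x hx => (hx.2 0 one_pos).symm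
  -- There are finitely many symbols, and `ν'` is positive on each one that occurs.
  obtain ⟨Q, hQ, hQle⟩ : ∃ Q : ℝ≥0∞, Q ≠ ∞ ∧ ∀ q : SFT A,
      ν {x | x 0 = q 0} ≤ Q * ν' {x | x 0 = q 0} := by
    classical
    refine ⟨∑ a, if ν' {x | x 0 = a} = 0 then 0 else ν {x | x 0 = a} / ν' {x | x 0 = a},
      ?_, fun q => ?_⟩
    · refine ENNReal.sum_ne_top.2 fun a _ => ?_
      split_ifs with ha
      · simp
      · exact ENNReal.div_ne_top (measure_ne_top _ _) ha
    · calc ν {x | x 0 = q 0} = (ν {x | x 0 = q 0} / ν' {x | x 0 = q 0}) * ν' {x | x 0 = q 0} :=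
            (ENNReal.div_mul_cancel (hpos q) (measure_ne_top _ _)).symm
        _ ≤ _ := by
            gcongr
            have := Finset.single_le_sum (f := fun a => if ν' {x | x 0 = a} = 0 then (0 : ℝ≥0∞)
              else ν {x | x 0 = a} / ν' {x | x 0 = a}) (fun a _ => zero_le) (Finset.mem_univ (q 0))
            simpa only [hpos q, if_false] using this
  refine ⟨Q * ENNReal.ofReal (Real.exp (2 * D)), by finiteness, fun n w => ?_⟩
  rcases em (∃ q : SFT A, word (n + 1) q = w) with ⟨q, rfl⟩ | hw
  · have hset : {x : SFT A | word (n + 1) x = word (n + 1) q} =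
        {x | FwdAgree (n + 1) q x} := by
      ext x; exact eq_comm.trans word_eq_iff
    rw [hset]
    have h1 := hν.le_measure_symbol hDK q n
    have h2 := hν'.measure_symbol_le hD q n
    have h3 := hQle ((shift A)^[n] q)
    rw [shift_iterate_apply, zero_add] at h3
    rw [birkhoff_add_const] at h1
    -- Both cylinders are compared through their last symbol. The Birkhoff sums of `θ` cancel,
    -- leaving two distortion factors `exp D` and the factor `exp (n * K)`.
    have h4 := h1.trans (h3.trans (mul_le_mul_right h2 Q))
    have hone : ENNReal.ofReal (Real.exp (D + birkhoff θ n q + n * K)) *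
        ENNReal.ofReal (Real.exp (-D - (birkhoff θ n q + n * K))) = 1 := by
      rw [← ENNReal.ofReal_mul (Real.exp_pos _).le, ← Real.exp_add]
      ring_nf
      simp
    have htwo : ENNReal.ofReal (Real.exp (D + birkhoff θ n q + n * K)) *
        ENNReal.ofReal (Real.exp (D - birkhoff θ n q)) =
        ENNReal.ofReal (Real.exp (2 * D)) * ENNReal.ofReal (Real.exp (n * K)) := by
      rw [← ENNReal.ofReal_mul (Real.exp_pos _).le, ← Real.exp_add,
        ← ENNReal.ofReal_mul (Real.exp_pos _).le, ← Real.exp_add]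
      ring_nf
    calc ν {x | FwdAgree (n + 1) q x}
        = ENNReal.ofReal (Real.exp (D + birkhoff θ n q + n * K)) *
          (ENNReal.ofReal (Real.exp (-D - (birkhoff θ n q + n * K))) *
            ν {x | FwdAgree (n + 1) q x}) := by rw [← mul_assoc, hone, one_mul]
      _ ≤ ENNReal.ofReal (Real.exp (D + birkhoff θ n q + n * K)) *
          (Q * (ENNReal.ofReal (Real.exp (D - birkhoff θ n q)) *
            ν' {x | FwdAgree (n + 1) q x})) := by gcongr
      _ = Q * (ENNReal.ofReal (Real.exp (D + birkhoff θ n q + n * K)) *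
          ENNReal.ofReal (Real.exp (D - birkhoff θ n q))) * ν' {x | FwdAgree (n + 1) q x} := by
          ring
      _ = _ := by rw [htwo]; ring
  · have : {x : SFT A | word (n + 1) x = w} = ∅ := by
      ext x; simp only [mem_empty_iff_false, iff_false]; exact fun hx => hw ⟨x, hx⟩
    rw [this]; simp

/-- Within the core, a closed set is the decreasing intersection of its cylinder hulls `U n`, so the
inequality passes to closed sets and, by inner regularity, to Borel sets. -/
theorem le_smul_of_cylinder_le {ν ν' : Measure (SFT A)} [IsFiniteMeasure ν]
    [IsFiniteMeasure ν'] (h0 : ν (core A)ᶜ = 0) (h0' : ν' (core A)ᶜ = 0) {R : ℝ≥0∞} (hR : R ≠ ∞)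
    (h : ∀ n (w : Fin (n + 1) → Fin r),
      ν {x | word (n + 1) x = w} ≤ R * ν' {x | word (n + 1) x = w}) : ν ≤ R • ν' := by
  have hclosed : ∀ F : Set (SFT A), IsClosed F → F ⊆ core A → ν F ≤ R * ν' F := by
    intro F hF hFc
    let U : ℕ → Set (SFT A) := fun n => word (n + 1) ⁻¹' (word (n + 1) '' F)
    have hUm : ∀ n, MeasurableSet (U n) := fun n =>
      measurable_word (n + 1) (Set.toFinite _).measurableSet
    have hanti : Antitone U := by
      intro m n hmn x hx
      obtain ⟨y, hy, hxy⟩ := hx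
      exact ⟨y, hy, word_eq_iff.2 ((word_eq_iff.1 hxy).mono (by omega))⟩
    have hint : core A ∩ (⋂ n, U n) ⊆ F := by
      rintro x ⟨hx, hxU⟩
      rw [← hF.closure_eq, Metric.mem_closure_iff]
      intro ε hε
      obtain ⟨n, hn⟩ := exists_pow_lt_of_lt_one (show 0 < ε / 4 by positivity)
        (show (1 / 2 : ℝ) < 1 by norm_num)
      obtain ⟨y, hy, hxy⟩ := mem_iInter.1 hxU n
      refine ⟨y, hy, ?_⟩
      have h1 := (word_eq_iff.1 hxy).agree_retr
      rw [retr_of_mem hx, retr_of_mem (hFc hy)] at h1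
      have := dist_le_of_agree ((h1.symm).mono (Nat.le_succ n))
      linarith
    have hlim := tendsto_measure_iInter_atTop (μ := ν')
      (fun n => (hUm n).nullMeasurableSet) hanti ⟨0, measure_ne_top _ _⟩
    have hlim' := ENNReal.Tendsto.const_mul (a := R) hlim (Or.inr hR)
    have h1 : ν F ≤ R * ν' (⋂ n, U n) := ge_of_tendsto' hlim' fun n =>
      (measure_mono (subset_preimage_image _ _)).trans (measure_word_preimage_le (h n) _)
    refine h1.trans ?_
    rw [← measure_core_inter h0']
    gcongr
  refine Measure.le_iff.2 fun E hE => ?_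
  rw [Measure.smul_apply, smul_eq_mul, ← measure_core_inter h0, ← measure_core_inter h0',
    (measurableSet_core.inter hE).measure_eq_iSup_isClosed_of_ne_top (measure_ne_top _ _)]
  refine iSup₂_le fun F hF => iSup_le fun hFc => ?_
  refine (hclosed F hFc (hF.trans inter_subset_left)).trans ?_
  gcongr

/-- If `K < 0`, the comparison on cylinders bounds the total mass of `ν` by a multiple of `exp (n *
K)`, which tends to `0`. -/
theorem const_nonneg {ν' : Measure (SFT A)} {K : ℝ}
    (hν : Conformal ν (fun x => θ x + K)) (hν' : Conformal ν' θ) (h0 : ν ≠ 0) (h0' : ν' ≠ 0)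
    (ht : IsTransitive A) : 0 ≤ K := by
  by_contra! hK
  have hf := hν'.fin
  obtain ⟨R, hR, h⟩ := hν.exists_cylinder_le hν' h0' ht
  have h1 : ∀ n : ℕ, ν univ ≤ R * ENNReal.ofReal (Real.exp (n * K)) * ν' univ := fun n => by
    simpa using measure_word_preimage_le (h n) univ
  have hlim : Tendsto (fun n : ℕ => R * ENNReal.ofReal (Real.exp (n * K)) * ν' univ) atTop
      (𝓝 (R * ENNReal.ofReal 0 * ν' univ)) := by
    refine ENNReal.Tendsto.mul_const (ENNReal.Tendsto.const_mul ?_ (Or.inr hR))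
      (Or.inr (measure_ne_top _ _))
    refine ENNReal.tendsto_ofReal (Real.tendsto_exp_atBot.comp ?_)
    exact tendsto_natCast_atTop_atTop.atTop_mul_const_of_neg hK
  have h2 : ν univ ≤ R * ENNReal.ofReal 0 * ν' univ := ge_of_tendsto' hlim h1
  rw [ENNReal.ofReal_zero, mul_zero, zero_mul] at h2
  exact h0 (Measure.measure_univ_eq_zero.1 (le_antisymm h2 zero_le))

theorem exists_le_smul {ν' : Measure (SFT A)} (hν : Conformal ν θ) (hν' : Conformal ν' θ)
    (h0' : ν' ≠ 0) (ht : IsTransitive A) : ∃ R : ℝ≥0∞, R ≠ ∞ ∧ ν ≤ R • ν' := by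
  have hf := hν.fin
  have hf' := hν'.fin
  have hν2 : Conformal ν (fun x => θ x + 0) := by simpa using hν
  obtain ⟨R, hR, h⟩ := hν2.exists_cylinder_le hν' h0' ht
  exact ⟨R, hR, le_smul_of_cylinder_le hν.null hν'.null hR fun n w => by simpa using h n w⟩

/-- Conformality is linear in the measure, and all quantities subtracted are finite. -/
theorem sub_smul {ν' : Measure (SFT A)} (hν : Conformal ν θ) (hν' : Conformal ν' θ) {c : ℝ≥0∞}
    (hc : c ≠ ∞) (hle : c • ν' ≤ ν) : Conformal (ν - c • ν') θ := by
  have hf := hν.fin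
  have hf' := hν'.fin
  have hfc : IsFiniteMeasure (c • ν') := ν'.smul_finite hc
  have hadd : ν - c • ν' + c • ν' = ν := Measure.sub_add_cancel_of_le hle
  refine ⟨inferInstance, ?_, hν.holder, fun a E hE hm => ?_⟩
  · exact le_antisymm ((Measure.sub_le _).trans hν.null.le) zero_le
  · have h1 := hν.rn a E hE hm
    have h2 := hν'.rn a E hE hm
    rw [← hadd] at h1
    rw [Measure.add_apply, Measure.restrict_add, lintegral_add_measure, Measure.restrict_smul,
      lintegral_smul_measure, Measure.smul_apply, h2, smul_eq_mul] at h1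
    refine (ENNReal.add_left_inj ?_).1 h1
    rw [← h2]
    exact ENNReal.mul_ne_top hc (measure_ne_top _ _)

/-- Conformal measures are unique up to a factor. -/
theorem exists_eq_smul {ν' : Measure (SFT A)} (hν : Conformal ν θ) (hν' : Conformal ν' θ)
    (h0 : ν ≠ 0) (h0' : ν' ≠ 0) (ht : IsTransitive A) :
    ∃ c : ℝ, ν = ENNReal.ofReal (Real.exp c) • ν' := by
  have hf := hν.fin
  have hf' := hν'.fin
  -- This is the largest `c` with `c • ν' ≤ ν`. A nonzero remainder `ν - c • ν'` would be conformal
  -- too, hence would dominate `R⁻¹ • ν'` for a finite `R`, and `c` could be increased.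
  obtain ⟨c, hcdef⟩ : ∃ c : ℝ≥0∞, c = ⨅ (E : Set (SFT A)) (_ : ν' E ≠ 0), ν E / ν' E := ⟨_, rfl⟩
  have hle : c • ν' ≤ ν := by
    refine Measure.le_iff.2 fun E _ => ?_
    rw [Measure.smul_apply, smul_eq_mul]
    by_cases hE : ν' E = 0
    · rw [hE, mul_zero]; exact zero_le
    · exact ENNReal.mul_le_of_le_div (hcdef ▸ iInf₂_le E hE)
  have hu : ν' univ ≠ 0 := fun h => h0' (Measure.measure_univ_eq_zero.1 h)
  have hctop : c ≠ ∞ := by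
    refine ne_top_of_le_ne_top (ENNReal.div_ne_top (measure_ne_top ν univ) hu) ?_
    exact hcdef ▸ iInf₂_le univ hu
  have hfc : IsFiniteMeasure (c • ν') := ν'.smul_finite hctop
  have hadd : ν - c • ν' + c • ν' = ν := Measure.sub_add_cancel_of_le hle
  have hzero : ν - c • ν' = 0 := by
    by_contra hne
    obtain ⟨R, hR, hRle⟩ := hν'.exists_le_smul (hν.sub_smul hν' hctop hle) hne ht
    have hR0 : R ≠ 0 := by
      rintro rfl
      rw [zero_smul] at hRle
      exact h0' (le_antisymm hRle (Measure.zero_le _))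
    have h1 : c + R⁻¹ ≤ c := by
      conv_rhs => rw [hcdef]
      refine le_iInf₂ fun E hE => ?_
      rw [ENNReal.le_div_iff_mul_le (Or.inl hE) (Or.inl (measure_ne_top _ _)), add_mul, add_comm]
      have h2 : ν E = (ν - c • ν') E + c * ν' E := by
        conv_lhs => rw [← hadd]
        rw [Measure.add_apply, Measure.smul_apply, smul_eq_mul]
      rw [h2]
      gcongr
      rw [mul_comm, ← div_eq_mul_inv]
      refine ENNReal.div_le_of_le_mul ?_
      rw [mul_comm]
      exact hRle E
    have h3 : R⁻¹ ≤ 0 := by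
      have := (ENNReal.add_le_add_iff_left hctop).1 (h1.trans (add_zero c).ge)
      exact this
    exact hR (ENNReal.inv_eq_zero.1 (le_antisymm h3 zero_le))
  rw [hzero, zero_add] at hadd
  have hc0 : c ≠ 0 := by
    rintro rfl
    rw [zero_smul] at hadd
    exact h0 hadd.symm
  refine ⟨Real.log c.toReal, ?_⟩
  rw [Real.exp_log (ENNReal.toReal_pos hc0 hctop), ENNReal.ofReal_toReal hctop, hadd]

end Conformal

end SFT

/-! ### Positive eigenfunctionals of positive operators -/

namespace PositiveOperator

variable {K : Type*} [TopologicalSpace K]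

/-- Positivity of a linear operator on continuous functions. -/
def IsPos (L : Module.End ℝ C(K, ℝ)) : Prop := ∀ f, 0 ≤ f → 0 ≤ L f

theorem IsPos.pow {L : Module.End ℝ C(K, ℝ)} (hL : IsPos L) (n : ℕ) : IsPos (L ^ n) := by
  induction n with
  | zero => exact fun f hf => by simpa using hf
  | succ n ih =>
    intro f hf
    rw [pow_succ', Module.End.mul_apply]
    exact hL _ (ih f hf)

theorem IsPos.mono {L : Module.End ℝ C(K, ℝ)} (hL : IsPos L) {f g : C(K, ℝ)} (h : f ≤ g) :
    L f ≤ L g := by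
  have := hL (g - f) (sub_nonneg.2 h)
  rw [map_sub] at this
  exact sub_nonneg.1 this

variable {L P : Module.End ℝ C(K, ℝ)} {c : ℝ}

theorem pow_le_pow_apply (hL : IsPos L) (hc : 0 < c) (h1 : ∀ x, c ≤ L 1 x) (n : ℕ) (x : K) :
    c ^ n ≤ (L ^ n) 1 x := by
  induction n with
  | zero => simp
  | succ n ih =>
    have h2 : c • (1 : C(K, ℝ)) ≤ L 1 := fun y => by simpa using h1 y
    have h3 := ContinuousMap.le_def.1 ((hL.pow n).mono h2) x
    rw [map_smul] at h3
    rw [pow_succ L, Module.End.mul_apply]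
    refine le_trans ?_ h3
    simp only [ContinuousMap.smul_apply, smul_eq_mul]
    rw [pow_succ']
    gcongr

/-- Partial sums of the orbit of the constant function. -/
noncomputable def orbitSum (P : Module.End ℝ C(K, ℝ)) (N : ℕ) : C(K, ℝ) :=
  ∑ n ∈ Finset.range N, (P ^ n) 1

theorem orbitSum_apply (N : ℕ) (x : K) :
    orbitSum P N x = ∑ n ∈ Finset.range N, (P ^ n) 1 x := by
  simp [orbitSum]

theorem orbitSum_nonneg (hP : IsPos P) (N : ℕ) : 0 ≤ orbitSum P N :=
  Finset.sum_nonneg fun n _ => hP.pow n 1 zero_le_one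

theorem orbitSum_mono (hP : IsPos P) {M N : ℕ} (h : M ≤ N) : orbitSum P M ≤ orbitSum P N :=
  Finset.sum_le_sum_of_subset_of_nonneg (Finset.range_subset_range.2 h)
    fun n _ _ => hP.pow n 1 zero_le_one

variable [CompactSpace K]

theorem apply_le_norm (f : C(K, ℝ)) (x : K) : f x ≤ ‖f‖ :=
  (le_abs_self _).trans (f.norm_coe_le_norm x)

theorem le_norm_smul_one (f : C(K, ℝ)) : f ≤ ‖f‖ • (1 : C(K, ℝ)) := fun x => by
  have := (le_abs_self (f x)).trans (f.norm_coe_le_norm x)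
  simpa using this

theorem IsPos.abs_apply_le {L : Module.End ℝ C(K, ℝ)} (hL : IsPos L) (f : C(K, ℝ)) (x : K) :
    |L f x| ≤ ‖f‖ * L 1 x := by
  have h1 := ContinuousMap.le_def.1 (hL.mono (le_norm_smul_one f)) x
  have h2 := ContinuousMap.le_def.1 (hL.mono (le_norm_smul_one (-f))) x
  rw [map_smul] at h1 h2
  rw [map_neg, norm_neg] at h2
  simp only [ContinuousMap.smul_apply, ContinuousMap.neg_apply, smul_eq_mul] at h1 h2
  exact abs_le.2 ⟨by linarith, h1⟩

theorem norm_eq_of_isMax [Nonempty K] {f : C(K, ℝ)} (hf : 0 ≤ f) : ∃ x, f x = ‖f‖ := by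
  obtain ⟨x, -, hx⟩ := isCompact_univ.exists_isMaxOn univ_nonempty f.continuous.continuousOn
  refine ⟨x, le_antisymm ((le_abs_self _).trans (f.norm_coe_le_norm x)) ?_⟩
  refine (ContinuousMap.norm_le _ (ContinuousMap.le_def.1 hf x)).2 fun y => ?_
  rw [Real.norm_of_nonneg (ContinuousMap.le_def.1 hf y)]
  exact hx trivial

/-- Otherwise the norms of the sums grow at least like `(1 + ε) ^ N`, and the increments, being at
least `ε` times the sums, do so too. This contradicts the subexponential growth of `P ^ N 1`. -/
theorem exists_slow_growth
    (h2 : ∀ ε > 0, ∀ᶠ n in atTop, ‖(P ^ n) (1 : C(K, ℝ))‖ ≤ (1 + ε) ^ n) {ε : ℝ} (hε : 0 < ε)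
    (N0 : ℕ) : ∃ N ≥ N0, ‖orbitSum P (N + 1)‖ ≤ (1 + ε) * ‖orbitSum P N‖ := by
  by_contra! hcon
  have hs0 : 0 < ‖orbitSum P (N0 + 1)‖ := by
    refine lt_of_le_of_lt ?_ (hcon N0 le_rfl)
    positivity
  have hgrow : ∀ k, (1 + ε) ^ k * ‖orbitSum P (N0 + 1)‖ ≤ ‖orbitSum P (N0 + 1 + k)‖ := by
    intro k
    induction k with
    | zero => simp
    | succ k ih =>
      have := (hcon (N0 + 1 + k) (by omega)).le
      rw [pow_succ', mul_assoc]
      exact (mul_le_mul_of_nonneg_left ih (by positivity)).trans this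
  have hdiff : ∀ N, N0 ≤ N → ε * ‖orbitSum P N‖ ≤ ‖(P ^ N) (1 : C(K, ℝ))‖ := by
    intro N hN
    have h3 : ‖orbitSum P (N + 1)‖ ≤ ‖orbitSum P N‖ + ‖(P ^ N) (1 : C(K, ℝ))‖ := by
      rw [orbitSum, Finset.sum_range_succ]
      exact norm_add_le _ _
    linarith [hcon N hN]
  have hlim : Tendsto (fun k : ℕ => ((1 + ε) / (1 + ε / 2)) ^ k) atTop atTop := by
    refine tendsto_pow_atTop_atTop_of_one_lt ?_
    rw [one_lt_div (by positivity)]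
    linarith
  obtain ⟨N1, hN1⟩ := eventually_atTop.1 (h2 (ε / 2) (by positivity))
  obtain ⟨k, hk1, hk2⟩ := ((hlim.eventually_gt_atTop
    ((1 + ε / 2) ^ (N0 + 1) / (ε * ‖orbitSum P (N0 + 1)‖))).and (eventually_ge_atTop N1)).exists
  have h5 := hN1 (N0 + 1 + k) (by omega)
  have h6 := (mul_le_mul_of_nonneg_left (hgrow k) hε.le).trans (hdiff (N0 + 1 + k) (by omega))
  rw [div_pow, div_lt_div_iff₀ (by positivity) (by positivity), ← pow_add] at hk1
  linarith

theorem norm_pow_add_le (hL : IsPos L) (m n : ℕ) :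
    ‖(L ^ (m + n)) 1‖ ≤ ‖(L ^ m) (1 : C(K, ℝ))‖ * ‖(L ^ n) (1 : C(K, ℝ))‖ := by
  refine (ContinuousMap.norm_le _ (by positivity)).2 fun x => ?_
  rw [pow_add, Module.End.mul_apply, Real.norm_eq_abs]
  refine ((hL.pow m).abs_apply_le _ x).trans ?_
  rw [mul_comm]
  gcongr
  exact apply_le_norm _ x

variable [Nonempty K]

/-- Normalization of a positive operator by its spectral radius. -/
theorem exists_growth_rate (hL : IsPos L) (hc : 0 < c) (h1 : ∀ x, c ≤ L 1 x) :
    ∃ l : ℝ, 0 < l ∧ (∀ n, l ^ n ≤ ‖(L ^ n) (1 : C(K, ℝ))‖) ∧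
      ∀ ε > 0, ∀ᶠ n in atTop, ‖(L ^ n) (1 : C(K, ℝ))‖ ≤ (l * (1 + ε)) ^ n := by
  obtain ⟨x0⟩ := ‹Nonempty K›
  have hlow : ∀ n, c ^ n ≤ ‖(L ^ n) (1 : C(K, ℝ))‖ := fun n =>
    (pow_le_pow_apply hL hc h1 n x0).trans
      (apply_le_norm _ x0)
  have hpos : ∀ n, 0 < ‖(L ^ n) (1 : C(K, ℝ))‖ := fun n => (pow_pos hc n).trans_le (hlow n)
  have hsub : Subadditive fun n => Real.log ‖(L ^ n) (1 : C(K, ℝ))‖ := fun m n => by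
    rw [← Real.log_mul (hpos m).ne' (hpos n).ne']
    exact Real.log_le_log (hpos _) (norm_pow_add_le hL m n)
  have hbdd : BddBelow (range fun n : ℕ => Real.log ‖(L ^ n) (1 : C(K, ℝ))‖ / n) := by
    -- The `0` covers the index `n = 0`, where the quotient by zero has the value `0`.
    refine ⟨min 0 (Real.log c), ?_⟩
    rintro _ ⟨n, rfl⟩
    rcases Nat.eq_zero_or_pos n with rfl | hn
    · simp
    · refine (min_le_right _ _).trans ?_
      simp only
      rw [le_div_iff₀ (by positivity), mul_comm, ← Real.log_pow]
      exact Real.log_le_log (by positivity) (hlow n)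
  refine ⟨Real.exp hsub.lim, Real.exp_pos _, fun n => ?_, fun ε hε => ?_⟩
  · rcases Nat.eq_zero_or_pos n with rfl | hn
    · simp
    · have := hsub.lim_le_div hbdd hn.ne'
      rw [le_div_iff₀ (by positivity)] at this
      rw [← Real.exp_nat_mul, mul_comm, ← Real.exp_log (hpos n)]
      exact Real.exp_le_exp.2 this
  · have hlt : hsub.lim < hsub.lim + Real.log (1 + ε) := by
      linarith [Real.log_pos (show 1 < 1 + ε by linarith)]
    filter_upwards [(hsub.tendsto_lim hbdd).eventually_lt_const hlt, eventually_gt_atTop 0]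
      with n hn hn0
    rw [div_lt_iff₀ (by positivity)] at hn
    rw [← Real.exp_log (hpos n), ← Real.exp_log (show 0 < 1 + ε by linarith), ← Real.exp_add,
      ← Real.exp_nat_mul, mul_comm (n : ℝ)]
    exact Real.exp_le_exp.2 hn.le

theorem norm_orbitSum_mono (hP : IsPos P) {M N : ℕ} (h : M ≤ N) :
    ‖orbitSum P M‖ ≤ ‖orbitSum P N‖ := by
  obtain ⟨x, hx⟩ := norm_eq_of_isMax (orbitSum_nonneg hP M)
  rw [← hx]
  exact (ContinuousMap.le_def.1 (orbitSum_mono hP h) x).trans (apply_le_norm _ x)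

/-- If all sums were bounded by `C`, then `P ^ (n - j) 1 ≤ C` and so `P ^ n 1 ≤ C • P ^ j 1` for all
`j < n`. Adding these at a maximum point of `P ^ n 1` gives `n ≤ C * C` for every `n`. -/
theorem orbitSum_unbounded (hP : IsPos P) (h1 : ∀ n, 1 ≤ ‖(P ^ n) (1 : C(K, ℝ))‖) (C : ℝ) :
    ∃ N, C < ‖orbitSum P N‖ := by
  by_contra! hcon
  have hC : 0 ≤ C := (norm_nonneg _).trans (hcon 0)
  obtain ⟨n, hn⟩ := exists_nat_gt (C * C)
  obtain ⟨x, hx⟩ := norm_eq_of_isMax ((hP.pow n) 1 zero_le_one)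
  have hnn : ∀ (k : ℕ) (y : K), 0 ≤ (P ^ k) 1 y := fun k y =>
    ContinuousMap.le_def.1 (hP.pow k 1 zero_le_one) y
  have hle : ∀ k (y : K), (P ^ k) 1 y ≤ C := fun k y => by
    refine le_trans ?_ ((apply_le_norm _ y).trans (hcon (k + 1)))
    rw [orbitSum_apply, Finset.sum_range_succ]
    have := Finset.sum_nonneg fun j (_ : j ∈ Finset.range k) => hnn j y
    linarith
  have hstep : ∀ j ∈ Finset.range n, (P ^ n) 1 x ≤ C * (P ^ j) 1 x := by
    intro j hj
    have hj' := Finset.mem_range.1 hj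
    have h2 : (P ^ (n - j)) 1 ≤ C • (1 : C(K, ℝ)) := fun y => by simpa using hle (n - j) y
    have h3 := ContinuousMap.le_def.1 ((hP.pow j).mono h2) x
    rw [← Module.End.mul_apply, ← pow_add, map_smul, show j + (n - j) = n by omega] at h3
    simpa using h3
  have h4 := Finset.sum_le_sum hstep
  rw [Finset.sum_const, Finset.card_range, nsmul_eq_mul, ← Finset.mul_sum, ← orbitSum_apply] at h4
  have h5 : C * orbitSum P n x ≤ C * C :=
    mul_le_mul_of_nonneg_left ((apply_le_norm _ x).trans (hcon n)) hC
  have h6 : (n : ℝ) ≤ n * (P ^ n) 1 x := le_mul_of_one_le_right (by positivity) (hx ▸ h1 n)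
  linarith

/-- The functional is the orbit average `f ↦ ∑ (P ^ n f) x` over `n < N`, divided by `‖orbitSum P
N‖`, at a maximum point `x` of the orbit sum. Applying `P` telescopes, leaving `P ^ N f x - f x`,
which is small compared with the norm of the sum. -/
theorem exists_approx_eigenfunctional (hP : IsPos P)
    (h1 : ∀ n, 1 ≤ ‖(P ^ n) (1 : C(K, ℝ))‖)
    (h2 : ∀ ε > 0, ∀ᶠ n in atTop, ‖(P ^ n) (1 : C(K, ℝ))‖ ≤ (1 + ε) ^ n) {ε : ℝ} (hε : 0 < ε) :
    ∃ Λ : C(K, ℝ) →ₗ[ℝ] ℝ, (∀ f, 0 ≤ f → 0 ≤ Λ f) ∧ Λ 1 = 1 ∧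
      ∀ f, |Λ (P f) - Λ f| ≤ ε * ‖f‖ := by
  obtain ⟨N0, hN0⟩ := orbitSum_unbounded hP h1 (2 / ε)
  obtain ⟨N, hN, hsl⟩ := exists_slow_growth h2 (half_pos hε) N0
  obtain ⟨x, hx⟩ := norm_eq_of_isMax (orbitSum_nonneg hP N)
  have hs : 2 / ε < ‖orbitSum P N‖ := hN0.trans_le (norm_orbitSum_mono hP hN)
  have hs0 : 0 < ‖orbitSum P N‖ := lt_trans (by positivity) hs
  let ev : C(K, ℝ) →ₗ[ℝ] ℝ := (ContinuousMap.evalCLM ℝ x).toLinearMap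
  have hev : ∀ f, ev f = f x := fun f => rfl
  let Λ : C(K, ℝ) →ₗ[ℝ] ℝ := ‖orbitSum P N‖⁻¹ • ∑ n ∈ Finset.range N, ev ∘ₗ (P ^ n)
  have hΛ : ∀ f, Λ f = ‖orbitSum P N‖⁻¹ * ∑ n ∈ Finset.range N, (P ^ n) f x := fun f => by
    simp [Λ, hev]
  refine ⟨Λ, fun f hf => ?_, ?_, fun f => ?_⟩
  · rw [hΛ]
    exact mul_nonneg (by positivity) (Finset.sum_nonneg fun n _ => ContinuousMap.le_def.1 (hP.pow n f hf) x)
  · rw [hΛ, ← orbitSum_apply, hx, inv_mul_cancel₀ hs0.ne']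
  · have h3 : ∑ n ∈ Finset.range N, (P ^ n) (P f) x - ∑ n ∈ Finset.range N, (P ^ n) f x =
        (P ^ N) f x - f x := by
      rw [← Finset.sum_sub_distrib]
      have := Finset.sum_range_sub (fun n => (P ^ n) f x) N
      simp only [pow_succ, Module.End.mul_apply, pow_zero, Module.End.one_apply] at this
      exact this
    -- As `x` maximizes `orbitSum P N`, the next term at `x` is at most the growth of the norm,
    -- which is slow for this `N`.
    have h4 : (P ^ N) 1 x ≤ ε / 2 * ‖orbitSum P N‖ := by
      have h5 := (apply_le_norm (orbitSum P (N + 1)) x).trans hsl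
      rw [orbitSum_apply, Finset.sum_range_succ, ← orbitSum_apply, hx] at h5
      linarith
    have h6 : |(P ^ N) f x - f x| ≤ ε * ‖orbitSum P N‖ * ‖f‖ := by
      refine (abs_sub _ _).trans ?_
      have h7 := (hP.pow N).abs_apply_le f x
      have h8 : |f x| ≤ ‖f‖ := f.norm_coe_le_norm x
      have h9 : 2 ≤ ‖orbitSum P N‖ * ε := ((div_lt_iff₀ hε).1 hs).le
      have := norm_nonneg f
      nlinarith
    rw [hΛ, hΛ, ← mul_sub, h3, abs_mul, abs_of_pos (inv_pos.2 hs0), inv_mul_le_iff₀ hs0]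
    linarith

/-- A positive operator on continuous functions which is bounded below on constants has a positive
eigenfunctional. -/
theorem exists_eigenfunctional (hL : IsPos L) (hc : 0 < c) (hc1 : ∀ x, c ≤ L 1 x) :
    ∃ l : ℝ, 0 < l ∧ ∃ Λ : C(K, ℝ) →ₗ[ℝ] ℝ, (∀ f, 0 ≤ f → 0 ≤ Λ f) ∧ Λ 1 = 1 ∧
      ∀ f, Λ (L f) = l * Λ f := by
  obtain ⟨l, hl, hl1, hl2⟩ := exists_growth_rate hL hc hc1
  have hPn : ∀ n f, ((l⁻¹ • L) ^ n) f = (l ^ n)⁻¹ • (L ^ n) f := fun n f => by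
    rw [smul_pow, inv_pow]; rfl
  have hP : IsPos (l⁻¹ • L) := fun f hf => smul_nonneg (inv_pos.2 hl).le (hL f hf)
  have hnorm : ∀ n, ‖((l⁻¹ • L) ^ n) (1 : C(K, ℝ))‖ = (l ^ n)⁻¹ * ‖(L ^ n) (1 : C(K, ℝ))‖ :=
    fun n => by rw [hPn, norm_smul, Real.norm_of_nonneg (by positivity)]
  have h1 : ∀ n, 1 ≤ ‖((l⁻¹ • L) ^ n) (1 : C(K, ℝ))‖ := fun n => by
    rw [hnorm, le_inv_mul_iff₀ (by positivity), mul_one]; exact hl1 n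
  have h2 : ∀ ε > 0, ∀ᶠ n in atTop, ‖((l⁻¹ • L) ^ n) (1 : C(K, ℝ))‖ ≤ (1 + ε) ^ n :=
    fun ε hε => by
      filter_upwards [hl2 ε hε] with n hn
      rw [hnorm, inv_mul_le_iff₀ (by positivity), ← mul_pow]
      exact hn
  choose Λ hpos hone happ using fun k : ℕ =>
    exists_approx_eigenfunctional hP h1 h2 (ε := 1 / ((k : ℝ) + 1)) (by positivity)
  have hbd : ∀ k f, |Λ k f| ≤ ‖f‖ := fun k f => by
    have h3 := hpos k (‖f‖ • 1 - f) (sub_nonneg.2 (le_norm_smul_one f))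
    have h4 := hpos k (‖f‖ • 1 + f) (by
      have := le_norm_smul_one (-f)
      rw [norm_neg] at this
      exact neg_le_iff_add_nonneg.1 this)
    rw [map_sub, map_smul, hone, smul_eq_mul, mul_one] at h3
    rw [map_add, map_smul, hone, smul_eq_mul, mul_one] at h4
    exact abs_le.2 ⟨by linarith, by linarith⟩
  -- Values on a fixed `f` lie in a compact interval, so the limit along a free ultrafilter exists.
  -- It is linear, positive and normalized, and the invariance error tends to `0`.
  let 𝓤 : Ultrafilter ℕ := hyperfilter ℕ
  have hlim : ∀ f, ∃ a, Tendsto (fun k => Λ k f) 𝓤 (𝓝 a) := fun f => by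
    obtain ⟨a, -, ha⟩ := (isCompact_Icc (a := -‖f‖) (b := ‖f‖)).ultrafilter_le_nhds
      (𝓤.map fun k => Λ k f) (by
        rw [le_principal_iff]
        exact Filter.univ_mem' (s := (fun k => Λ k f) ⁻¹' Icc (-‖f‖) ‖f‖)
          fun k => abs_le.1 (hbd k f))
    exact ⟨a, ha⟩
  choose Φ hΦ using hlim
  refine ⟨l, hl, ⟨⟨Φ, fun f g => ?_⟩, fun a f => ?_⟩, fun f hf => ?_, ?_, fun f => ?_⟩
  · refine tendsto_nhds_unique (hΦ (f + g)) (((hΦ f).add (hΦ g)).congr fun k => ?_)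
    rw [map_add]
  · refine tendsto_nhds_unique (hΦ (a • f)) (((hΦ f).const_mul a).congr fun k => ?_)
    rw [map_smul, smul_eq_mul]
  · exact ge_of_tendsto' (hΦ f) fun k => hpos k f hf
  · exact tendsto_nhds_unique (hΦ 1) (tendsto_const_nhds.congr fun k => (hone k).symm)
  · have h5 : Φ ((l⁻¹ • L) f) = Φ f := by
      have h6 : Tendsto (fun k => Λ k ((l⁻¹ • L) f) - Λ k f) 𝓤 (𝓝 0) := by
        refine squeeze_zero_norm (fun k => happ k f) ?_
        have h7 := (tendsto_one_div_add_atTop_nhds_zero_nat (𝕜 := ℝ)).mul_const ‖f‖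
        rw [zero_mul] at h7
        exact h7.mono_left Nat.hyperfilter_le_atTop
      exact sub_eq_zero.1 (tendsto_nhds_unique ((hΦ _).sub (hΦ f)) h6)
    have h8 : Φ ((l⁻¹ • L) f) = l⁻¹ * Φ (L f) := by
      refine tendsto_nhds_unique (hΦ _) (((hΦ (L f)).const_mul l⁻¹).congr fun k => ?_)
      rw [LinearMap.smul_apply, map_smul, smul_eq_mul]
    show Φ (L f) = l * Φ f
    rw [← h5, h8, mul_inv_cancel_left₀ hl.ne']

/-- The Riesz–Markov–Kakutani theorem turns the eigenfunctional into a measure. -/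
theorem exists_eigenmeasure {X : Type*} [TopologicalSpace X] [CompactSpace X] [T2Space X]
    [MeasurableSpace X] [BorelSpace X] [Nonempty X] {L : Module.End ℝ C(X, ℝ)} {c : ℝ}
    (hL : IsPos L) (hc : 0 < c) (hc1 : ∀ x, c ≤ L 1 x) :
    ∃ l : ℝ, 0 < l ∧ ∃ μ : Measure X, IsFiniteMeasure μ ∧ μ ≠ 0 ∧
      ∀ f : C(X, ℝ), ∫ x, L f x ∂μ = l * ∫ x, f x ∂μ := by
  obtain ⟨l, hl, Λ, hpos, hone, hΛ⟩ := exists_eigenfunctional hL hc hc1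
  let Λ' : CompactlySupportedContinuousMap X ℝ →ₚ[ℝ] ℝ := PositiveLinearMap.mk₀
    { toFun := fun f => Λ f.toContinuousMap
      map_add' := fun f g => map_add Λ f.toContinuousMap g.toContinuousMap
      map_smul' := fun a f => map_smul Λ a f.toContinuousMap }
    fun f hf => hpos _ hf
  have hint : ∀ f : C(X, ℝ), ∫ x, f x ∂(RealRMK.rieszMeasure Λ') = Λ f := fun f =>
    RealRMK.integral_rieszMeasure Λ' (CompactlySupportedContinuousMap.continuousMapEquiv f)
  refine ⟨l, hl, RealRMK.rieszMeasure Λ', inferInstance, fun h0 => ?_, fun f => ?_⟩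
  · have := hint 1
    rw [h0, hone] at this
    simp at this
  · rw [hint, hint, hΛ]

end PositiveOperator

namespace SFT

variable {r : ℕ} {A : Matrix (Fin r) (Fin r) ℕ}

/-- The points that may be preceded by the symbol `b`. -/
def precedable (A : Matrix (Fin r) (Fin r) ℕ) (b : Fin r) : Set (SFT A) :=
  {x | A b (x 0) = 1 ∧ ∃ z : SFT A, z 0 = b}

theorem isClopen_precedable (b : Fin r) : IsClopen (precedable A b) :=
  (isClopen_discrete {a | A b a = 1 ∧ ∃ z : SFT A, z 0 = b}).preimage (continuous_apply 0)

variable [Nonempty (SFT A)]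

/-! ### Reduction to functions of the future -/

theorem CoordHolder.exists_cohomologous {φ : SFT A → ℝ} (hφ : CoordHolder φ) :
    ∃ ψ u : SFT A → ℝ, FwdHolderOn ψ univ ∧ CoordHolder u ∧
      ∀ x, ψ x = φ x + (u (shift A x) - u x) := by
  have hφ' := hφ
  obtain ⟨C, β, hC, h0, h1, h⟩ := hφ'
  -- The terms of the series below are bounded both by `β ^ k` and, in their variation, by `β ^ (n -
  -- k)`. The better bound is at most `γ ^ (n + k)` in either case `n ≤ 2 * k` or `2 * k ≤ n`.
  obtain ⟨γ, hγ0, hγ1, hγ⟩ : ∃ γ : ℝ, 0 < γ ∧ γ < 1 ∧ γ ^ 3 = β := by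
    refine ⟨β ^ (1 / 3 : ℝ), by positivity, Real.rpow_lt_one h0.le h1 (by norm_num), ?_⟩
    rw [← Real.rpow_natCast, ← Real.rpow_mul h0.le]
    norm_num
  -- The transfer function is the sum of the `a k`, comparing the forward orbits of `x` and `retr
  -- x`, which converge exponentially.
  let a : ℕ → SFT A → ℝ := fun k x => φ ((shift A)^[k] x) - φ ((shift A)^[k] (retr x))
  have ha : ∀ k x, |a k x| ≤ C * β ^ k := fun k x => h k _ _ fun i hi => by
    rw [shift_iterate_apply, shift_iterate_apply, retr_apply_nonneg _ (by omega)]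
  have hs : ∀ x, Summable fun k => a k x := fun x =>
    Summable.of_norm_bounded ((summable_geometric_of_lt_one h0.le h1).mul_left C)
      fun k => ha k x
  have hdiff : ∀ n x y, Agree n x y → ∀ k, |a k x - a k y| ≤ 2 * C * γ ^ n * γ ^ k := by
    intro n x y hxy k
    have h2 : |a k x - a k y| ≤ 2 * C * β ^ k := by
      have := abs_sub (a k x) (a k y)
      linarith [ha k x, ha k y]
    have h3 : |a k x - a k y| ≤ 2 * C * β ^ (n - k) := by
      have h4 : ∀ x y : SFT A, Agree n x y →
          |φ ((shift A)^[k] x) - φ ((shift A)^[k] y)| ≤ C * β ^ (n - k) := fun x y hxy =>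
        h (n - k) _ _ fun i hi => by
          rw [shift_iterate_apply, shift_iterate_apply]
          exact hxy _ (by omega)
      have h5 := h4 x y hxy
      have h6 := h4 _ _ hxy.fwd.agree_retr
      have h7 : a k x - a k y = (φ ((shift A)^[k] x) - φ ((shift A)^[k] y)) -
          (φ ((shift A)^[k] (retr x)) - φ ((shift A)^[k] (retr y))) := by simp only [a]; ring
      rw [h7]
      refine (abs_sub _ _).trans ?_
      linarith
    rw [← hγ, ← pow_mul] at h2 h3
    rw [mul_assoc, ← pow_add]
    rcases le_total n (2 * k) with hk | hk
    · refine h2.trans ?_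
      gcongr ?_ * ?_
      exact pow_le_pow_of_le_one hγ0.le hγ1.le (by omega)
    · refine h3.trans ?_
      gcongr ?_ * ?_
      exact pow_le_pow_of_le_one hγ0.le hγ1.le (by omega)
  have hu : CoordHolder fun x => ∑' k, a k x := by
    refine ⟨2 * C * (1 - γ)⁻¹, γ, ?_, hγ0, hγ1, fun n x y hxy => ?_⟩
    · have : 0 < 1 - γ := by linarith
      positivity
    · rw [← (hs x).tsum_sub (hs y)]
      have h8 := tsum_of_norm_bounded (f := fun k => a k x - a k y)
        ((hasSum_geometric_of_lt_one hγ0.le hγ1).mul_left (2 * C * γ ^ n)) (hdiff n x y hxy)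
      rw [Real.norm_eq_abs] at h8
      refine h8.trans (le_of_eq ?_)
      ring
  have hret : ∀ x, ∑' k, a k (retr x) = 0 := fun x => by
    simp only [a, retr_retr, sub_self, tsum_zero]
  refine ⟨fun x => φ x + (∑' k, a k (shift A x) - ∑' k, a k x), fun x => ∑' k, a k x, ?_, hu,
    fun x => rfl⟩
  refine FwdHolderOn.congr (CoordHolder.fwdHolderOn_of_core
    (hφ.add (hu.comp_shift.add hu.neg)) fun x => ?_) fun x _ => by simp only [sub_eq_add_neg]
  -- The retractions of `σ x` and `σ (retr x)` coincide, so their contributions cancel. With the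
  -- vanishing of the sum at `retr x`, this shows that `φ + u ∘ σ - u` takes the same value at `x`
  -- and `retr x`.
  have h9 : ∑' k, a k (shift A x) - ∑' k, a k (shift A (retr x)) = ∑' k, a (k + 1) x := by
    rw [← (hs _).tsum_sub (hs _)]
    refine tsum_congr fun k => ?_
    have : retr (shift A (retr x)) = retr (shift A x) := retr_eq_retr fun n => by
      rw [shift_apply, shift_apply, retr_apply_nonneg _ (by positivity)]
    simp only [a, this, Function.iterate_succ_apply]
    ring
  have h10 := (hs x).tsum_eq_zero_add
  have h11 : a 0 x = φ x - φ (retr x) := rfl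
  have h12 := hret x
  change φ (retr x) + (∑' k, a k (shift A (retr x)) + -∑' k, a k (retr x)) =
    φ x + (∑' k, a k (shift A x) + -∑' k, a k x)
  linarith

/-! ### The transfer operator and the existence of conformal measures -/

open Classical in
/-- The point of the core over the future of `x` preceded by the symbol `b`. -/
noncomputable def prepend (b : Fin r) (x : SFT A) : SFT A :=
  if h : A b (x 0) = 1 ∧ ∃ z : SFT A, z 0 = b then
    ⟨fun i => if i ≤ 0 then (base A b) i else x (i - 1), fun i => by
      obtain ⟨h1, z, rfl⟩ := h
      rcases lt_trichotomy i 0 with hi | rfl | hi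
      · rw [if_pos hi.le, if_pos (by omega)]
        exact (base A (z 0)).allowed i
      · rw [if_pos le_rfl, if_neg (by omega), base_apply_zero]
        exact h1
      · rw [if_neg (by omega), if_neg (by omega)]
        have := x.allowed (i - 1)
        rwa [show i - 1 + 1 = i + 1 - 1 by ring] at this⟩
  else base A b

theorem prepend_apply {b : Fin r} {x : SFT A} (h : x ∈ precedable A b) (i : ℤ) :
    (prepend b x) i = if i ≤ 0 then (base A b) i else x (i - 1) := by
  rw [prepend, dif_pos (show A b (x 0) = 1 ∧ ∃ z : SFT A, z 0 = b from h)]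

theorem prepend_apply_zero {b : Fin r} {x : SFT A} (h : x ∈ precedable A b) :
    (prepend b x) 0 = b := by
  obtain ⟨z, rfl⟩ := h.2
  rw [prepend_apply h, if_pos le_rfl, base_apply_zero]

theorem prepend_mem_core {b : Fin r} {x : SFT A} (h : x ∈ precedable A b) :
    prepend b x ∈ core A := by
  refine SFT.ext (funext fun i => ?_)
  rcases le_total i 0 with hi | hi
  · rw [retr_apply_nonpos _ hi, prepend_apply_zero h, prepend_apply h, if_pos hi]
  · rw [retr_apply_nonneg _ hi]

theorem oneShift_prepend {b : Fin r} {x : SFT A} (h : x ∈ precedable A b) :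
    oneShift (prepend b x) = retr x :=
  retr_eq_retr fun n => by
    rw [shift_apply, prepend_apply h, if_neg (by omega), add_sub_cancel_right]

theorem mem_precedable_of_oneShift_eq {x y : SFT A} (h : oneShift y = retr x) :
    x ∈ precedable A (y 0) := by
  refine ⟨?_, y, rfl⟩
  have := apply_eq_of_retr_eq h 0
  rw [shift_apply] at this
  rw [← show y 1 = x 0 from this]
  exact y.allowed 0

theorem prepend_of_oneShift_eq {x y : SFT A} (hy : y ∈ core A) (h : oneShift y = retr x) :
    prepend (y 0) x = y := by
  have hx := mem_precedable_of_oneShift_eq h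
  refine SFT.ext (funext fun i => ?_)
  rw [prepend_apply hx]
  split_ifs with hi
  · rw [← retr_apply_nonpos y hi, retr_of_mem hy]
  · have := apply_eq_of_retr_eq h (i - 1).toNat
    rw [show ((i - 1).toNat : ℤ) = i - 1 by omega, shift_apply, sub_add_cancel] at this
    exact this.symm

theorem continuous_prepend (b : Fin r) : Continuous (prepend b : SFT A → SFT A) := by
  classical
  refine continuous_of_apply fun i => ?_
  have h : (fun x : SFT A => (prepend b x) i) =
      (fun q : Fin r × Fin r => if A b q.1 = 1 ∧ ∃ z : SFT A, z 0 = b then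
        (if i ≤ 0 then (base A b) i else q.2) else (base A b) i) ∘
      (fun x : SFT A => (x 0, x (i - 1))) := by
    funext x
    by_cases hx : A b (x 0) = 1 ∧ ∃ z : SFT A, z 0 = b
    · rw [prepend_apply hx, Function.comp_apply, if_pos hx]
    · rw [Function.comp_apply, if_neg hx, prepend, dif_neg hx]
  rw [h]
  exact continuous_of_discreteTopology.comp ((continuous_apply 0).prodMk (continuous_apply _))

/-- The transfer operator with potential `ψ`. -/
noncomputable def transfer (ψ : C(SFT A, ℝ)) : Module.End ℝ C(SFT A, ℝ) where
  toFun f := ∑ b, ⟨(precedable A b).indicator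
    fun x => Real.exp (ψ (prepend b x)) * f (prepend b x),
    ((Real.continuous_exp.comp (ψ.continuous.comp (continuous_prepend b))).mul
      (f.continuous.comp (continuous_prepend b))).indicator
        fun x hx => by rw [(isClopen_precedable b).frontier_eq] at hx; exact hx.elim⟩
  map_add' f g := by
    rw [← Finset.sum_add_distrib]
    refine Finset.sum_congr rfl fun b _ => ?_
    ext x
    by_cases hx : x ∈ precedable A b
    · simp [hx, mul_add]
    · simp [hx]
  map_smul' a f := by
    rw [RingHom.id_apply, Finset.smul_sum]
    refine Finset.sum_congr rfl fun b _ => ?_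
    ext x
    by_cases hx : x ∈ precedable A b
    · simp [hx, mul_left_comm]
    · simp [hx]

theorem transfer_apply (ψ f : C(SFT A, ℝ)) (x : SFT A) :
    transfer ψ f x = ∑ b, (precedable A b).indicator
      (fun x => Real.exp (ψ (prepend b x)) * f (prepend b x)) x := by
  simp [transfer]

theorem isPos_transfer (ψ : C(SFT A, ℝ)) : PositiveOperator.IsPos (transfer ψ) := by
  intro f hf
  refine ContinuousMap.le_def.2 fun x => ?_
  rw [transfer_apply]
  exact Finset.sum_nonneg fun b _ => indicator_nonneg
    (fun y _ => mul_nonneg (Real.exp_pos _).le (ContinuousMap.le_def.1 hf _)) x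

/-- Every point has at least one preimage, since its own symbol at time `-1` may be put in front of
its future. -/
theorem exp_neg_norm_le_transfer_one (ψ : C(SFT A, ℝ)) (x : SFT A) :
    Real.exp (-‖ψ‖) ≤ transfer ψ 1 x := by
  rw [transfer_apply]
  have hmem : x ∈ precedable A (x (-1)) := by
    refine ⟨?_, (shift A).symm x, ?_⟩
    · exact x.allowed (-1)
    · rw [shift_symm_apply, zero_sub]
  refine le_trans ?_ (Finset.single_le_sum (f := fun b => (precedable A b).indicator
    (fun x => Real.exp (ψ (prepend b x)) * (1 : C(SFT A, ℝ)) (prepend b x)) x)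
    (fun b _ => indicator_nonneg (fun y _ => mul_nonneg (Real.exp_pos _).le zero_le_one) x)
    (Finset.mem_univ (x (-1))))
  simp only [indicator_of_mem hmem, ContinuousMap.one_apply, mul_one]
  exact Real.exp_le_exp.2 (neg_le_of_abs_le (ψ.norm_coe_le_norm _))

/-- The dual operator applied to `μ` is the sum `η` of weighted pushforwards under `prepend b`.
Agreement of `η` and `l • μ` on continuous functions makes them equal as measures. -/
theorem lintegral_transfer {ψ : C(SFT A, ℝ)} {l : ℝ} (hl : 0 < l) {μ : Measure (SFT A)}
    [IsFiniteMeasure μ]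
    (h : ∀ f : C(SFT A, ℝ), ∫ x, transfer ψ f x ∂μ = l * ∫ x, f x ∂μ) {g : SFT A → ℝ≥0∞}
    (hg : Measurable g) :
    ∑ b, ∫⁻ x in precedable A b, ENNReal.ofReal (Real.exp (ψ (prepend b x))) *
      g (prepend b x) ∂μ = ENNReal.ofReal l * ∫⁻ x, g x ∂μ := by
  have hd : ∀ b, Measurable fun x : SFT A => ENNReal.ofReal (Real.exp (ψ (prepend b x))) :=
    fun b => ENNReal.measurable_ofReal.comp (Real.measurable_exp.comp
      (ψ.continuous.comp (continuous_prepend b)).measurable)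
  have hpb : ∀ b, Measurable (prepend b : SFT A → SFT A) := fun b =>
    (continuous_prepend b).measurable
  have hint : ∀ f : C(SFT A, ℝ), Integrable f μ := fun f =>
    f.continuous.integrable_of_hasCompactSupport (HasCompactSupport.of_compactSpace _)
  let η : Measure (SFT A) := ∑ b, ((μ.restrict (precedable A b)).withDensity
    fun x => ENNReal.ofReal (Real.exp (ψ (prepend b x)))).map (prepend b)
  have hη : ∀ g : SFT A → ℝ≥0∞, Measurable g → ∫⁻ x, g x ∂η =
      ∑ b, ∫⁻ x in precedable A b, ENNReal.ofReal (Real.exp (ψ (prepend b x))) *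
        g (prepend b x) ∂μ := by
    intro g hg
    rw [lintegral_finsetSum_measure]
    refine Finset.sum_congr rfl fun b _ => ?_
    rw [lintegral_map hg (hpb b)]
    exact lintegral_withDensity_eq_lintegral_mul _ (hd b) (hg.comp (hpb b))
  have hcont : ∀ f : BoundedContinuousFunction (SFT A) ℝ≥0,
      ∫⁻ x, f x ∂(ENNReal.ofReal l • μ) = ∫⁻ x, f x ∂η := by
    intro f
    have hfm : Measurable fun x => (f x : ℝ≥0∞) := f.continuous.measurable.coe_nnreal_ennreal
    let F : C(SFT A, ℝ) := ⟨fun x => f x, NNReal.continuous_coe.comp f.continuous⟩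
    have hF : 0 ≤ F := ContinuousMap.le_def.2 fun x => (f x).2
    have h1 : ∫⁻ x, f x ∂μ = ENNReal.ofReal (∫ x, F x ∂μ) := by
      rw [ofReal_integral_eq_lintegral_ofReal (hint F)
        (ae_of_all _ fun x => ContinuousMap.le_def.1 hF x)]
      exact lintegral_congr fun x => (ENNReal.ofReal_coe_nnreal).symm
    rw [lintegral_smul_measure, smul_eq_mul, h1, ← ENNReal.ofReal_mul hl.le, ← h F, hη _ hfm,
      ofReal_integral_eq_lintegral_ofReal (hint _)
        (ae_of_all _ fun x => ContinuousMap.le_def.1 (isPos_transfer ψ F hF) x)]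
    have hterm : ∀ b, ∫⁻ x in precedable A b, ENNReal.ofReal (Real.exp (ψ (prepend b x))) *
        (f (prepend b x) : ℝ≥0∞) ∂μ = ∫⁻ x, ENNReal.ofReal ((precedable A b).indicator
          (fun x => Real.exp (ψ (prepend b x)) * F (prepend b x)) x) ∂μ := by
      intro b
      rw [← lintegral_indicator (isClopen_precedable b).isClosed.measurableSet]
      refine lintegral_congr fun x => ?_
      by_cases hx : x ∈ precedable A b
      · rw [indicator_of_mem hx, indicator_of_mem hx, ENNReal.ofReal_mul (Real.exp_pos _).le]
        congr 1
        exact (ENNReal.ofReal_coe_nnreal).symm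
      · rw [indicator_of_notMem hx, indicator_of_notMem hx, ENNReal.ofReal_zero]
    rw [Finset.sum_congr rfl fun b _ => hterm b, ← lintegral_finsetSum]
    · refine lintegral_congr fun x => ?_
      rw [transfer_apply, ENNReal.ofReal_sum_of_nonneg]
      exact fun b _ => indicator_nonneg
        (fun y _ => mul_nonneg (Real.exp_pos _).le (ContinuousMap.le_def.1 hF _)) x
    · intro b _
      refine ENNReal.measurable_ofReal.comp (Measurable.indicator ?_
        (isClopen_precedable b).isClosed.measurableSet)
      exact ((Real.continuous_exp.comp (ψ.continuous.comp (continuous_prepend b))).mul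
        (F.continuous.comp (continuous_prepend b))).measurable
  have hfin : IsFiniteMeasure (ENNReal.ofReal l • μ) := μ.smul_finite ENNReal.ofReal_ne_top
  have heq : ENNReal.ofReal l • μ = η := ext_of_forall_lintegral_eq_of_IsFiniteMeasure hcont
  rw [← hη g hg, ← heq, lintegral_smul_measure, smul_eq_mul]

/-- Every Hölder function of the future is the cocycle of a conformal measure, up to a constant. -/
theorem exists_conformal {ψ : SFT A → ℝ} (hψ : FwdHolderOn ψ univ) :
    ∃ (ν : Measure (SFT A)) (K : ℝ), ν ≠ 0 ∧ Conformal ν (fun x => ψ x + K) := by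
  let Ψ : C(SFT A, ℝ) := ⟨ψ, hψ.coordHolder.continuous⟩
  obtain ⟨l, hl, μ, hfin, hμ0, hμ⟩ := PositiveOperator.exists_eigenmeasure (isPos_transfer Ψ)
    (Real.exp_pos _) (exp_neg_norm_le_transfer_one Ψ)
  have hl0 : ENNReal.ofReal l ≠ 0 := by simpa using hl
  have hpm : ∀ b, Measurable (prepend b : SFT A → SFT A) := fun b =>
    (continuous_prepend b).measurable
  have hok : ∀ b, MeasurableSet (precedable A b) := fun b =>
    (isClopen_precedable b).isClosed.measurableSet
  -- All prepended points lie in the core, so the transferred indicator of the complement vanishes.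
  have hnull : μ (core A)ᶜ = 0 := by
    have h1 := lintegral_transfer hl hμ
      (g := (core A)ᶜ.indicator 1) (measurable_one.indicator measurableSet_core.compl)
    rw [lintegral_indicator_one measurableSet_core.compl, Finset.sum_eq_zero] at h1
    · exact (mul_eq_zero.1 h1.symm).resolve_left hl0
    · intro b _
      rw [setLIntegral_congr_fun (hok b) (g := fun _ => 0), lintegral_zero]
      intro x hx
      simp only [indicator_of_notMem (show prepend b x ∉ (core A)ᶜ from
        fun hn => hn (prepend_mem_core hx)), mul_zero]
  have hψm : Measurable ψ := hψ.coordHolder.continuous.measurable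
  refine ⟨μ, -Real.log l, hμ0, hfin, hnull,
    hψ.add (fwdHolderOn_const _ _), fun a E hE hEm => ?_⟩
  -- The factor `exp (-ψ)` cancels the weight of the operator. As `E` lies in the cylinder of `a`,
  -- only the branch `b = a` contributes, and it gives `μ (oneShift '' E)`.
  have h1 := lintegral_transfer hl hμ (g := E.indicator fun x => ENNReal.ofReal (Real.exp (-ψ x)))
    ((ENNReal.measurable_ofReal.comp (Real.measurable_exp.comp hψm.neg)).indicator hEm)
  rw [lintegral_indicator hEm, ← lintegral_const_mul' _ _ ENNReal.ofReal_ne_top] at h1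
  have h2 : ∀ b, ∫⁻ x in precedable A b, ENNReal.ofReal (Real.exp (Ψ (prepend b x))) *
      E.indicator (fun x => ENNReal.ofReal (Real.exp (-ψ x))) (prepend b x) ∂μ =
      μ (precedable A b ∩ prepend b ⁻¹' E) := by
    intro b
    rw [← setLIntegral_one, inter_comm, ← setLIntegral_indicator ((hpm b) hEm)]
    refine setLIntegral_congr_fun (hok b) fun x _ => ?_
    by_cases hx : prepend b x ∈ E
    · rw [indicator_of_mem hx, indicator_of_mem (show x ∈ prepend b ⁻¹' E from hx),
        ← ENNReal.ofReal_mul (Real.exp_pos _).le, ← Real.exp_add]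
      simp [Ψ]
    · rw [indicator_of_notMem hx, indicator_of_notMem (show x ∉ prepend b ⁻¹' E from hx),
        mul_zero]
  have h3 : μ (oneShift '' E) = μ (precedable A a ∩ prepend a ⁻¹' E) := by
    rw [← measure_core_inter hnull, ← measure_core_inter hnull (precedable A a ∩ prepend a ⁻¹' E)]
    congr 1
    ext x
    constructor
    · rintro ⟨hx, y, hy, hyx⟩
      have hy0 : y 0 = a := (hE hy).2
      rw [← retr_of_mem hx] at hyx
      have h4 := mem_precedable_of_oneShift_eq hyx
      have h5 := prepend_of_oneShift_eq (hE hy).1 hyx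
      rw [hy0] at h4 h5
      exact ⟨hx, h4, by rw [mem_preimage, h5]; exact hy⟩
    · rintro ⟨hx, h4, h5⟩
      exact ⟨hx, prepend a x, h5, by rw [oneShift_prepend h4, retr_of_mem hx]⟩
  rw [h3, ← h2 a, ← Finset.sum_eq_single_of_mem (f := fun b => ∫⁻ x in precedable A b,
    ENNReal.ofReal (Real.exp (Ψ (prepend b x))) *
      E.indicator (fun x => ENNReal.ofReal (Real.exp (-ψ x))) (prepend b x) ∂μ) a
      (Finset.mem_univ a), h1]
  · refine setLIntegral_congr_fun hEm fun x _ => ?_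
    simp only
    rw [← ENNReal.ofReal_mul hl.le]
    congr 1
    rw [neg_add, neg_neg, Real.exp_add, Real.exp_log hl, mul_comm]
  · intro b _ hb
    rw [h2 b]
    convert measure_empty (μ := μ)
    ext x
    simp only [mem_inter_iff, mem_preimage, mem_empty_iff_false, iff_false]
    rintro ⟨hx, hx'⟩
    have := (hE hx').2
    exact hb ((prepend_apply_zero hx).symm.trans this)

end SFT

namespace SFT

variable {r : ℕ} {A : Matrix (Fin r) (Fin r) ℕ}

theorem localUnstable_subset_flowBox (x : SFT A) {ε : ℝ} (h0 : 0 < ε) (h1 : ε ≤ 1) :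
    localUnstable x ε ⊆ flowBox x ε := fun z hz =>
  ⟨x, fun n => by simpa using h0, z, hz, bracket_of_mem_localUnstable h1 hz⟩

theorem rn_smul (ν : Measure (SFT A)) (c : ℝ) :
    RN ν (ENNReal.ofReal (Real.exp c) • ν) id univ fun _ => c :=
  ⟨MeasurableSet.univ, measurable_subtype_coe, injOn_id _, measurable_const, fun E _ _ => by
    rw [image_id, setLIntegral_const, Measure.smul_apply, smul_eq_mul]⟩

variable [Nonempty (SFT A)]

/-! ### Every transverse measure class is represented by a measure on the core -/

theorem conjugating_bracket_eq_retr {x p : SFT A} {ε : ℝ} (h1 : ε ≤ 1) (hp : p ∈ flowBox x ε) :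
    conjugating (retr x) 0 (bracket x p) = retr p := by
  have h0 : x 0 = p 0 := ((mem_flowBox h1).1 hp).1.symm
  refine SFT.ext (funext fun i => ?_)
  rw [conjugating_apply (by
    rw [Nat.cast_zero, retr_apply_nonneg _ le_rfl, bracket_apply_nonpos h0 le_rfl])]
  split_ifs with hi
  · have hi' : i ≤ 0 := by simpa using hi
    rw [retr_apply_nonpos _ hi', retr_apply_nonpos _ hi', h0]
  · have hi' : 0 ≤ i := by
      have : ¬ i ≤ 0 := by simpa using hi
      omega
    rw [retr_apply_nonneg _ hi', bracket_apply_nonneg h0 hi']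

/-- Every point of a small transversal with initial word `w` is mapped to the core by a holonomy
transformation. -/
theorem exists_holonomy_retr (T : SmallTransversal A) (w : Fin 2 → Fin r) :
    ∃ S h, Holonomy T (unstableTransversal (wordRep A 2 w) 1 one_pos le_rfl) S h ∧
      (T : Set (SFT A)) ∩ {x | word 2 x = w} ⊆ S ∧
      EqOn h retr ((T : Set (SFT A)) ∩ {x | word 2 x = w}) := by
  obtain ⟨x, ε, h0, h1, hT⟩ := T.exists_chart
  have H1 := Holonomy.proj T x ε h0 h1
  have H2 := Holonomy.conj x (retr x) 0
    (fun i hi => (retr_apply_nonneg x (by simpa using hi)).symm) ε h0 h1 (by simpa using h1)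
  have H3 := Holonomy.proj (unstableTransversal (retr x) ε h0 h1) (wordRep A 2 w) 1 one_pos le_rfl
  have hret : ∀ p ∈ (T : Set (SFT A)), conjugating (retr x) 0 (bracket x p) = retr p :=
    fun p hp => conjugating_bracket_eq_retr h1 (hT hp)
  have hloc : ∀ p, word 2 p = w → retr p ∈ localUnstable (wordRep A 2 w) 1 := by
    rintro p rfl
    exact core_mem_localUnstable (wordRep_mem _ _) (retr_mem_core p) le_rfl (by norm_num) two_pos
      ((fwdAgree_wordRep 2 p).trans (fwdAgree_retr 2 p).symm)
  -- Project to the unstable set of the chart centre `x`, replace the past of `x` by that of `retr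
  -- x` (conjugation with `n = 0`), and then enter the unstable set attached to `w`. On points with
  -- word `w` the last projection is the identity.
  refine ⟨_, _, (H1.comp H2).comp H3, fun p hp => ?_, fun p hp => ?_⟩
  · have hb := mapsTo_bracket_flowBox x h1 (hT hp.1)
    refine ⟨⟨⟨hp.1, hT hp.1⟩, hb⟩, H2.isFwdIsometry.mapsTo hb, ?_⟩
    rw [Function.comp_apply, hret p hp.1]
    exact localUnstable_subset_flowBox _ one_pos le_rfl (hloc p hp.2)
  · simp only [Function.comp_apply, hret p hp.1]
    exact bracket_of_mem_localUnstable le_rfl (hloc p hp.2)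

/-- The core is partitioned by two-letter words, and each piece lies in one unstable transversal,
from which a representative is restricted. Holonomy invariance gives the derivative of `retr` on
each piece of `T`, and Hölder functions on these finitely many cylinders glue. -/
theorem TransverseMeasureClass.exists_core_measure (M : TransverseMeasureClass A) :
    ∃ ν : Measure (SFT A), IsFiniteMeasure ν ∧ ν (core A)ᶜ = 0 ∧
      ∀ T, ∀ m ∈ M.cls T, ∃ u, FwdHolderOn u T ∧ RN m ν retr T u := by
  choose m' hm' hfin using fun w : Fin 2 → Fin r =>
    M.exists_finite (unstableTransversal (wordRep A 2 w) 1 one_pos le_rfl)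
  let C : (Fin 2 → Fin r) → Set (SFT A) := fun w => core A ∩ {x | word 2 x = w}
  have hν : ∀ w, ∀ F ⊆ C w, MeasurableSet F → (∑ w, (m' w).restrict (C w)) F = m' w F := by
    intro w F hF hFm
    rw [Measure.finsetSum_apply, Finset.sum_eq_single_of_mem w (Finset.mem_univ _)]
    · rw [Measure.restrict_apply hFm, inter_eq_left.2 hF]
    · intro v _ hv
      rw [Measure.restrict_apply hFm]
      convert measure_empty (μ := m' v)
      rw [eq_empty_iff_forall_notMem]
      exact fun x hx => hv (hx.2.2.symm.trans (hF hx.1).2)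
  refine ⟨∑ w, (m' w).restrict (C w), inferInstance, ?_, fun T m hm => ?_⟩
  · rw [Measure.finsetSum_apply]
    refine Finset.sum_eq_zero fun w _ => ?_
    rw [Measure.restrict_apply measurableSet_core.compl]
    convert measure_empty (μ := m' w)
    rw [eq_empty_iff_forall_notMem]
    exact fun x hx => hx.1 hx.2.1
  · have hpiece : ∀ w, ∃ u, FwdHolderOn u ((T : Set (SFT A)) ∩ {x | word 2 x = w}) ∧
        RN m (m' w) retr ((T : Set (SFT A)) ∩ {x | word 2 x = w}) u := by
      intro w
      obtain ⟨S, h, H, hS, heq⟩ := exists_holonomy_retr T w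
      obtain ⟨u, hu, hr⟩ := M.exists_rn_holonomy H hm (hm' w)
      exact ⟨u, hu.mono hS, (hr.mono (T.measurableSet.inter (measurableSet_word_eq 2 w)) hS).congr
        heq fun _ _ => rfl⟩
    choose u hu hr using hpiece
    have hU : FwdHolderOn (fun x => u (word 2 x) x) (T : Set (SFT A)) :=
      FwdHolderOn.of_pieces 2 (fun w => {x | word 2 x = w})
        (fun x _ => ⟨word 2 x, fun y _ hxy => (word_eq_iff.2 hxy).symm⟩)
        fun w => (hu w).congr fun x hx => by rw [show word 2 x = w from hx.2]
    refine ⟨_, hU, RN.of_pieces (fun w => {x | word 2 x = w}) (measurableSet_word_eq 2) ?_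
      (fun x _ => ⟨_, rfl⟩) T.measurableSet (measurable_restrict_retr _) (injOn_retr T)
      hU.measurable fun w E hE hEm => ?_⟩
    · exact fun v w hvw => disjoint_left.2 fun x hx hx' => hvw (hx.symm.trans hx')
    · rw [hν w _ (image_subset_iff.2 fun x hx => ⟨retr_mem_core x,
          (word_eq_iff.2 (fwdAgree_retr 2 x)).trans (hE hx).2⟩) ((hr w).measurableSet_image hEm hE),
        (hr w).rn E hE hEm]
      refine setLIntegral_congr_fun hEm fun x hx => ?_
      simp only [show word 2 x = w from (hE hx).2]

theorem TransverseMeasureClass.exists_represents (M : TransverseMeasureClass A) :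
    ∃ ν : Measure (SFT A), IsFiniteMeasure ν ∧ ν (core A)ᶜ = 0 ∧ ν ≠ 0 ∧ Represents ν M := by
  obtain ⟨ν, hfin, hnull, hν⟩ := M.exists_core_measure
  refine ⟨ν, hfin, hnull, ?_, fun T => ?_⟩
  · rintro rfl
    obtain ⟨T, m, hm, h0⟩ := M.nonzero
    obtain ⟨u, -, hr⟩ := hν T m hm
    refine hr.measure_image_pos (fun hT => h0 ?_) rfl
    rw [← Measure.measure_univ_eq_zero, ← union_compl_self (T : Set (SFT A))]
    exact measure_union_null hT (compl_eq_zero hm)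
  · obtain ⟨m, hm, -⟩ := M.exists_finite T
    obtain ⟨u, hu, hr⟩ := hν T m hm
    rw [cls_eq hm, mem_holderMeasureClass]
    exact ⟨pull_compl ν T, u, hu, (hr.lift (h := id) (pull_rn ν T) (mapsTo_id _)
      fun _ _ => rfl).congr (fun _ _ => rfl) fun _ _ => sub_zero _⟩

/-- Three letters put the cylinder inside an unstable set of size `1 / 2`, whose shift is again a
small transversal. Shift-invariance applies there, and `oneShift` is the shift followed by `retr`.
-/
theorem Represents.exists_rn_oneShift {ν : Measure (SFT A)} {M : TransverseMeasureClass A}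
    (hν : Represents ν M) (hM : M.ShiftInvariant) (w : Fin 3 → Fin r) :
    ∃ u, FwdHolderOn u (core A ∩ {x | word 3 x = w}) ∧
      RN ν ν oneShift (core A ∩ {x | word 3 x = w}) u := by
  let q := wordRep A 3 w
  let T := unstableTransversal q (1 / 2) (by norm_num) (by norm_num)
  let T' := unstableTransversal (shift A q) (2 * (1 / 2)) (by norm_num) (by norm_num)
  have hT : (T' : Set (SFT A)) = shift A '' (T : Set (SFT A)) :=
    shift_image_localUnstable q le_rfl
  obtain ⟨u, hu, hrn⟩ := hM T T' hT _ (hν T) _ (hν T')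
  rw [transverselyHolderOn_iff] at hu
  have hmaps : MapsTo (shift A) (T : Set (SFT A)) T' := by
    rw [hT]; exact mapsTo_image _ _
  have hr : RN (pull ν T) (pull ν T') (shift A) T u :=
    ⟨T.measurableSet, continuous_shift.measurable.comp measurable_subtype_coe,
      (shift A).injective.injOn, hu.measurable, hrn⟩
  have hsub : core A ∩ {x | word 3 x = w} ⊆ (T : Set (SFT A)) := by
    rintro x ⟨hx, rfl⟩
    exact core_mem_localUnstable (wordRep_mem _ _) hx (by norm_num) (by norm_num) three_pos
      (fwdAgree_wordRep 3 x)
  have hmeas : MeasurableSet (core A ∩ {x | word 3 x = w}) :=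
    measurableSet_core.inter (measurableSet_word_eq 3 w)
  have hid : RN (pull ν T) ν id (core A ∩ {x | word 3 x = w}) (fun _ => 0) :=
    ((pull_rn ν T).mono hmeas hsub).congr (fun x hx => retr_of_mem hx.1) fun _ _ => rfl
  refine ⟨u, hu.mono hsub, ((hid.symm_id.comp_of_mapsTo hr hsub).comp_of_mapsTo (pull_rn ν T')
    fun x hx => hmaps (hsub hx)).congr (fun _ _ => rfl) fun x _ => by simp⟩

theorem Represents.exists_conformal {ν : Measure (SFT A)} [IsFiniteMeasure ν]
    {M : TransverseMeasureClass A} (hν : Represents ν M) (hnull : ν (core A)ᶜ = 0)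
    (hM : M.ShiftInvariant) : ∃ θ, Conformal ν θ := by
  choose u hu hr using hν.exists_rn_oneShift hM
  have hU : FwdHolderOn (fun x => u (word 3 x) x) (core A) :=
    FwdHolderOn.of_pieces 3 (fun w => {x | word 3 x = w})
      (fun x _ => ⟨word 3 x, fun y _ hxy => (word_eq_iff.2 hxy).symm⟩)
      fun w => (hu w).congr fun x hx => by rw [show word 3 x = w from hx.2]
  have hU' := hU.comp_retr
  refine ⟨fun x => -u (word 3 (retr x)) (retr x), inferInstance, hnull, hU'.neg, fun a => ?_⟩
  have hmeas : MeasurableSet (core A ∩ {x | x 0 = a}) :=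
    measurableSet_core.inter (isOpen_apply_eq 0 a).measurableSet
  simp only [neg_neg]
  refine (RN.of_pieces (fun w => {x | word 3 x = w}) (measurableSet_word_eq 3) ?_
    (fun x _ => ⟨_, rfl⟩) hmeas (continuous_oneShift.measurable.comp measurable_subtype_coe)
    (injOn_oneShift a) (hU'.mono (subset_univ _)).measurable fun w => ?_).rn
  · exact fun v w hvw => disjoint_left.2 fun x hx hx' => hvw (hx.symm.trans hx')
  · have hsub : core A ∩ {x | x 0 = a} ∩ {x | word 3 x = w} ⊆ core A ∩ {x | word 3 x = w} :=
      fun x hx => ⟨hx.1.1, hx.2⟩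
    refine (((hr w).mono (hmeas.inter (measurableSet_word_eq 3 w)) hsub).congr (fun _ _ => rfl)
      fun x hx => ?_).rn
    rw [retr_of_mem hx.1.1, show word 3 x = w from hx.2]

/-! ### Existence and uniqueness -/

/-- A Hölder transfer function between functions of the future is a function of the future. -/
theorem CoordHolder.fwdHolderOn_of_cohomologous {w θ ψ : SFT A → ℝ} {K : ℝ} (hw : CoordHolder w)
    (hθ : FwdHolderOn θ univ) (hψ : FwdHolderOn ψ univ)
    (h : ∀ x, θ x = ψ x + w (shift A x) - w x + K) : FwdHolderOn w univ := by
  refine hw.fwdHolderOn_of_core fun x => ?_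
  -- The functions `θ` and `ψ` cannot distinguish `x` from `retr x`, so this difference is constant
  -- along the orbit. It vanishes because the forward orbits converge.
  have hn : ∀ n, w (retr x) - w x = w ((shift A)^[n] (retr x)) - w ((shift A)^[n] x) := by
    intro n
    induction n with
    | zero => rfl
    | succ n ih =>
      rw [Function.iterate_succ_apply', Function.iterate_succ_apply', ih]
      have hag : ∀ k : ℕ, ((shift A)^[n] (retr x)) k = ((shift A)^[n] x) k := fun k => by
        rw [shift_iterate_apply, shift_iterate_apply, retr_apply_nonneg _ (by positivity)]
      have h1 := hθ.eq_of_forall_apply_eq hag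
      have h2 := hψ.eq_of_forall_apply_eq hag
      linarith [h ((shift A)^[n] (retr x)), h ((shift A)^[n] x)]
  obtain ⟨C, β, hC, h0, h1, hβ⟩ := hw
  have hb : ∀ n : ℕ, |w (retr x) - w x| ≤ C * β ^ n := fun n => by
    rw [hn n]
    refine hβ n _ _ fun i hi => ?_
    rw [shift_iterate_apply, shift_iterate_apply, retr_apply_nonneg _ (by omega)]
  have hlim := (tendsto_pow_atTop_nhds_zero_of_lt_one h0.le h1).const_mul C
  rw [mul_zero] at hlim
  exact sub_eq_zero.1 (abs_nonpos_iff.1 (ge_of_tendsto' hlim hb))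

theorem Represents.eq_of_rn {ν ν' : Measure (SFT A)} {M M' : TransverseMeasureClass A}
    (hν : Represents ν M) (hν' : Represents ν' M') {u : SFT A → ℝ} (hu : FwdHolderOn u univ)
    (H : RN ν ν' id univ u) : M = M' := by
  refine TransverseMeasureClass.ext (funext fun T => ?_)
  rw [TransverseMeasureClass.cls_eq (hν T), TransverseMeasureClass.cls_eq (hν' T)]
  refine holderMeasureClass_eq (u := u) (hu.mono (subset_univ _))
    ((((pull_rn ν T).comp_of_mapsTo H (mapsTo_univ _ _)).lift (h := id) (pull_rn ν' T)
      (mapsTo_id _) fun _ _ => rfl).congr (fun _ _ => rfl) fun x _ => ?_)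
  simp only [zero_add, sub_zero]
  exact hu.eq_of_forall_apply_eq (retr_apply_nat x)

/-- Multiplying `ν'` by `exp w` removes the coboundary without leaving the class. The constants then
agree by `Conformal.const_nonneg` used in both directions, so the two measures are proportional. -/
theorem Conformal.class_eq {ν ν' : Measure (SFT A)} {ψ θ w : SFT A → ℝ} {K K' : ℝ}
    {M M' : TransverseMeasureClass A} (ht : IsTransitive A)
    (hν : Conformal ν fun x => ψ x + K) (h0 : ν ≠ 0) (hM : Represents ν M)
    (hψ : FwdHolderOn ψ univ) (hν' : Conformal ν' θ) (h0' : ν' ≠ 0) (hM' : Represents ν' M')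
    (hw : CoordHolder w) (h : ∀ x, θ x = ψ x + w (shift A x) - w x + K') : M' = M := by
  have hw' := hw.fwdHolderOn_of_cohomologous hν'.holder hψ h
  obtain ⟨hc, hr⟩ := hν'.withDensity hw'
  set ν'' := ν'.withDensity fun x => ENNReal.ofReal (Real.exp (w x))
  have hc' : Conformal ν'' fun x => ψ x + K' := by
    convert hc using 2 with x
    linarith [h x]
  have h0'' : ν'' ≠ 0 := by
    intro h1
    refine hr.measure_image_pos (by rwa [Ne, Measure.measure_univ_eq_zero]) ?_
    rw [h1, Measure.coe_zero, Pi.zero_apply]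
  have key : ∀ {μ μ' : Measure (SFT A)} {a b : ℝ}, Conformal μ (fun x => ψ x + a) →
      Conformal μ' (fun x => ψ x + b) → μ ≠ 0 → μ' ≠ 0 → b ≤ a := by
    intro μ μ' a b hμ hμ' h1 h2
    have hμ2 : Conformal μ fun x => (ψ x + b) + (a - b) := by
      convert hμ using 2 with x
      ring
    linarith [Conformal.const_nonneg hμ2 hμ' h1 h2 ht]
  have hK : K' = K := le_antisymm (key hν hc' h0 h0'') (key hc' hν h0'' h0)
  subst hK
  obtain ⟨c, hc2⟩ := Conformal.exists_eq_smul hν hc' h0 h0'' ht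
  refine hM'.eq_of_rn hM (hw'.add (fwdHolderOn_const c _)) (hr.trans_id ?_)
  rw [hc2]
  exact rn_smul ν'' c

end SFT

theorem mainTheorem6 {r : ℕ} (A : Matrix (Fin r) (Fin r) ℕ)
    (hA : ∀ i j, A i j = 0 ∨ A i j = 1) (htrans : SFT.IsTransitive A)
    (φ : SFT A → ℝ) (hφ : SFT.IsHolder φ) :
    ∃! M : SFT.TransverseMeasureClass A,
      M.ShiftInvariant ∧ M.reducedRNClass = SFT.reducedClass φ := by
  have hne : Nonempty (SFT A) := ⟨htrans.choose⟩
  obtain ⟨ψ, u, hψ, hu, hψφ⟩ := (SFT.isHolder_iff.1 hφ).exists_cohomologous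
  obtain ⟨ν, K, h0, hν⟩ := SFT.exists_conformal hψ
  have hM := hν.represents_toClass h0
  have hφψ : ∀ x, φ x = ψ x + (u x - u (SFT.shift A x)) := fun x => by linarith [hψφ x]
  have hmem : (fun x => ψ x + K) ∈ SFT.reducedClass φ :=
    SFT.mem_reducedClass_iff.2 ⟨hν.holder.coordHolder, u, hu, K, fun x => by linarith [hψφ x]⟩
  refine ⟨hν.toClass h0, ⟨hν.shiftInvariant hM, ?_⟩, fun M' hM' => ?_⟩
  · rw [hν.reducedRNClass_eq h0 htrans hM]
    exact (SFT.reducedClass_subset hmem).antisymm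
      (SFT.reducedClass_subset (SFT.reducedClass_symm (SFT.isHolder_iff.1 hφ) hmem))
  · obtain ⟨ν', hfin, hnull, h0', hrep⟩ := M'.exists_represents
    obtain ⟨θ, hθ⟩ := hrep.exists_conformal hnull hM'.1
    have h1 := hθ.mem_reducedRNClass hrep
    rw [hM'.2] at h1
    obtain ⟨-, v, hv, K', h2⟩ := SFT.mem_reducedClass_iff.1 h1
    -- Here `v` carries `φ` to `θ` and `u` carries `φ` to `ψ`, so `v - u` carries `ψ` to `θ`, up to
    -- the constant.
    refine hν.class_eq (w := fun x => v x + -u x) (K' := K') htrans h0 hM hψ hθ h0' hrep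
      (hv.add hu.neg) fun x => ?_
    simp only [h2 x, hφψ x]
    ring
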